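/- Let $2\le k\le n$ and $\frac{n-1}{k-1}<p<\infty$ (so $p>1$). Let $D\subset\mathbb R^n$ be open. Let $\Omega^k_p(D)$ be the Banach space of (classes of) measurable $k$-forms with norm $\|\omega\|=\big(\int_D|\omega(x)|^p\,dx\big)^{1/p}$, where $|\cdot|$ is the Euclidean norm of covectors (the $dx_{i_1}\wedge\dots\wedge dx_{i_k}$, $i_1<\dots<i_k$, are orthonormal). Let $d$ be the exterior differential in the sense of distributions, let $Z^k_p(D)=\{\omega\in\Omega^k_p(D): d\omega=0\}$, let $\Omega^{k-1}_{p,p}(D)=\{\theta\in\Omega^{k-1}_p(D): d\theta\in\Omega^{k}_p(D)\}$ carry the norm of $\Omega^{k-1}_p(D)$, and let $$\mathcal H^{k-1}_p(D)=\Omega^{k-1}_{p,p}(D)/\ker d$$ carry the quotient norm $\|[\zeta]\|=\inf\{\|\theta\|_{\Omega^{k-1}_p(D)}: d\theta=d\zeta\}$. Suppose that $D$ is bi-Lipschitz homeomorphic to an open ball $B$ of radius $r>0$ in $\mathbb R^n$: there is a homeomorphism $\beta:D\to B$ such that $$|\beta(x)-\beta(x')|\le C|x-x'|\quad (x,x'\in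 D),\qquad |\beta^{-1}(y)-\beta^{-1}(y')|\le L|y-y'|\quad (y,y'\in B).$$ Then there is a compact linear operator $\mathscr S: Z^k_p(D)\to\mathcal H^{k-1}_p(D)$ with $d\circ\mathscr S=\mathrm{id}$. For every $\omega\in Z^k_p(D)$, $\mathscr S\omega$ is the class $[\eta]$ of a form $\eta\in\Omega^{k-1}_{p,p}(D)$ with $d\eta=\omega$, with $\delta(|\eta|^{p-2}\eta)=0$ in the sense of distributions (that is, $\int_D|\eta|^{p-2}\langle\eta,d\varphi\rangle\,dx=0$ for all smooth $(k-2)$-forms $\varphi$ with compact support in $D$), and with the smallest norm in $\Omega^{k-1}_p(D)$ among all $\theta\in\Omega^{k-1}_{p,p}(D)$ with $d\theta=\omega$. Moreover, with $$K=\frac{\sqrt{\binom nk}\,(n-k+1)}{(p(k-1)-n+1)^{1/p}}\left(\frac{n!^{\frac{p+1}{p}}}{(n-k+1)!}\right)^2,$$ one has $$\|\mathscr S\|\le r\,K\,C^{\,k-1+\frac np}\,L^{\,k+\frac np}.$$ In particular, if $L=\frac1C$, then $\|\mathscr S\|\le rK/C$, which is $K/C$ for the unit ball. -/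

import Mathlib

open MeasureTheory Set
open scoped ENNReal NNReal

set_option linter.unusedSectionVars false

noncomputable section

/-- An alternating `k`-covector on `ℝⁿ`, given by its coefficients in the basis
`dx_I = dx_{i₁} ∧ ⋯ ∧ dx_{i_k}`, `I = {i₁ < ⋯ < i_k}`; this basis is orthonormal. -/
abbrev Form (n k : ℕ) : Type :=
  EuclideanSpace ℝ {I : Finset (Fin n) // I.card = k}

namespace Form

variable {n k l m : ℕ}

/-- The sign with `dx_I ∧ dx_J = shuffleSign I J • dx_{I ∪ J}` for disjoint `I`, `J`:
minus one to the number of inversions. -/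
def shuffleSign (I J : Finset (Fin n)) : ℝ :=
  (-1) ^ ((I ×ˢ J).filter (fun q => q.2 < q.1)).card

/-- The wedge product of a `k`-covector and an `l`-covector, as an `m`-covector. It is only
meaningful for `m = k + l` (it is `0` otherwise); `m` is a free parameter to avoid casts. -/
def wedge (m : ℕ) (a : Form n k) (b : Form n l) : Form n m :=
  WithLp.toLp 2 fun K => ∑ I, ∑ J,
    if Disjoint I.1 J.1 ∧ I.1 ∪ J.1 = K.1 then shuffleSign I.1 J.1 * (a I * b J) else 0

/-- The basis covector `dx_i`. -/
def dx (i : Fin n) : Form n 1 :=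
  EuclideanSpace.single ⟨{i}, Finset.card_singleton i⟩ 1

/-- The coefficient of `dx_1 ∧ ⋯ ∧ dx_n` of a covector of top degree. -/
def top (a : Form n n) : ℝ := a ⟨Finset.univ, by simp⟩

/-- The exterior derivative `dφ = ∑ i, dx_i ∧ ∂φ/∂x_i` of a differentiable `l`-form, as a form of
degree `m`; only meaningful for `m = l + 1`. -/
def extD (m : ℕ) (φ : EuclideanSpace ℝ (Fin n) → Form n l) (x : EuclideanSpace ℝ (Fin n)) :
    Form n m :=
  ∑ i, wedge m (dx i) (fderiv ℝ φ x (EuclideanSpace.single i 1))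

lemma wedge_add_left (a a' : Form n k) (b : Form n l) :
    wedge m (a + a') b = wedge m a b + wedge m a' b := by
  ext K
  simp only [wedge, PiLp.add_apply, ← Finset.sum_add_distrib]
  refine Finset.sum_congr rfl fun I _ => Finset.sum_congr rfl fun J _ => ?_
  split_ifs <;> ring

lemma wedge_smul_left (c : ℝ) (a : Form n k) (b : Form n l) :
    wedge m (c • a) b = c • wedge m a b := by
  ext K
  simp only [wedge, PiLp.smul_apply, smul_eq_mul, Finset.mul_sum]
  refine Finset.sum_congr rfl fun I _ => Finset.sum_congr rfl fun J _ => ?_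
  split_ifs <;> ring

lemma wedge_zero_left (b : Form n l) : wedge m (0 : Form n k) b = 0 := by
  ext K; simp [wedge]

lemma wedge_zero_right (a : Form n k) : wedge m a (0 : Form n l) = 0 := by
  ext K; simp [wedge]

lemma top_add (a b : Form n n) : top (a + b) = top a + top b := rfl

lemma top_smul (c : ℝ) (a : Form n n) : top (c • a) = c * top a := rfl

lemma shuffleSign_ne_zero (I J : Finset (Fin n)) : shuffleSign I J ≠ 0 :=
  pow_ne_zero _ (by norm_num)

lemma top_wedge_single (K : {I : Finset (Fin n) // I.card = k}) (hK : K.1ᶜ.card = l)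
    (a : Form n k) (c : ℝ) :
    top (wedge n a (c • EuclideanSpace.single (⟨K.1ᶜ, hK⟩ :
      {I : Finset (Fin n) // I.card = l}) (1 : ℝ))) = shuffleSign K.1 K.1ᶜ * (a K * c) := by
  simp only [top, wedge]
  rw [Finset.sum_eq_single K, Finset.sum_eq_single ⟨K.1ᶜ, hK⟩]
  · simp [disjoint_compl_right]
  · intro J _ hJ
    simp [hJ]
  · simp
  · intro I _ hI
    refine Finset.sum_eq_zero fun J _ => ?_
    split_ifs with hc
    · by_cases hJ : J = ⟨K.1ᶜ, hK⟩
      · exfalso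
        subst hJ
        refine hI (Subtype.ext ?_)
        have h1 : IsCompl I.1 K.1ᶜ := ⟨hc.1, codisjoint_iff.2 hc.2⟩
        simpa using h1.eq_compl
      · simp [hJ]
    · rfl
  · simp

lemma continuous_wedge_right (a : Form n k) : Continuous fun b : Form n l => wedge m a b := by
  refine (PiLp.continuous_toLp 2 _).comp (continuous_pi fun K => ?_)
  refine continuous_finsetSum _ fun I _ => continuous_finsetSum _ fun J _ => ?_
  split_ifs
  · fun_prop
  · fun_prop

lemma continuous_extD {φ : EuclideanSpace ℝ (Fin n) → Form n l} (hφ : ContDiff ℝ ((⊤ : ℕ∞) : WithTop ℕ∞) φ) :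
    Continuous (extD m φ) := by
  refine continuous_finsetSum _ fun i _ => (continuous_wedge_right (dx i)).comp ?_
  exact (hφ.continuous_fderiv (by simp)).clm_apply continuous_const

lemma hasCompactSupport_extD {φ : EuclideanSpace ℝ (Fin n) → Form n l}
    (hφ : HasCompactSupport φ) : HasCompactSupport (extD m φ) := by
  refine (hφ.fderiv ℝ).mono fun x hx hx' => hx ?_
  simp [extD, hx', wedge_zero_right]

end Form

open Form

/-- `φ` is a smooth `l`-form on `ℝⁿ` with compact support contained in `D`. -/
structure IsTestForm {n l : ℕ} (D : TopologicalSpace.Opens (EuclideanSpace ℝ (Fin n)))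
    (φ : EuclideanSpace ℝ (Fin n) → Form n l) : Prop where
  smooth : ContDiff ℝ ((⊤ : ℕ∞) : WithTop ℕ∞) φ
  compact : HasCompactSupport φ
  subset : tsupport φ ⊆ D

/-- The Banach space `Ω^k_p(D)` of (classes of) `p`-integrable `k`-forms on `D`, with norm
`(∫_D |ω(x)|^p dx)^{1/p}`, where `|·|` is the Euclidean norm of covectors. -/
abbrev LpForm {n : ℕ} (D : TopologicalSpace.Opens (EuclideanSpace ℝ (Fin n))) (p : ℝ) (k : ℕ) :
    Type :=
  Lp (Form n k) (ENNReal.ofReal p)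
    (volume.restrict (D : Set (EuclideanSpace ℝ (Fin n))))

/-- `η = dω` on `D` in the sense of distributions:
`∫_D ω ∧ dφ = (-1)^{k+1} ∫_D η ∧ φ` for all test forms `φ` of complementary degree
(there are none if `k = n`, where `η` lives in the zero space). -/
def IsWeakD {n k : ℕ} (D : TopologicalSpace.Opens (EuclideanSpace ℝ (Fin n)))
    (ω : EuclideanSpace ℝ (Fin n) → Form n k) (η : EuclideanSpace ℝ (Fin n) → Form n (k + 1)) :
    Prop :=
  ∀ l : ℕ, k + 1 + l = n → ∀ φ : EuclideanSpace ℝ (Fin n) → Form n l, IsTestForm D φ →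
    ∫ x in (D : Set (EuclideanSpace ℝ (Fin n))), top (wedge n (ω x) (extD (l + 1) φ x)) =
      (-1) ^ (k + 1) *
        ∫ x in (D : Set (EuclideanSpace ℝ (Fin n))), top (wedge n (η x) (φ x))

section Spaces

variable {n : ℕ} (D : TopologicalSpace.Opens (EuclideanSpace ℝ (Fin n))) (p : ℝ)
  [Fact (1 ≤ ENNReal.ofReal p)] (k : ℕ)

variable {D p k} in
lemma LpForm.locallyIntegrable (ω : LpForm D p k) (I : {I : Finset (Fin n) // I.card = k}) :
    LocallyIntegrable (fun x => ω x I)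
      (volume.restrict (D : Set (EuclideanSpace ℝ (Fin n)))) := by
  have h := (Lp.memLp ω).locallyIntegrable Fact.out
  intro x
  obtain ⟨s, hs, hi⟩ := h x
  exact ⟨s, hs, (EuclideanSpace.proj (𝕜 := ℝ) I).integrable_comp hi⟩

variable {D p k} in
lemma LpForm.integrable_wedge (ω : LpForm D p k) {l : ℕ}
    {g : EuclideanSpace ℝ (Fin n) → Form n l} (hg : Continuous g) (hc : HasCompactSupport g) :
    Integrable (fun x => top (wedge n (ω x) (g x)))
      (volume.restrict (D : Set (EuclideanSpace ℝ (Fin n)))) := by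
  simp only [top, wedge]
  refine integrable_finsetSum _ fun I _ => integrable_finsetSum _ fun J _ => ?_
  split_ifs
  · refine Integrable.const_mul ?_ _
    have hgJ : Continuous fun x => g x J := by fun_prop
    have hcJ : HasCompactSupport fun x => g x J :=
      hc.mono fun x hx hx' => hx (by simp [hx'])
    simpa [mul_comm] using
      (LpForm.locallyIntegrable ω I).integrable_smul_left_of_hasCompactSupport hgJ hcJ
  · exact integrable_zero _ _ _

variable {D p k} in
lemma IsWeakD.zero : IsWeakD D ((0 : LpForm D p k) : EuclideanSpace ℝ (Fin n) → Form n k)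
    ((0 : LpForm D p (k + 1)) : EuclideanSpace ℝ (Fin n) → Form n (k + 1)) := by
  intro l hl φ hφ
  have h1 : ∫ x in (D : Set (EuclideanSpace ℝ (Fin n))),
      top (wedge n ((0 : LpForm D p k) x) (extD (l + 1) φ x)) = 0 := by
    refine integral_eq_zero_of_ae ?_
    filter_upwards [Lp.coeFn_zero (Form n k) (ENNReal.ofReal p)
      (volume.restrict (D : Set (EuclideanSpace ℝ (Fin n))))] with x hx
    rw [hx]; simp [wedge_zero_left, top]
  have h2 : ∫ x in (D : Set (EuclideanSpace ℝ (Fin n))),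
      top (wedge n ((0 : LpForm D p (k + 1)) x) (φ x)) = 0 := by
    refine integral_eq_zero_of_ae ?_
    filter_upwards [Lp.coeFn_zero (Form n (k + 1)) (ENNReal.ofReal p)
      (volume.restrict (D : Set (EuclideanSpace ℝ (Fin n))))] with x hx
    rw [hx]; simp [wedge_zero_left, top]
  rw [h1, h2, mul_zero]

variable {D p k} in
lemma LpForm.integral_wedge_add (ω ω' : LpForm D p k) {l : ℕ}
    {g : EuclideanSpace ℝ (Fin n) → Form n l} (hg : Continuous g) (hc : HasCompactSupport g) :
    ∫ x in (D : Set (EuclideanSpace ℝ (Fin n))), top (wedge n ((ω + ω' : LpForm D p k) x) (g x)) =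
      (∫ x in (D : Set (EuclideanSpace ℝ (Fin n))), top (wedge n (ω x) (g x))) +
        ∫ x in (D : Set (EuclideanSpace ℝ (Fin n))), top (wedge n (ω' x) (g x)) := by
  rw [← integral_add (ω.integrable_wedge hg hc) (ω'.integrable_wedge hg hc)]
  refine integral_congr_ae ?_
  filter_upwards [Lp.coeFn_add ω ω'] with x hx
  rw [hx, Pi.add_apply, wedge_add_left, top_add]

variable {D p k} in
lemma LpForm.integral_wedge_smul (c : ℝ) (ω : LpForm D p k) {l : ℕ}
    (g : EuclideanSpace ℝ (Fin n) → Form n l) :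
    ∫ x in (D : Set (EuclideanSpace ℝ (Fin n))), top (wedge n ((c • ω : LpForm D p k) x) (g x)) =
      c * ∫ x in (D : Set (EuclideanSpace ℝ (Fin n))), top (wedge n (ω x) (g x)) := by
  rw [← integral_const_mul]
  refine integral_congr_ae ?_
  filter_upwards [Lp.coeFn_smul c ω] with x hx
  rw [hx, Pi.smul_apply, wedge_smul_left, top_smul]

variable {D p k} in
lemma IsWeakD.add {ω ω' : LpForm D p k} {η η' : LpForm D p (k + 1)}
    (h : IsWeakD D ω η) (h' : IsWeakD D ω' η') :
    IsWeakD D (ω + ω' : LpForm D p k) (η + η' : LpForm D p (k + 1)) := by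
  intro l hl φ hφ
  rw [LpForm.integral_wedge_add _ _ (continuous_extD hφ.smooth) (hasCompactSupport_extD hφ.compact),
    LpForm.integral_wedge_add _ _ hφ.smooth.continuous hφ.compact, h l hl φ hφ, h' l hl φ hφ,
    mul_add]

variable {D p k} in
lemma IsWeakD.smul (c : ℝ) {ω : LpForm D p k} {η : LpForm D p (k + 1)} (h : IsWeakD D ω η) :
    IsWeakD D (c • ω : LpForm D p k) (c • η : LpForm D p (k + 1)) := by
  intro l hl φ hφ
  rw [LpForm.integral_wedge_smul, LpForm.integral_wedge_smul, h l hl φ hφ]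
  ring

variable {D p k} in
lemma LpForm.integral_wedge_sub (ω ω' : LpForm D p k) {l : ℕ}
    {g : EuclideanSpace ℝ (Fin n) → Form n l} (hg : Continuous g) (hc : HasCompactSupport g) :
    ∫ x in (D : Set (EuclideanSpace ℝ (Fin n))), top (wedge n ((ω - ω' : LpForm D p k) x) (g x)) =
      (∫ x in (D : Set (EuclideanSpace ℝ (Fin n))), top (wedge n (ω x) (g x))) -
        ∫ x in (D : Set (EuclideanSpace ℝ (Fin n))), top (wedge n (ω' x) (g x)) := by
  have h : ω - ω' = ω + (-1 : ℝ) • ω' := by rw [neg_one_smul, sub_eq_add_neg]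
  rw [h, LpForm.integral_wedge_add _ _ hg hc, LpForm.integral_wedge_smul]
  ring

variable {D p k} in
/-- The weak differential is unique. -/
lemma IsWeakD.unique {ω : LpForm D p k} {η η' : LpForm D p (k + 1)}
    (h : IsWeakD D ω η) (h' : IsWeakD D ω η') : η = η' := by
  have hz : ∀ K : {I : Finset (Fin n) // I.card = k + 1},
      ∀ᵐ x ∂(volume.restrict (D : Set (EuclideanSpace ℝ (Fin n)))),
        (η - η' : LpForm D p (k + 1)) x K = 0 := by
    intro K
    have hK : K.1ᶜ.card = n - (k + 1) := by simp [Finset.card_compl, K.2]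
    have hle : k + 1 ≤ n := by simpa [K.2] using Finset.card_le_univ K.1
    set J : {I : Finset (Fin n) // I.card = n - (k + 1)} := ⟨K.1ᶜ, hK⟩
    rw [ae_restrict_iff' D.isOpen.measurableSet]
    refine D.isOpen.ae_eq_zero_of_integral_contDiff_smul_eq_zero (μ := volume)
      (f := fun x => (η - η' : LpForm D p (k + 1)) x K)
      (locallyIntegrableOn_of_locallyIntegrable_restrict (LpForm.locallyIntegrable (η - η') K))
      fun g hg hgc hgs => ?_
    set φ : EuclideanSpace ℝ (Fin n) → Form n (n - (k + 1)) :=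
      fun x => g x • EuclideanSpace.single J (1 : ℝ)
    have hsub : Function.support φ ⊆ Function.support g :=
      fun x hx hx' => hx (by simp [φ, hx'])
    have hφ : IsTestForm D φ :=
      ⟨hg.smul contDiff_const, hgc.mono hsub, (closure_mono hsub).trans hgs⟩
    have e := (h _ (by omega) φ hφ).symm.trans (h' _ (by omega) φ hφ)
    have e' := mul_left_cancel₀ (pow_ne_zero _ (by norm_num : (-1 : ℝ) ≠ 0)) e
    have e2 := LpForm.integral_wedge_sub η η' hφ.smooth.continuous hφ.compact
    rw [e', sub_self] at e2
    simp only [φ, J, top_wedge_single K hK, integral_const_mul] at e2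
    have e3 := (mul_eq_zero.1 e2).resolve_left (shuffleSign_ne_zero _ _)
    rw [← e3, ← integral_indicator D.isOpen.measurableSet]
    refine integral_congr_ae (Filter.Eventually.of_forall fun x => ?_)
    by_cases hx : x ∈ (D : Set (EuclideanSpace ℝ (Fin n)))
    · simp [hx, mul_comm]
    · have : g x = 0 := by
        by_contra hne
        exact hx (hgs (subset_closure hne))
      rw [indicator_of_notMem hx]
      exact (smul_eq_zero_of_left this _)
  rw [← sub_eq_zero]
  refine Lp.ext ?_
  filter_upwards [ae_all_iff.2 hz, Lp.coeFn_zero (Form n (k + 1)) (ENNReal.ofReal p)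
      (volume.restrict (D : Set (EuclideanSpace ℝ (Fin n))))] with x hx h0
  rw [h0]
  ext K
  simpa using hx K

/-- `Ω^k_{p,p}(D)`: the forms in `Ω^k_p(D)` whose weak differential is in `Ω^{k+1}_p(D)`,
with the norm of `Ω^k_p(D)`. -/
def SobolevForm : Submodule ℝ (LpForm D p k) where
  carrier := {ω | ∃ η : LpForm D p (k + 1), IsWeakD D ω η}
  add_mem' := fun ⟨η, h⟩ ⟨η', h'⟩ => ⟨η + η', h.add h'⟩
  zero_mem' := ⟨0, IsWeakD.zero⟩
  smul_mem' := fun c _ ⟨η, h⟩ => ⟨c • η, h.smul c⟩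

/-- The weak exterior differential `d : Ω^k_{p,p}(D) → Ω^{k+1}_p(D)`. -/
def SobolevForm.d : SobolevForm D p k →ₗ[ℝ] LpForm D p (k + 1) where
  toFun ω := ω.2.choose
  map_add' ω ω' :=
    IsWeakD.unique (ω + ω').2.choose_spec (ω.2.choose_spec.add ω'.2.choose_spec)
  map_smul' c ω := IsWeakD.unique (c • ω).2.choose_spec (ω.2.choose_spec.smul c)

variable {D p k} in
lemma SobolevForm.d_eq_iff (ω : SobolevForm D p k) (η : LpForm D p (k + 1)) :
    SobolevForm.d D p k ω = η ↔ IsWeakD D ω.1 η :=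
  ⟨fun h => h ▸ ω.2.choose_spec, fun h => IsWeakD.unique ω.2.choose_spec h⟩

/-- `Z^k_p(D)`: the weakly closed forms in `Ω^k_p(D)`. -/
def ClosedForm : Submodule ℝ (LpForm D p k) where
  carrier := {ω | IsWeakD D ω (0 : LpForm D p (k + 1))}
  add_mem' := fun h h' => by simpa using IsWeakD.add h h'
  zero_mem' := IsWeakD.zero
  smul_mem' := fun c _ h => by simpa using IsWeakD.smul c h

/-- `ℋ^k_p(D) = Ω^k_{p,p}(D) / ker d`, with the quotient norm
`‖[ζ]‖ = inf {‖η‖_{Ω^k_p(D)} : dη = dζ}`. -/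
abbrev HarmonicSpace : Type :=
  SobolevForm D p k ⧸ LinearMap.ker (SobolevForm.d D p k)

/-- The map `d : ℋ^k_p(D) → Ω^{k+1}_p(D)` induced by the exterior differential. -/
def HarmonicSpace.d : HarmonicSpace D p k →ₗ[ℝ] LpForm D p (k + 1) :=
  (LinearMap.ker (SobolevForm.d D p k)).liftQ (SobolevForm.d D p k) le_rfl

end Spaces

/-- `δ(|η|^{p-2} η) = 0` on `D` in the sense of distributions, for a `k`-form `η`:
`∫_D |η|^{p-2} ⟨η, dφ⟩ = 0` for all test forms `φ` of degree `k - 1`. -/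
def IsPHarmonic {n k : ℕ} (D : TopologicalSpace.Opens (EuclideanSpace ℝ (Fin n))) (p : ℝ)
    (η : EuclideanSpace ℝ (Fin n) → Form n k) : Prop :=
  ∀ l : ℕ, l + 1 = k → ∀ φ : EuclideanSpace ℝ (Fin n) → Form n l, IsTestForm D φ →
    ∫ x in (D : Set (EuclideanSpace ℝ (Fin n))), ‖η x‖ ^ (p - 2) * inner ℝ (η x) (extD k φ x) = 0

/-- `β : D → V` is a homeomorphism with inverse `α : V → D`, and `β` is `C`-Lipschitz, `α` is
`L`-Lipschitz. -/
structure IsBiLipschitz {n : ℕ} (C L : ℝ≥0) (D V : Set (EuclideanSpace ℝ (Fin n)))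
    (β α : EuclideanSpace ℝ (Fin n) → EuclideanSpace ℝ (Fin n)) : Prop where
  mapsTo : MapsTo β D V
  mapsTo_inv : MapsTo α V D
  left_inv : LeftInvOn α β D
  right_inv : RightInvOn α β V
  lipschitz : LipschitzOnWith C β D
  lipschitz_inv : LipschitzOnWith L α V

/-- The constant
`√(n choose k) (n-k+1) / (p(k-1)-n+1)^{1/p} * (n!^{(p+1)/p} / (n-k+1)!)²` (for `k ≤ n`). -/
def solutionConst (n k : ℕ) (p : ℝ) : ℝ :=
  √(n.choose k : ℝ) * ((n : ℝ) - k + 1) / (p * ((k : ℝ) - 1) - n + 1) ^ (1 / p) *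
    ((n.factorial : ℝ) ^ ((p + 1) / p) / ((n - k + 1).factorial : ℝ)) ^ 2

end

noncomputable section

open Form

/-! The differential is injective on `HarmonicSpace`, so the solution operator is forced: it is the
inverse of `HarmonicSpace.d` on the closed forms, and any primitive of `ω` represents `𝒮 ω`
(`HarmonicSpace.eq_mk`). The norm bound, the compactness and the `p`-harmonic representative may
therefore use three different primitives of the same form.

Primitives come from the ball. A closed form `u` on `D` is pulled back by `α` to a form `v` on the
ball, the homotopy operator with centre `y`, `∫₀¹ t^m ι_{x-y} v(y + t(x-y)) dt` with `m + 1` the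
degree of `v`, gives a primitive of `v`, and this is pulled back by `β`. The homothety has Jacobian
`t^n`, so the `L^p` bound contains the integral of `t^{pm-n}`, which is finite because `p >
(n-1)/(k-1)` with `m = k - 1`. The primitive property is tested against `g`: the time integrand is
minus the derivative of `t^{m+1-n} ∫ g(y + (z-y)/t) v(z) dz`, which tends to `0` at `t = 0` and to
`∫ g v` at `t = 1` (`integral_integral_coneKernel`, `AltWeakD.cone`). The centre of the ball as the
only centre gives the norm bound (`IsBiLipschitz.exists_primitive`).

Pullback under a bi-Lipschitz map respects the weak differential by a double approximation. For
smooth forms the map is mollified, which works because the derivatives converge almost everywhere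
and boundedly (`altWeakD_pull_of_smooth`). For integrable forms the form is mollified, and the
Lipschitz bound on the inverse transports `L^1` convergence (`AltWeakD.pullback`).

For compactness the centre is averaged against a Lipschitz density. Times close to `1` contribute an
operator of small norm. For `t ≤ s < 1` the substitution `z = y + t(x-y)` in the centre moves the
dependence on `x` from `v` to the density, so the images are bounded and equi-Lipschitz and have
finite nets (`exists_finite_net_cone`). The resulting primitives lie in a totally bounded set whose
closure still consists of forms with differential in `L^p` (`IsWeakD.exists_of_mem_closure`).

A primitive of least norm exists by uniform convexity of `L^p`, derived from a pointwise inequality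
(`exists_norm_sub_rpow_le`). Adding `t dφ` to it gives another primitive, so the first variation of
the norm vanishes, which is the equation `δ(|η|^{p-2} η) = 0`. The constant produced by these
estimates is finally compared with the stated one (`primitiveConst_le`). -/

/-- Alternating `k`-linear forms on `ℝⁿ`. -/
abbrev Alt (n k : ℕ) : Type :=
  EuclideanSpace ℝ (Fin n) [⋀^Fin k]→L[ℝ] ℝ

/-! ### Coefficient vectors and alternating multilinear maps -/

namespace Form

variable {n k l m : ℕ}

/-- The vectors of the standard basis with indices in `I`, in increasing order. -/
def basisVec (I : {I : Finset (Fin n) // I.card = k}) (a : Fin k) : EuclideanSpace ℝ (Fin n) :=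
  EuclideanSpace.single (I.1.orderEmbOfFin I.2 a) 1

lemma norm_basisVec (I : {I : Finset (Fin n) // I.card = k}) (a : Fin k) :
    ‖basisVec I a‖ = 1 := by simp [basisVec]

lemma card_index : Fintype.card {I : Finset (Fin n) // I.card = k} = n.choose k := by
  simp

/-- The covector of coefficients of an alternating form. -/
def ofAlt : Alt n k →L[ℝ] Form n k :=
  LinearMap.mkContinuous
    { toFun := fun w => WithLp.toLp 2 fun I => w (basisVec I)
      map_add' := fun w w' => by ext I; simp
      map_smul' := fun c w => by ext I; simp } (√(n.choose k : ℝ)) fun w => by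
    rw [EuclideanSpace.norm_eq, ← Real.sqrt_sq (norm_nonneg w), ← Real.sqrt_mul (by positivity)]
    refine Real.sqrt_le_sqrt ?_
    calc _ ≤ ∑ _I : {I : Finset (Fin n) // I.card = k}, ‖w‖ ^ 2 := by
          refine Finset.sum_le_sum fun I _ => ?_
          refine pow_le_pow_left₀ (norm_nonneg _) ?_ 2
          simpa [norm_basisVec] using w.le_opNorm (basisVec I)
      _ = _ := by rw [Finset.sum_const, Finset.card_univ, card_index, nsmul_eq_mul]

@[simp] lemma ofAlt_apply (w : Alt n k) (I : {I : Finset (Fin n) // I.card = k}) :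
    ofAlt w I = w (basisVec I) := rfl

lemma norm_ofAlt_le (w : Alt n k) : ‖ofAlt w‖ ≤ √(n.choose k : ℝ) * ‖w‖ :=
  LinearMap.mkContinuous_norm_le _ (Real.sqrt_nonneg _) _ |> (ofAlt (n := n) (k := k)).le_of_opNorm_le <| w

/-- The alternating form `dx_I`. -/
def dxAlt (I : {I : Finset (Fin n) // I.card = k}) : Alt n k :=
  AlternatingMap.mkContinuous
    ((Matrix.detRowAlternating (R := ℝ) (n := Fin k)).compLinearMap
      (LinearMap.pi fun a => (EuclideanSpace.proj (𝕜 := ℝ) (I.1.orderEmbOfFin I.2 a) :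
        EuclideanSpace ℝ (Fin n) →L[ℝ] ℝ).toLinearMap)) (k.factorial : ℝ) fun v => by
    simp only [AlternatingMap.compLinearMap_apply, Matrix.detRowAlternating]
    change ‖Matrix.det (Matrix.of fun i a : Fin k => v i (I.1.orderEmbOfFin I.2 a))‖ ≤ _
    rw [Matrix.det_apply]
    -- Leibniz expansion: each of the `k!` permutations contributes at most the product of the
    -- norms. This crude bound is the source of the factorial in `primitiveConst`.
    calc _ ≤ ∑ σ : Equiv.Perm (Fin k), ∏ i, ‖v i‖ := by
          refine (norm_sum_le _ _).trans ?_
          refine Finset.sum_le_sum fun σ _ => ?_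
          have h1 : ∀ (τ : Equiv.Perm (Fin k)) (y : ℝ), ‖Equiv.Perm.sign τ • y‖ = ‖y‖ := by
            intro τ y
            rcases Int.units_eq_one_or (Equiv.Perm.sign τ) with h | h <;> simp [h]
          rw [h1, norm_prod, ← Equiv.prod_comp σ fun i => ‖v i‖]
          refine Finset.prod_le_prod (fun _ _ => norm_nonneg _) fun i _ => ?_
          exact PiLp.norm_apply_le (v (σ i)) _
      _ = _ := by simp [Finset.card_univ, Fintype.card_perm]

lemma norm_dxAlt_le (I : {I : Finset (Fin n) // I.card = k}) : ‖dxAlt I‖ ≤ k.factorial :=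
  AlternatingMap.mkContinuous_norm_le _ (by positivity) _

lemma dxAlt_basisVec (I J : {I : Finset (Fin n) // I.card = k}) :
    dxAlt I (basisVec J) = if I = J then 1 else 0 := by
  change Matrix.det (Matrix.of fun i a : Fin k => basisVec J i (I.1.orderEmbOfFin I.2 a)) = _
  split_ifs with h
  · subst h
    convert Matrix.det_one (n := Fin k) (R := ℝ)
    ext i a
    simp [basisVec, Matrix.one_apply, eq_comm]
  · have hJ : ∃ j ∈ J.1, j ∉ I.1 := by
      by_contra! hc
      exact h (Subtype.ext (Finset.eq_of_subset_of_card_le hc (by rw [I.2, J.2])).symm)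
    obtain ⟨j, hj, hjI⟩ := hJ
    obtain ⟨b, hb⟩ : ∃ b, J.1.orderEmbOfFin J.2 b = j := by
      have : j ∈ Set.range (J.1.orderEmbOfFin J.2) := by simpa using hj
      exact this
    refine Matrix.det_eq_zero_of_row_eq_zero b fun a => ?_
    have : I.1.orderEmbOfFin I.2 a ≠ j := fun he => hjI (he ▸ Finset.orderEmbOfFin_mem _ _ _)
    simp [basisVec, hb, this]

/-- The alternating form with given coefficients. -/
def toAlt : Form n k →L[ℝ] Alt n k :=
  LinearMap.mkContinuous
    { toFun := fun a => ∑ I, a I • dxAlt I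
      map_add' := fun a b => by simp [add_smul, Finset.sum_add_distrib]
      map_smul' := fun c a => by simp [mul_smul, Finset.smul_sum] }
    (√(n.choose k : ℝ) * k.factorial) fun a => by
    change ‖∑ I, a I • dxAlt I‖ ≤ _
    have h1 : ∑ I, ‖a I‖ ≤ √(n.choose k : ℝ) * ‖a‖ := by
      have h := Finset.sum_mul_sq_le_sq_mul_sq Finset.univ (fun I => ‖a I‖) (fun _ => (1 : ℝ))
      simp only [mul_one, one_pow, Finset.sum_const, Finset.card_univ, card_index,
        nsmul_eq_mul] at h
      rw [EuclideanSpace.norm_eq, ← Real.sqrt_mul (by positivity)]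
      refine Real.le_sqrt_of_sq_le (h.trans_eq ?_)
      ring
    calc _ ≤ ∑ I, ‖a I‖ * k.factorial := by
          refine (norm_sum_le _ _).trans (Finset.sum_le_sum fun I _ => ?_)
          rw [norm_smul]
          exact mul_le_mul_of_nonneg_left (norm_dxAlt_le I) (norm_nonneg _)
      _ ≤ _ := by
          rw [← Finset.sum_mul]
          nlinarith [(Nat.cast_pos (α := ℝ)).2 k.factorial_pos]

lemma toAlt_apply (a : Form n k) : toAlt a = ∑ I, a I • dxAlt I := rfl

lemma norm_toAlt_le (a : Form n k) : ‖toAlt a‖ ≤ √(n.choose k : ℝ) * k.factorial * ‖a‖ :=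
  (toAlt (n := n) (k := k)).le_of_opNorm_le (LinearMap.mkContinuous_norm_le _ (by positivity) _) a

@[simp] lemma ofAlt_toAlt (a : Form n k) : ofAlt (toAlt a) = a := by
  ext I
  rw [ofAlt_apply, toAlt_apply, ContinuousAlternatingMap.sum_apply]
  simp [dxAlt_basisVec]

/-- An alternating map is determined by its values on injective tuples of basis vectors, and each
such tuple is a permutation of an increasing one. -/
lemma ofAlt_injective : Function.Injective (ofAlt : Alt n k → Form n k) := by
  intro w w' h
  refine ContinuousAlternatingMap.toAlternatingMap_injective ?_
  refine (EuclideanSpace.basisFun (Fin n) ℝ).toBasis.ext_alternating fun v hv => ?_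
  set I : {I : Finset (Fin n) // I.card = k} :=
    ⟨Finset.univ.image v, by simp [Finset.card_image_of_injective _ hv]⟩
  have hmem : ∀ a, v a ∈ I.1 := fun a => by simp [I]
  set τ : Fin k → Fin k := fun a => (I.1.orderIsoOfFin I.2).symm ⟨v a, hmem a⟩
  have hτ : Function.Bijective τ := by
    refine Finite.injective_iff_bijective.1 fun a b hab => hv ?_
    simpa using (I.1.orderIsoOfFin I.2).symm.injective hab
  set σ : Equiv.Perm (Fin k) := Equiv.ofBijective τ hτ
  have hb : (fun a => (EuclideanSpace.basisFun (Fin n) ℝ).toBasis (v a)) = basisVec I ∘ σ := by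
    funext a
    have : I.1.orderEmbOfFin I.2 (τ a) = v a := by
      rw [← Finset.coe_orderIsoOfFin_apply]
      simp [τ]
    simp [basisVec, σ, this]
  have hI : w (basisVec I) = w' (basisVec I) := by
    simpa using congrArg (fun a : Form n k => a I) h
  rw [hb, AlternatingMap.map_perm, AlternatingMap.map_perm]
  simp [hI]

@[simp] lemma toAlt_ofAlt (w : Alt n k) : toAlt (ofAlt w) = w :=
  ofAlt_injective (ofAlt_toAlt _)


/-- The wedge product `ξ ∧ w` of a linear form and an alternating form. -/
def wedgeL (ξ : EuclideanSpace ℝ (Fin n) →L[ℝ] ℝ) (w : Alt n k) : Alt n (k + 1) :=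
  ContinuousAlternatingMap.alternatizeUncurryFin (ξ.smulRight w)

lemma wedgeL_apply (ξ : EuclideanSpace ℝ (Fin n) →L[ℝ] ℝ) (w : Alt n k)
    (v : Fin (k + 1) → EuclideanSpace ℝ (Fin n)) :
    wedgeL ξ w v = ∑ a : Fin (k + 1), (-1) ^ (a : ℕ) * (ξ (v a) * w (a.removeNth v)) := by
  simp [wedgeL, ContinuousAlternatingMap.alternatizeUncurryFin_apply]

/-- Identifies the number of inversions between an element of `K` and the rest of `K` with its
position, hence `shuffleSign` with the sign `(-1)^a` of an alternatizing sum. -/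
lemma card_filter_lt_orderEmb (K : Finset (Fin n)) (hK : K.card = m) (a : Fin m) :
    (K.filter (· < K.orderEmbOfFin hK a)).card = a := by
  have : K.filter (· < K.orderEmbOfFin hK a) =
      (Finset.Iio a).map (K.orderEmbOfFin hK).toEmbedding := by
    ext b
    simp only [Finset.mem_filter, Finset.mem_map, Finset.mem_Iio]
    constructor
    · rintro ⟨hb, hlt⟩
      obtain ⟨c, rfl⟩ : b ∈ Set.range (K.orderEmbOfFin hK) := by simpa using hb
      exact ⟨c, by simpa using hlt, rfl⟩
    · rintro ⟨c, hc, rfl⟩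
      exact ⟨Finset.orderEmbOfFin_mem _ _ _, by simpa using hc⟩
  rw [this, Finset.card_map, Fin.card_Iio]

lemma wedge_dx_apply (i : Fin n) (a : Form n k) (K : {I : Finset (Fin n) // I.card = k + 1}) :
    wedge (k + 1) (dx i) a K = if h : i ∈ K.1 then
      shuffleSign {i} (K.1.erase i) * a ⟨K.1.erase i, by simp [Finset.card_erase_of_mem h, K.2]⟩
      else 0 := by
  simp only [wedge]
  rw [Finset.sum_eq_single (⟨{i}, Finset.card_singleton i⟩ : {I : Finset (Fin n) // I.card = 1})]
  · split_ifs with h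
    · rw [Finset.sum_eq_single ⟨K.1.erase i, by simp [Finset.card_erase_of_mem h, K.2]⟩]
      · rw [if_pos]
        · simp [dx]
        · exact ⟨by simp, by rw [← Finset.insert_eq, Finset.insert_erase h]⟩
      · intro J _ hJ
        rw [if_neg]
        rintro ⟨h1, h2⟩
        refine hJ (Subtype.ext ?_)
        change J.1 = K.1.erase i
        rw [← h2, ← Finset.insert_eq, Finset.erase_insert]
        simpa using h1
      · simp
    · refine Finset.sum_eq_zero fun J _ => if_neg fun hc => h ?_
      rw [← hc.2]; simp
  · intro I _ hI
    refine Finset.sum_eq_zero fun J _ => ?_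
    simp [dx, hI]
  · simp

/-- Reconciles the two wedge conventions. Both sides at `K` are sums over the elements of `K`, each
removed in turn; the signs agree by `card_filter_lt_orderEmb`. -/
lemma ofAlt_wedgeL (ξ : EuclideanSpace ℝ (Fin n) →L[ℝ] ℝ) (w : Alt n k) :
    ofAlt (wedgeL ξ w) =
      ∑ i, ξ (EuclideanSpace.single i 1) • wedge (k + 1) (dx i) (ofAlt w) := by
  ext K
  have h0 : (∑ i, ξ (EuclideanSpace.single i 1) • wedge (k + 1) (dx i) (ofAlt w) :
      Form n (k + 1)) K =
      ∑ i, ξ (EuclideanSpace.single i 1) * wedge (k + 1) (dx i) (ofAlt w) K := by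
    simp
  rw [h0, ofAlt_apply, wedgeL_apply]
  rw [← Finset.sum_subset (Finset.subset_univ K.1)]
  swap
  · intro i _ hi
    rw [wedge_dx_apply, dif_neg hi, mul_zero]
  have hmap : K.1 = Finset.univ.map (K.1.orderEmbOfFin K.2).toEmbedding := by
    simp
  conv_rhs => rw [hmap]
  rw [Finset.sum_map]
  refine Finset.sum_congr rfl fun a _ => ?_
  have hmem : K.1.orderEmbOfFin K.2 a ∈ K.1 := Finset.orderEmbOfFin_mem _ _ _
  simp only [RelEmbedding.coe_toEmbedding]
  rw [wedge_dx_apply, dif_pos hmem]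
  have hs : shuffleSign {K.1.orderEmbOfFin K.2 a} (K.1.erase (K.1.orderEmbOfFin K.2 a)) =
      (-1) ^ (a : ℕ) := by
    rw [shuffleSign, ← card_filter_lt_orderEmb K.1 K.2 a]
    congr 1
    refine Finset.card_bij (fun q _ => q.2) ?_ ?_ ?_
    · rintro ⟨i, b⟩ h
      simp only [Finset.mem_filter, Finset.mem_product, Finset.mem_singleton,
        Finset.mem_erase] at h ⊢
      exact ⟨h.1.2.2, h.1.1 ▸ h.2⟩
    · rintro ⟨i, b⟩ h ⟨i', b'⟩ h' hb
      simp only [Finset.mem_filter, Finset.mem_product, Finset.mem_singleton] at h h' hb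
      simp [h.1.1, h'.1.1, hb]
    · intro b h
      simp only [Finset.mem_filter] at h
      exact ⟨(K.1.orderEmbOfFin K.2 a, b), by simp [h.1, h.2, h.2.ne], rfl⟩
  rw [hs, ofAlt_apply]
  have hv : a.removeNth (basisVec K) = basisVec
      ⟨K.1.erase (K.1.orderEmbOfFin K.2 a), by simp [Finset.card_erase_of_mem hmem, K.2]⟩ := by
    funext b
    have := Finset.orderEmbOfFin_unique (s := K.1.erase (K.1.orderEmbOfFin K.2 a))
      (by simp [Finset.card_erase_of_mem hmem, K.2])
      (f := fun b => K.1.orderEmbOfFin K.2 (a.succAbove b))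
      (fun b => Finset.mem_erase.2 ⟨fun h => Fin.succAbove_ne a b
        ((K.1.orderEmbOfFin K.2).injective h), Finset.orderEmbOfFin_mem _ _ _⟩)
      ((K.1.orderEmbOfFin K.2).strictMono.comp (Fin.strictMono_succAbove a))
    simp only [Fin.removeNth, basisVec]
    rw [← this]
  rw [hv, basisVec]
  ring

lemma norm_wedgeL_le (ξ : EuclideanSpace ℝ (Fin n) →L[ℝ] ℝ) (w : Alt n k) :
    ‖wedgeL ξ w‖ ≤ (k + 1) * (‖ξ‖ * ‖w‖) := by
  refine (ContinuousAlternatingMap.norm_alternatizeUncurryFin_le _).trans ?_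
  rw [ContinuousLinearMap.norm_smulRight_apply]

/-- The wedge product `ξ ∧ w` as a continuous bilinear map. -/
def wedgeB : (EuclideanSpace ℝ (Fin n) →L[ℝ] ℝ) →L[ℝ] Alt n k →L[ℝ] Alt n (k + 1) :=
  LinearMap.mkContinuous₂ (LinearMap.mk₂ ℝ wedgeL
    (fun ξ ξ' w => by
      ext v
      simp only [ContinuousAlternatingMap.add_apply, wedgeL_apply, ← Finset.sum_add_distrib]
      refine Finset.sum_congr rfl fun a _ => ?_
      simp only [_root_.add_apply]; ring)
    (fun c ξ w => by
      ext v
      simp only [ContinuousAlternatingMap.smul_apply, wedgeL_apply, Finset.smul_sum]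
      refine Finset.sum_congr rfl fun a _ => ?_
      simp only [_root_.smul_apply, smul_eq_mul]; ring)
    (fun ξ w w' => by
      ext v
      simp only [ContinuousAlternatingMap.add_apply, wedgeL_apply, ← Finset.sum_add_distrib]
      refine Finset.sum_congr rfl fun a _ => ?_
      ring)
    (fun c ξ w => by
      ext v
      simp only [ContinuousAlternatingMap.smul_apply, wedgeL_apply, Finset.smul_sum]
      refine Finset.sum_congr rfl fun a _ => ?_
      simp only [smul_eq_mul]; ring)) (k + 1) fun ξ w => by
    rw [mul_assoc]
    exact norm_wedgeL_le ξ w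

@[simp] lemma wedgeB_apply (ξ : EuclideanSpace ℝ (Fin n) →L[ℝ] ℝ) (w : Alt n k) :
    wedgeB ξ w = wedgeL ξ w := rfl

instance : FiniteDimensional ℝ (Alt n k) :=
  FiniteDimensional.of_injective (ofAlt (n := n) (k := k)).toLinearMap ofAlt_injective

lemma toAlt_wedge_dx (ξ : EuclideanSpace ℝ (Fin n) →L[ℝ] ℝ) (a : Form n k) :
    toAlt (∑ i, ξ (EuclideanSpace.single i 1) • wedge (k + 1) (dx i) a) =
      wedgeL ξ (toAlt a) := by
  refine ofAlt_injective ?_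
  rw [ofAlt_toAlt, ofAlt_wedgeL, ofAlt_toAlt]

end Form

/-! ### Signs and the pairing of complementary degrees -/

namespace Form

variable {n k l m : ℕ}

lemma shuffleSign_union_right {A B C : Finset (Fin n)} (h : Disjoint B C) :
    shuffleSign A (B ∪ C) = shuffleSign A B * shuffleSign A C := by
  rw [shuffleSign, shuffleSign, shuffleSign, ← pow_add, Finset.product_union, Finset.filter_union,
    Finset.card_union_of_disjoint]
  refine Finset.disjoint_filter_filter ?_
  exact Finset.disjoint_product.2 (Or.inr h)

lemma shuffleSign_union_left {A B C : Finset (Fin n)} (h : Disjoint A B) :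
    shuffleSign (A ∪ B) C = shuffleSign A C * shuffleSign B C := by
  rw [shuffleSign, shuffleSign, shuffleSign, ← pow_add, Finset.union_product, Finset.filter_union,
    Finset.card_union_of_disjoint]
  refine Finset.disjoint_filter_filter ?_
  exact Finset.disjoint_product.2 (Or.inl h)

lemma shuffleSign_mul_self (A B : Finset (Fin n)) : shuffleSign A B * shuffleSign A B = 1 := by
  rw [shuffleSign, ← pow_add, ← two_mul, pow_mul]; simp

/-- Each element of `A` lies on exactly one side of `i`, so the two inversion counts add up to the
cardinality of `A`. -/
lemma shuffleSign_swap {A : Finset (Fin n)} {i : Fin n} (h : i ∉ A) :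
    shuffleSign A {i} * shuffleSign {i} A = (-1) ^ A.card := by
  rw [shuffleSign, shuffleSign, ← pow_add]
  congr 1
  have h1 : ((A ×ˢ ({i} : Finset (Fin n))).filter fun q => q.2 < q.1).card =
      (A.filter (i < ·)).card := by
    refine Finset.card_bij (fun q _ => q.1) ?_ ?_ ?_
    · rintro ⟨a, b⟩ hq
      simp only [Finset.mem_filter, Finset.mem_product, Finset.mem_singleton] at hq ⊢
      exact ⟨hq.1.1, hq.1.2 ▸ hq.2⟩
    · rintro ⟨a, b⟩ hq ⟨a', b'⟩ hq' he
      simp only [Finset.mem_filter, Finset.mem_product, Finset.mem_singleton] at hq hq' he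
      simp [hq.1.2, hq'.1.2, he]
    · intro a ha
      simp only [Finset.mem_filter] at ha
      exact ⟨(a, i), by simp [ha.1, ha.2], rfl⟩
  have h2 : ((({i} : Finset (Fin n)) ×ˢ A).filter fun q => q.2 < q.1).card =
      (A.filter fun a => ¬ i < a).card := by
    refine Finset.card_bij (fun q _ => q.2) ?_ ?_ ?_
    · rintro ⟨a, b⟩ hq
      simp only [Finset.mem_filter, Finset.mem_product, Finset.mem_singleton] at hq ⊢
      exact ⟨hq.1.2, not_lt.2 (hq.1.1 ▸ hq.2).le⟩
    · rintro ⟨a, b⟩ hq ⟨a', b'⟩ hq' he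
      simp only [Finset.mem_filter, Finset.mem_product, Finset.mem_singleton] at hq hq' he
      simp [hq.1.1, hq'.1.1, he]
    · intro a ha
      simp only [Finset.mem_filter] at ha
      refine ⟨(i, a), ?_, rfl⟩
      simp only [Finset.mem_filter, Finset.mem_product, Finset.mem_singleton, true_and]
      exact ⟨ha.1, lt_of_le_of_ne (not_lt.1 ha.2) fun e => h (e ▸ ha.1)⟩
  rw [h1, h2, Finset.card_filter_add_card_filter_not]

/-- The complementary multi-index. -/
def compIdx (h : k + l = n) (I : {I : Finset (Fin n) // I.card = k}) :
    {J : Finset (Fin n) // J.card = l} :=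
  ⟨I.1ᶜ, by rw [Finset.card_compl, Fintype.card_fin, I.2]; omega⟩

lemma compIdx_coe (h : k + l = n) (I : {I : Finset (Fin n) // I.card = k}) :
    (compIdx h I).1 = I.1ᶜ := rfl

lemma top_wedge (h : k + l = n) (a : Form n k) (b : Form n l) :
    top (wedge n a b) = ∑ K, shuffleSign K.1 K.1ᶜ * (a K * b (compIdx h K)) := by
  simp only [top, wedge]
  refine Finset.sum_congr rfl fun I _ => ?_
  rw [Finset.sum_eq_single (compIdx h I)]
  · simp [compIdx, disjoint_compl_right]
  · intro J _ hJ
    refine if_neg fun hc => hJ (Subtype.ext ?_)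
    have h1 : IsCompl I.1 J.1 := ⟨hc.1, codisjoint_iff.2 hc.2⟩
    exact h1.compl_eq.symm
  · simp

lemma wedge_dx_apply_sum (i : Fin n) (a : Form n k) (K : {I : Finset (Fin n) // I.card = m}) :
    wedge m (dx i) a K =
      ∑ I, if i ∉ I.1 ∧ insert i I.1 = K.1 then shuffleSign {i} I.1 * a I else 0 := by
  simp only [wedge]
  rw [Finset.sum_eq_single (⟨{i}, Finset.card_singleton i⟩ : {I : Finset (Fin n) // I.card = 1})]
  · refine Finset.sum_congr rfl fun I _ => ?_
    simp only [Finset.disjoint_singleton_left, ← Finset.insert_eq]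
    simp [dx]
  · intro I _ hI
    refine Finset.sum_eq_zero fun J _ => ?_
    simp [dx, hI]
  · simp

/-- Moving `dx_i` past a `k`-covector costs `(-1)^k`. In coefficients both sides run over pairs with
`K = I ∪ {i}`, once the `l`-subsets are indexed by their complements `K`. -/
lemma top_wedge_dx (h : k + 1 + l = n) (i : Fin n) (a : Form n k) (b : Form n l) :
    top (wedge n a (wedge (l + 1) (dx i) b)) =
      (-1) ^ k * top (wedge n (wedge (k + 1) (dx i) a) b) := by
  rw [top_wedge (by omega : k + (l + 1) = n), top_wedge h]
  have hbij : Function.Bijective (compIdx h) := by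
    refine Function.bijective_iff_has_inverse.2 ⟨compIdx (by omega : l + (k + 1) = n), ?_, ?_⟩ <;>
    · intro I
      exact Subtype.ext (compl_compl _)
  simp only [wedge_dx_apply_sum]
  have hL : ∀ I : {I : Finset (Fin n) // I.card = k},
      shuffleSign I.1 I.1ᶜ * (a I * ∑ J : {I : Finset (Fin n) // I.card = l},
        if i ∉ J.1 ∧ insert i J.1 = (compIdx (by omega : k + (l + 1) = n) I).1
        then shuffleSign {i} J.1 * b J else 0) =
      ∑ K : {I : Finset (Fin n) // I.card = k + 1}, if i ∉ I.1 ∧ insert i I.1 = K.1 then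
        (-1) ^ k * (shuffleSign K.1 K.1ᶜ * shuffleSign {i} I.1 * a I * b (compIdx h K)) else 0 := by
    intro I
    rw [← hbij.sum_comp, Finset.mul_sum, Finset.mul_sum]
    refine Finset.sum_congr rfl fun K _ => ?_
    have hc : (i ∉ (compIdx h K).1 ∧ insert i (compIdx h K).1 =
        (compIdx (by omega : k + (l + 1) = n) I).1) ↔ (i ∉ I.1 ∧ insert i I.1 = K.1) := by
      simp only [compIdx_coe]
      constructor
      · rintro ⟨h1, h2⟩
        have h3 : i ∉ I.1 := by
          have : i ∈ I.1ᶜ := h2 ▸ Finset.mem_insert_self _ _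
          simpa using this
        refine ⟨h3, ?_⟩
        ext b
        have h4 : b ∈ insert i K.1ᶜ ↔ b ∈ I.1ᶜ := by rw [h2]
        simp only [Finset.mem_insert, Finset.mem_compl] at h1 h4 ⊢
        by_cases hb : b = i
        · subst hb; tauto
        · tauto
      · rintro ⟨h1, h2⟩
        rw [← h2]
        refine ⟨by simp, ?_⟩
        ext b
        simp only [Finset.mem_insert, Finset.mem_compl]
        by_cases hb : b = i
        · subst hb; tauto
        · tauto
    by_cases hh : i ∉ I.1 ∧ insert i I.1 = K.1
    · rw [if_pos (hc.2 hh), if_pos hh]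
      obtain ⟨h1, h2⟩ := hc.2 hh
      simp only [compIdx_coe] at h1 h2 ⊢
      have e1 : shuffleSign I.1 I.1ᶜ = shuffleSign I.1 {i} * shuffleSign I.1 K.1ᶜ := by
        rw [← h2, Finset.insert_eq, shuffleSign_union_right (by simpa using h1)]
      have e2 : shuffleSign K.1 K.1ᶜ = shuffleSign {i} K.1ᶜ * shuffleSign I.1 K.1ᶜ := by
        conv_lhs => rw [← hh.2, Finset.insert_eq]
        rw [shuffleSign_union_left (by simpa using hh.1)]
        conv_rhs => rw [← hh.2, Finset.insert_eq]
      have e3 := shuffleSign_swap hh.1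
      rw [I.2] at e3
      rw [e1, e2, ← e3]
      have e4 := shuffleSign_mul_self {i} I.1
      -- The two sides differ by the square of a sign.
      linear_combination (-(shuffleSign I.1 {i} * shuffleSign I.1 K.1ᶜ * shuffleSign {i} K.1ᶜ *
        a I * b (compIdx h K))) * e4
    · rw [if_neg fun h' => hh (hc.1 h'), if_neg hh]
      simp
  rw [Finset.sum_congr rfl fun I _ => hL I, Finset.sum_comm, Finset.mul_sum]
  refine Finset.sum_congr rfl fun K _ => ?_
  rw [Finset.sum_mul, Finset.mul_sum, Finset.mul_sum]
  refine Finset.sum_congr rfl fun I _ => ?_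
  split_ifs
  · ring
  · simp

lemma wedge_add_right (a : Form n k) (b b' : Form n l) :
    wedge m a (b + b') = wedge m a b + wedge m a b' := by
  ext K
  simp only [wedge, PiLp.add_apply, ← Finset.sum_add_distrib]
  refine Finset.sum_congr rfl fun I _ => Finset.sum_congr rfl fun J _ => ?_
  split_ifs <;> ring

lemma wedge_sum_right {ι : Type*} (s : Finset ι) (a : Form n k) (b : ι → Form n l) :
    wedge m a (∑ i ∈ s, b i) = ∑ i ∈ s, wedge m a (b i) := by
  classical
  induction s using Finset.induction_on with
  | empty => simp [wedge_zero_right]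
  | insert i s hi ih => rw [Finset.sum_insert hi, Finset.sum_insert hi, wedge_add_right, ih]

lemma top_sum {ι : Type*} (s : Finset ι) (b : ι → Form n n) :
    top (∑ i ∈ s, b i) = ∑ i ∈ s, top (b i) := by
  simp [top]

/-- Decouples the integrand of `IsWeakD`: each coefficient of the test form acts as a scalar test
function on one coefficient of `dg ∧ a + g b`. -/
lemma top_wedge_extD (h : k + 1 + l = n) (a : Form n k) (b : Form n (k + 1))
    {φ : EuclideanSpace ℝ (Fin n) → Form n l} {x : EuclideanSpace ℝ (Fin n)}
    (hφ : DifferentiableAt ℝ φ x) :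
    top (wedge n a (extD (l + 1) φ x)) - (-1) ^ (k + 1) * top (wedge n b (φ x)) =
      (-1) ^ k * ∑ K, shuffleSign K.1 K.1ᶜ *
        ((∑ i, fderiv ℝ (fun y => φ y (compIdx h K)) x (EuclideanSpace.single i 1) •
          wedge (k + 1) (dx i) a) K + φ x (compIdx h K) * b K) := by
  have hf : ∀ (J : {I : Finset (Fin n) // I.card = l}) (v : EuclideanSpace ℝ (Fin n)),
      fderiv ℝ (fun y => φ y J) x v = (fderiv ℝ φ x v) J := by
    intro J v
    have := ((EuclideanSpace.proj (𝕜 := ℝ) J : Form n l →L[ℝ] ℝ).hasFDerivAt.comp x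
      hφ.hasFDerivAt).fderiv
    change fderiv ℝ ((EuclideanSpace.proj (𝕜 := ℝ) J : Form n l →L[ℝ] ℝ) ∘ φ) x v = _
    rw [this]; rfl
  have hs : ∀ K, (∑ i, fderiv ℝ (fun y => φ y (compIdx h K)) x (EuclideanSpace.single i 1) •
      wedge (k + 1) (dx i) a) K =
      ∑ i, (fderiv ℝ φ x (EuclideanSpace.single i 1)) (compIdx h K) *
        wedge (k + 1) (dx i) a K := by
    intro K
    simp [hf]
  rw [extD, wedge_sum_right, top_sum]
  simp only [top_wedge_dx h, hs]
  rw [← Finset.mul_sum]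
  simp only [top_wedge h]
  rw [Finset.sum_comm]
  simp only [mul_add, Finset.sum_add_distrib, Finset.mul_sum, pow_succ]
  simp only [mul_neg, mul_one, neg_mul, Finset.sum_neg_distrib, sub_neg_eq_add]
  congr 1
  · refine Finset.sum_congr rfl fun K _ => Finset.sum_congr rfl fun i _ => ?_
    ring
  · refine Finset.sum_congr rfl fun K _ => ?_
    ring

end Form

/-! ### The weak differential tested against scalar functions -/

/-- `η = dθ` on `U` in the sense of distributions, tested against scalar functions:
`∫ dg ∧ θ + g η = 0`. -/
def AltWeakD {n k : ℕ} (U : Set (EuclideanSpace ℝ (Fin n)))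
    (θ : EuclideanSpace ℝ (Fin n) → Alt n k) (η : EuclideanSpace ℝ (Fin n) → Alt n (k + 1)) :
    Prop :=
  ∀ g : EuclideanSpace ℝ (Fin n) → ℝ, ContDiff ℝ ((⊤ : ℕ∞) : WithTop ℕ∞) g →
    HasCompactSupport g → tsupport g ⊆ U →
    ∫ x, (wedgeL (fderiv ℝ g x) (θ x) + g x • η x) = 0

lemma MeasureTheory.LocallyIntegrable.integrable_bilin {X F G W : Type*} [TopologicalSpace X]
    [MeasurableSpace X] [OpensMeasurableSpace X] [SecondCountableTopology X]
    [T2Space X] [TopologicalSpace.PseudoMetrizableSpace X] [NormedAddCommGroup F] [NormedSpace ℝ F]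
    [NormedAddCommGroup G] [NormedSpace ℝ G] [NormedAddCommGroup W] [NormedSpace ℝ W]
    {μ : Measure X} {w : X → G} (hw : LocallyIntegrable w μ) (B : F →L[ℝ] G →L[ℝ] W)
    {ξ : X → F} (hξ : Continuous ξ) (hc : HasCompactSupport ξ) :
    Integrable (fun x => B (ξ x) (w x)) μ := by
  have h1 : Integrable (fun x => ‖ξ x‖ • w x) μ :=
    hw.integrable_smul_left_of_hasCompactSupport hξ.norm hc.norm
  refine (h1.norm.const_mul ‖B‖).mono' ?_ (Filter.Eventually.of_forall fun x => ?_)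
  · exact B.aestronglyMeasurable_comp₂ hξ.aestronglyMeasurable hw.aestronglyMeasurable
  · rw [norm_smul, norm_norm, ← mul_assoc]
    exact B.le_opNorm₂ _ _

section

variable {n k : ℕ}

lemma integrable_weak_integrand {μ : Measure (EuclideanSpace ℝ (Fin n))}
    {θ : EuclideanSpace ℝ (Fin n) → Alt n k} {η : EuclideanSpace ℝ (Fin n) → Alt n (k + 1)}
    (hθ : LocallyIntegrable θ μ) (hη : LocallyIntegrable η μ)
    {g : EuclideanSpace ℝ (Fin n) → ℝ} (hg : ContDiff ℝ ((⊤ : ℕ∞) : WithTop ℕ∞) g)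
    (hc : HasCompactSupport g) :
    Integrable (fun x => wedgeL (fderiv ℝ g x) (θ x) + g x • η x) μ :=
  (hθ.integrable_bilin wedgeB (hg.continuous_fderiv (by simp)) (hc.fderiv ℝ)).add
    (hη.integrable_smul_left_of_hasCompactSupport hg.continuous hc)

lemma weak_integrand_eq_zero {U : Set (EuclideanSpace ℝ (Fin n))}
    (θ : EuclideanSpace ℝ (Fin n) → Alt n k) (η : EuclideanSpace ℝ (Fin n) → Alt n (k + 1))
    {g : EuclideanSpace ℝ (Fin n) → ℝ} (hs : tsupport g ⊆ U) {x : EuclideanSpace ℝ (Fin n)}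
    (hx : x ∉ U) : wedgeL (fderiv ℝ g x) (θ x) + g x • η x = 0 := by
  have h1 : x ∉ tsupport g := fun h => hx (hs h)
  have h2 : g x = 0 := image_eq_zero_of_notMem_tsupport h1
  have h3 : fderiv ℝ g x = 0 := fderiv_of_notMem_tsupport (𝕜 := ℝ) h1
  rw [h2, h3, ← wedgeB_apply]
  simp

lemma setIntegral_weak_integrand {U : Set (EuclideanSpace ℝ (Fin n))}
    (θ : EuclideanSpace ℝ (Fin n) → Alt n k) (η : EuclideanSpace ℝ (Fin n) → Alt n (k + 1))
    {g : EuclideanSpace ℝ (Fin n) → ℝ} (hs : tsupport g ⊆ U) :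
    ∫ x in U, (wedgeL (fderiv ℝ g x) (θ x) + g x • η x) =
      ∫ x, (wedgeL (fderiv ℝ g x) (θ x) + g x • η x) :=
  setIntegral_eq_integral_of_forall_compl_eq_zero fun _ hx => weak_integrand_eq_zero θ η hs hx

variable {D : TopologicalSpace.Opens (EuclideanSpace ℝ (Fin n))} {p : ℝ}
  [Fact (1 ≤ ENNReal.ofReal p)]

lemma LpForm.locallyIntegrable_toAlt (ω : LpForm D p k) :
    LocallyIntegrable (fun x => toAlt (ω x))
      (volume.restrict (D : Set (EuclideanSpace ℝ (Fin n)))) := by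
  have h := (Lp.memLp ω).locallyIntegrable Fact.out
  intro x
  obtain ⟨s, hs, hi⟩ := h x
  exact ⟨s, hs, toAlt.integrable_comp hi⟩

/-- A test form is a sum of scalar functions times constant covectors, so both notions test the same
coefficients. The scalar version does not mention a complementary degree and is the one suited to
pullbacks. -/
lemma isWeakD_iff (ω : LpForm D p k) (η : LpForm D p (k + 1)) :
    IsWeakD D ω η ↔ AltWeakD (D : Set (EuclideanSpace ℝ (Fin n)))
      (fun x => toAlt (ω x)) (fun x => toAlt (η x)) := by
  have hcoef : ∀ (g : EuclideanSpace ℝ (Fin n) → ℝ) (x : EuclideanSpace ℝ (Fin n)),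
      ofAlt (wedgeL (fderiv ℝ g x) (toAlt (ω x)) + g x • toAlt (η x)) =
      ∑ i, fderiv ℝ g x (EuclideanSpace.single i 1) • wedge (k + 1) (dx i) (ω x) + g x • η x := by
    intro g x
    rw [map_add, ofAlt_wedgeL, map_smul, ofAlt_toAlt, ofAlt_toAlt]
  constructor
  · intro h g hg hc hs
    have hint := integrable_weak_integrand ω.locallyIntegrable_toAlt η.locallyIntegrable_toAlt hg hc
    rw [← setIntegral_weak_integrand _ _ hs]
    refine ofAlt_injective ?_
    rw [map_zero, ← ofAlt.integral_comp_comm hint]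
    have hint' := ofAlt.integrable_comp hint
    simp only [hcoef] at hint' ⊢
    ext K
    have hcomm := (EuclideanSpace.proj (𝕜 := ℝ) K : Form n (k + 1) →L[ℝ] ℝ).integral_comp_comm hint'
    change (EuclideanSpace.proj (𝕜 := ℝ) K : Form n (k + 1) →L[ℝ] ℝ) _ = 0
    rw [← hcomm]
    have hle : k + 1 ≤ n := by simpa [K.2] using Finset.card_le_univ K.1
    have hl : k + 1 + (n - (k + 1)) = n := by omega
    set J := compIdx hl K with hJ
    -- The test form `g dx_J` with `J` the complement of `K` isolates the coefficient `K`.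
    set φ : EuclideanSpace ℝ (Fin n) → Form n (n - (k + 1)) :=
      fun x => g x • EuclideanSpace.single J (1 : ℝ)
    have hsub : Function.support φ ⊆ Function.support g :=
      fun x hx hx' => hx (by simp [φ, hx'])
    have hφ : IsTestForm D φ :=
      ⟨hg.smul contDiff_const, hc.mono hsub, (closure_mono hsub).trans hs⟩
    have e := h _ hl φ hφ
    rw [← sub_eq_zero, ← integral_const_mul, ← integral_sub
      (ω.integrable_wedge (continuous_extD hφ.smooth) (hasCompactSupport_extD hφ.compact))
      ((η.integrable_wedge hφ.smooth.continuous hφ.compact).const_mul _)] at e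
    have hinj : ∀ K', compIdx hl K' = J ↔ K' = K := by
      intro K'
      refine ⟨fun h => Subtype.ext ?_, fun h => by rw [h]⟩
      have := congrArg Subtype.val h
      simpa [hJ, compIdx] using this
    have hpt : ∀ x, top (wedge n (ω x) (extD (n - (k + 1) + 1) φ x)) -
        (-1) ^ (k + 1) * top (wedge n (η x) (φ x)) =
        ((-1) ^ k * shuffleSign K.1 K.1ᶜ) * (EuclideanSpace.proj (𝕜 := ℝ) K : Form n (k + 1) →L[ℝ] ℝ)
          (∑ i, fderiv ℝ g x (EuclideanSpace.single i 1) • wedge (k + 1) (dx i) (ω x) +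
            g x • η x) := by
      intro x
      rw [top_wedge_extD hl _ _ (hφ.smooth.differentiable (by simp) x), Finset.sum_eq_single K]
      · have : (fun y => φ y (compIdx hl K)) = g := by funext y; simp [φ, J]
        rw [this, mul_assoc]
        simp [φ, J]
      · intro K' _ hK'
        have : (fun y => φ y (compIdx hl K')) = fun _ => 0 := by
          funext y; simp [φ, (hinj K').not.2 hK']
        have h0 := congrFun this x
        simp only at h0
        rw [this, h0]
        simp
      · simp
    simp only [hpt, integral_const_mul] at e
    refine (mul_eq_zero.1 e).resolve_left (mul_ne_zero (pow_ne_zero _ (by norm_num)) ?_)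
    exact shuffleSign_ne_zero _ _
  · intro h l hl φ hφ
    rw [← sub_eq_zero, ← integral_const_mul, ← integral_sub
      (ω.integrable_wedge (continuous_extD hφ.smooth) (hasCompactSupport_extD hφ.compact))
      ((η.integrable_wedge hφ.smooth.continuous hφ.compact).const_mul _)]
    simp only [fun x => top_wedge_extD hl (ω x) (η x) (hφ.smooth.differentiable (by simp) x)]
    have hgK : ∀ J, ContDiff ℝ ((⊤ : ℕ∞) : WithTop ℕ∞) (fun y => φ y J) := fun J =>
      (EuclideanSpace.proj (𝕜 := ℝ) J : Form n l →L[ℝ] ℝ).contDiff.comp hφ.smooth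
    have hsub : ∀ J, Function.support (fun y => φ y J) ⊆ Function.support φ :=
      fun J x hx hx' => hx (by simp [hx'])
    have hcK : ∀ J, HasCompactSupport (fun y => φ y J) := fun J => hφ.compact.mono (hsub J)
    have key : ∀ K, Integrable (fun x => (∑ i, fderiv ℝ (fun y => φ y (compIdx hl K)) x
        (EuclideanSpace.single i 1) • wedge (k + 1) (dx i) (ω x)) K + φ x (compIdx hl K) * η x K)
        (volume.restrict (D : Set (EuclideanSpace ℝ (Fin n)))) ∧
        ∫ x in (D : Set (EuclideanSpace ℝ (Fin n))), ((∑ i, fderiv ℝ (fun y => φ y (compIdx hl K)) x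
        (EuclideanSpace.single i 1) • wedge (k + 1) (dx i) (ω x)) K +
          φ x (compIdx hl K) * η x K) = 0 := by
      intro K
      have hint := integrable_weak_integrand ω.locallyIntegrable_toAlt η.locallyIntegrable_toAlt
        (hgK (compIdx hl K)) (hcK _)
      have hz := h _ (hgK (compIdx hl K)) (hcK _) ((closure_mono (hsub _)).trans hφ.subset)
      rw [← setIntegral_weak_integrand _ _ ((closure_mono (hsub _)).trans hφ.subset)] at hz
      have hcomm := ((EuclideanSpace.proj (𝕜 := ℝ) K : Form n (k + 1) →L[ℝ] ℝ).comp
        ofAlt).integral_comp_comm hint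
      have hint' := ((EuclideanSpace.proj (𝕜 := ℝ) K : Form n (k + 1) →L[ℝ] ℝ).comp
        ofAlt).integrable_comp hint
      rw [hz, map_zero] at hcomm
      simp only [ContinuousLinearMap.comp_apply, hcoef] at hcomm hint'
      exact ⟨hint', hcomm⟩
    rw [integral_const_mul, integral_finsetSum _ fun K _ => (key K).1.const_mul _]
    refine mul_eq_zero_of_right _ (Finset.sum_eq_zero fun K _ => ?_)
    rw [integral_const_mul, (key K).2, mul_zero]

end

/-! ### Mollifiers and the pullback of smooth forms by Lipschitz maps -/

section Pullback

open Filter Topology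

variable {n k : ℕ}

/-- Sequence of mollifiers with support shrinking to the origin. -/
def bump (n : ℕ) (i : ℕ) : ContDiffBump (0 : EuclideanSpace ℝ (Fin n)) where
  -- The bounded ratio of outer to inner radius is what gives almost everywhere convergence of
  -- mollifications of locally integrable functions.
  rIn := 1 / (2 * (i + 1))
  rOut := 1 / (i + 1)
  rIn_pos := by positivity
  rIn_lt_rOut := by
    have : (0 : ℝ) < i + 1 := by positivity
    exact one_div_lt_one_div_of_lt this (by linarith)

lemma bump_rOut_tendsto : Tendsto (fun i => (bump n i).rOut) atTop (𝓝 0) :=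
  tendsto_one_div_add_atTop_nhds_zero_nat

lemma bump_rOut_le_one (i : ℕ) : (bump n i).rOut ≤ 1 := by
  change (1 : ℝ) / (i + 1) ≤ 1
  rw [div_le_one (by positivity)]
  have : (0 : ℝ) ≤ i := by positivity
  linarith

lemma bump_ratio (i : ℕ) : (bump n i).rOut ≤ 2 * (bump n i).rIn := by
  change (1 : ℝ) / (i + 1) ≤ 2 * (1 / (2 * (i + 1)))
  have : (0 : ℝ) < i + 1 := by positivity
  apply le_of_eq
  field_simp

/-- The `i`-th mollification of a function. -/
def mollify {F : Type*} [NormedAddCommGroup F] [NormedSpace ℝ F] (i : ℕ)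
    (f : EuclideanSpace ℝ (Fin n) → F) : EuclideanSpace ℝ (Fin n) → F :=
  convolution ((bump n i).normed volume) f (ContinuousLinearMap.lsmul ℝ ℝ) volume

section Mollify

variable {F : Type*} [NormedAddCommGroup F] [NormedSpace ℝ F]

lemma mollify_apply (i : ℕ) (f : EuclideanSpace ℝ (Fin n) → F) (x : EuclideanSpace ℝ (Fin n)) :
    mollify i f x = ∫ t, (bump n i).normed volume t • f (x - t) := rfl

lemma contDiff_mollify [CompleteSpace F] (i : ℕ) {f : EuclideanSpace ℝ (Fin n) → F}
    (hf : LocallyIntegrable f) : ContDiff ℝ ((⊤ : ℕ∞) : WithTop ℕ∞) (mollify i f) :=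
  (bump n i).hasCompactSupport_normed.contDiff_convolution_left _ (bump n i).contDiff_normed hf

lemma ae_tendsto_mollify [CompleteSpace F] {f : EuclideanSpace ℝ (Fin n) → F}
    (hf : LocallyIntegrable f) :
    ∀ᵐ x, Tendsto (fun i => mollify i f x) atTop (𝓝 (f x)) :=
  ContDiffBump.ae_convolution_tendsto_right_of_locallyIntegrable bump_rOut_tendsto
    (Eventually.of_forall bump_ratio) hf

lemma tendsto_mollify_of_continuous [CompleteSpace F] {f : EuclideanSpace ℝ (Fin n) → F}
    (hf : Continuous f) (x : EuclideanSpace ℝ (Fin n)) :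
    Tendsto (fun i => mollify i f x) atTop (𝓝 (f x)) :=
  ContDiffBump.convolution_tendsto_right_of_continuous bump_rOut_tendsto hf x

lemma norm_mollify_le {f : EuclideanSpace ℝ (Fin n) → F} {C : ℝ}
    (hC : ∀ x, ‖f x‖ ≤ C) (i : ℕ) (x : EuclideanSpace ℝ (Fin n)) : ‖mollify i f x‖ ≤ C := by
  rw [mollify_apply]
  calc _ ≤ ∫ t, (bump n i).normed volume t * C := by
        refine norm_integral_le_of_norm_le ((bump n i).integrable_normed.mul_const C)
          (Eventually.of_forall fun t => ?_)
        rw [norm_smul, Real.norm_of_nonneg ((bump n i).nonneg_normed t)]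
        exact mul_le_mul_of_nonneg_left (hC _) ((bump n i).nonneg_normed t)
    _ = C := by rw [integral_mul_const, (bump n i).integral_normed, one_mul]

lemma dist_mollify_le [CompleteSpace F] {K : ℝ≥0} {f : EuclideanSpace ℝ (Fin n) → F}
    (hf : LipschitzWith K f) (i : ℕ) (x : EuclideanSpace ℝ (Fin n)) :
    dist (mollify i f x) (f x) ≤ K := by
  refine (bump n i).dist_normed_convolution_le hf.continuous.aestronglyMeasurable fun y hy => ?_
  refine (hf.dist_le_mul y x).trans ?_
  have : dist y x ≤ 1 := hy.le.trans (bump_rOut_le_one i)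
  nlinarith [K.2, this]

/-- By Rademacher's theorem `f` is differentiable at `x - t` for almost every `t`, and the Lipschitz
constant dominates the difference quotients, so one may differentiate under the integral. -/
lemma hasFDerivAt_mollify [FiniteDimensional ℝ F] {K : ℝ≥0} {f : EuclideanSpace ℝ (Fin n) → F}
    (hf : LipschitzWith K f) (i : ℕ) (x : EuclideanSpace ℝ (Fin n)) :
    HasFDerivAt (mollify i f) (mollify i (fderiv ℝ f) x) x := by
  have hcs := (bump n i).continuous_normed (μ := volume)
  have hdiff : ∀ᵐ t, DifferentiableAt ℝ f (x - t) := by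
    have := (quasiMeasurePreserving_sub_left (volume : Measure (EuclideanSpace ℝ (Fin n))) x).ae
      hf.ae_differentiableAt
    exact this
  have hmeas : AEStronglyMeasurable (fun t => fderiv ℝ f (x - t)) volume :=
    ((measurable_fderiv ℝ f).comp (measurable_const.sub measurable_id)).aestronglyMeasurable
  refine (hasFDerivAt_integral_of_dominated_loc_of_lip (s := univ)
    (F := fun y t => (bump n i).normed volume t • f (y - t))
    (bound := fun t => (bump n i).normed volume t * K) univ_mem
    (Eventually.of_forall fun y => ?_) ?_ ?_ ?_ ?_ ?_).2
  · exact (hcs.smul (hf.continuous.comp (continuous_const.sub continuous_id))).aestronglyMeasurable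
  · exact (hcs.smul (hf.continuous.comp (continuous_const.sub
      continuous_id))).integrable_of_hasCompactSupport ((bump n i).hasCompactSupport_normed.smul_right)
  · exact hcs.aestronglyMeasurable.smul hmeas
  · refine Eventually.of_forall fun t => LipschitzOnWith.of_dist_le_mul fun y _ z _ => ?_
    have h0 := (bump n i).nonneg_normed (μ := volume) t
    rw [dist_smul₀, Real.norm_of_nonneg h0, Real.coe_nnabs, abs_of_nonneg (by positivity), mul_assoc]
    refine mul_le_mul_of_nonneg_left ?_ h0
    simpa using hf.dist_le_mul (y - t) (z - t)
  · exact (bump n i).integrable_normed.mul_const _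
  · filter_upwards [hdiff] with t ht
    have h1 := ht.hasFDerivAt.comp x ((hasFDerivAt_id x).sub_const t)
    exact h1.const_smul _

end Mollify

/-- The pullback of an alternating form under a linear map. -/
def pull (w : Alt n k) (A : EuclideanSpace ℝ (Fin n) →L[ℝ] EuclideanSpace ℝ (Fin n)) : Alt n k :=
  w.compContinuousLinearMap A

lemma continuous_pull : Continuous fun q : Alt n k ×
    (EuclideanSpace ℝ (Fin n) →L[ℝ] EuclideanSpace ℝ (Fin n)) => pull q.1 q.2 := by
  have h : Continuous fun q : Alt n k ×
      (EuclideanSpace ℝ (Fin n) →L[ℝ] EuclideanSpace ℝ (Fin n)) =>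
      (ContinuousAlternatingMap.compContinuousLinearMapCLM q.2 : Alt n k →L[ℝ] Alt n k) :=
    ContinuousAlternatingMap.continuous_compContinuousLinearMapCLM.comp continuous_snd
  exact h.clm_apply continuous_fst

lemma norm_pull_le (w : Alt n k) (A : EuclideanSpace ℝ (Fin n) →L[ℝ] EuclideanSpace ℝ (Fin n)) :
    ‖pull w A‖ ≤ ‖w‖ * ‖A‖ ^ k := by
  simpa [pull] using w.norm_compContinuousLinearMap_le A

/-- In coefficients the pullback is a sum of coefficients of `w` times multilinear functions of the
images of basis vectors under `A`. -/
lemma contDiff_pull {m : WithTop ℕ∞} {w : EuclideanSpace ℝ (Fin n) → Alt n k}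
    {A : EuclideanSpace ℝ (Fin n) → EuclideanSpace ℝ (Fin n) →L[ℝ] EuclideanSpace ℝ (Fin n)}
    (hw : ContDiff ℝ m w) (hA : ContDiff ℝ m A) : ContDiff ℝ m fun x => pull (w x) (A x) := by
  have h1 : (fun x => pull (w x) (A x)) = fun x => toAlt (ofAlt (pull (w x) (A x))) := by simp
  rw [h1]
  refine toAlt.contDiff.comp (contDiff_euclidean.2 fun I => ?_)
  have h2 : ∀ x, ofAlt (pull (w x) (A x)) I =
      ∑ J, ofAlt (w x) J * dxAlt J (fun a => A x (basisVec I a)) := by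
    intro x
    conv_lhs => rw [← toAlt_ofAlt (w x)]
    simp only [ofAlt_apply, pull, toAlt_apply, ContinuousAlternatingMap.compContinuousLinearMap_apply,
      ContinuousAlternatingMap.sum_apply, ContinuousAlternatingMap.smul_apply, smul_eq_mul]
    rfl
  simp only [h2]
  refine ContDiff.sum fun J _ => ContDiff.mul ?_ ?_
  · exact (contDiff_euclidean.1 (ofAlt.contDiff.comp hw)) J
  · exact (dxAlt J).toContinuousMultilinearMap.contDiff.comp
      (contDiff_pi.2 fun a => hA.clm_apply contDiff_const)

lemma integral_fderiv_eq_zero {F : Type*} [NormedAddCommGroup F] [NormedSpace ℝ F]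
    [FiniteDimensional ℝ F] {w : EuclideanSpace ℝ (Fin n) → F} (hw : ContDiff ℝ 1 w)
    (hc : HasCompactSupport w) : ∫ x, fderiv ℝ w x = 0 := by
  have hint : Integrable (fderiv ℝ w) :=
    (hw.continuous_fderiv one_ne_zero).integrable_of_hasCompactSupport (hc.fderiv ℝ)
  ext v
  rw [ContinuousLinearMap.integral_apply hint]
  have h := integral_smul_fderiv_eq_neg_fderiv_smul_of_integrable (μ := volume)
    (f := fun _ : EuclideanSpace ℝ (Fin n) => (1 : ℝ)) (g := w) (v := v)
    (by simp) (by simpa using hint.apply_continuousLinearMap v)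
    (by simpa using hw.continuous.integrable_of_hasCompactSupport hc)
    (fun x _ => differentiableAt_const _) (fun x _ => hw.differentiable one_ne_zero x)
  simpa using h

lemma continuous_extDeriv {w : EuclideanSpace ℝ (Fin n) → Alt n k} (hw : ContDiff ℝ 1 w) :
    Continuous (extDeriv w) :=
  (ContinuousAlternatingMap.alternatizeUncurryFinCLM ℝ (EuclideanSpace ℝ (Fin n)) ℝ).continuous.comp
    (hw.continuous_fderiv one_ne_zero)

/-- The integrand is `d(g w)`. Evaluated on fixed vectors it is a signed sum of directional
derivatives of compactly supported functions, each of integral zero. -/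
lemma altWeakD_extDeriv {w : EuclideanSpace ℝ (Fin n) → Alt n k} (hw : ContDiff ℝ 1 w) :
    AltWeakD univ w (extDeriv w) := by
  intro g hg hc _
  have hg1 : ContDiff ℝ 1 g := hg.of_le (by exact_mod_cast le_top)
  have hint := integrable_weak_integrand (μ := volume) hw.continuous.locallyIntegrable
    (continuous_extDeriv hw).locallyIntegrable hg hc
  ext v
  have hcomm := (ContinuousAlternatingMap.apply ℝ (EuclideanSpace ℝ (Fin n)) ℝ v :
    Alt n (k + 1) →L[ℝ] ℝ).integral_comp_comm hint
  refine hcomm.symm.trans ?_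
  have hwa : ∀ a : Fin (k + 1), ContDiff ℝ 1 fun y => w y (a.removeNth v) := fun a =>
    (ContinuousAlternatingMap.apply ℝ (EuclideanSpace ℝ (Fin n)) ℝ (a.removeNth v) :
      Alt n k →L[ℝ] ℝ).contDiff.comp hw
  have hpt : ∀ x, (ContinuousAlternatingMap.apply ℝ (EuclideanSpace ℝ (Fin n)) ℝ v :
      Alt n (k + 1) →L[ℝ] ℝ) (wedgeL (fderiv ℝ g x) (w x) + g x • extDeriv w x) =
      ∑ a : Fin (k + 1), (-1) ^ (a : ℕ) *
        fderiv ℝ (fun y => g y • w y (a.removeNth v)) x (v a) := by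
    intro x
    have h1 : ∀ a : Fin (k + 1), fderiv ℝ (fun y => w y (a.removeNth v)) x (v a) =
        (fderiv ℝ w x (v a)) (a.removeNth v) := by
      intro a
      have := ((ContinuousAlternatingMap.apply ℝ (EuclideanSpace ℝ (Fin n)) ℝ (a.removeNth v) :
        Alt n k →L[ℝ] ℝ).hasFDerivAt.comp x (hw.differentiable one_ne_zero x).hasFDerivAt).fderiv
      change fderiv ℝ ((ContinuousAlternatingMap.apply ℝ (EuclideanSpace ℝ (Fin n)) ℝ
        (a.removeNth v) : Alt n k →L[ℝ] ℝ) ∘ w) x (v a) = _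
      rw [this]; rfl
    change (wedgeL (fderiv ℝ g x) (w x) + g x • extDeriv w x) v = _
    rw [ContinuousAlternatingMap.add_apply, ContinuousAlternatingMap.smul_apply, wedgeL_apply,
      extDeriv_apply (hw.differentiable one_ne_zero x), Finset.smul_sum, ← Finset.sum_add_distrib]
    refine Finset.sum_congr rfl fun a _ => ?_
    rw [fderiv_fun_smul (hg1.differentiable one_ne_zero x) ((hwa a).differentiable one_ne_zero x)]
    simp only [_root_.add_apply, _root_.smul_apply, ContinuousLinearMap.smulRight_apply, smul_eq_mul]
    rw [h1]
    simp only [zsmul_eq_mul]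
    push_cast
    ring
  simp only [hpt]
  have hcd : ∀ a : Fin (k + 1), ContDiff ℝ 1 fun y => g y • w y (a.removeNth v) := fun a =>
    hg1.smul (hwa a)
  have hcc : ∀ a : Fin (k + 1), HasCompactSupport fun y => g y • w y (a.removeNth v) := fun a =>
    hc.smul_right
  have hI : ∀ a : Fin (k + 1), Integrable (fderiv ℝ fun y => g y • w y (a.removeNth v)) := fun a =>
    ((hcd a).continuous_fderiv one_ne_zero).integrable_of_hasCompactSupport ((hcc a).fderiv ℝ)
  rw [integral_finsetSum _ fun a _ => ((hI a).apply_continuousLinearMap (v a)).const_mul _]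
  refine Finset.sum_eq_zero fun a _ => ?_
  rw [integral_const_mul, ← ContinuousLinearMap.integral_apply (hI a),
    integral_fderiv_eq_zero (hcd a) (hcc a)]
  simp

/-- For smooth maps this is the classical commutation of `d` with pullback. A Lipschitz map is
mollified: the derivatives are the mollifications of `fderiv ℝ f`, so they converge almost
everywhere and stay bounded by `K`. Pointwise convergence is needed since the pullback is not linear
in the derivative; dominated convergence then concludes. -/
lemma altWeakD_pull_of_smooth {w : EuclideanSpace ℝ (Fin n) → Alt n k}
    (hw : ContDiff ℝ ((⊤ : ℕ∞) : WithTop ℕ∞) w) {K : ℝ≥0}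
    {f : EuclideanSpace ℝ (Fin n) → EuclideanSpace ℝ (Fin n)} (hf : LipschitzWith K f) :
    AltWeakD univ (fun x => pull (w (f x)) (fderiv ℝ f x))
      (fun x => pull (extDeriv w (f x)) (fderiv ℝ f x)) := by
  intro g hg hc _
  have hw1 : ContDiff ℝ 1 w := hw.of_le (by exact_mod_cast le_top)
  have hfl : LocallyIntegrable (fderiv ℝ f) := by
    refine LocallyIntegrable.mono (locallyIntegrable_const (K : ℝ))
      (measurable_fderiv ℝ f).aestronglyMeasurable (Eventually.of_forall fun x => ?_)
    exact (norm_fderiv_le_of_lipschitz ℝ hf).trans (le_abs_self _)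
  set f' : ℕ → EuclideanSpace ℝ (Fin n) → EuclideanSpace ℝ (Fin n) := fun i => mollify i f
  have hf's : ∀ i, ContDiff ℝ ((⊤ : ℕ∞) : WithTop ℕ∞) (f' i) := fun i =>
    contDiff_mollify i hf.continuous.locallyIntegrable
  have hD : ∀ i x, fderiv ℝ (f' i) x = mollify i (fderiv ℝ f) x := fun i x =>
    (hasFDerivAt_mollify hf i x).fderiv
  have hz : ∀ i, ∫ x, (wedgeL (fderiv ℝ g x) (pull (w (f' i x)) (fderiv ℝ (f' i) x)) +
      g x • pull (extDeriv w (f' i x)) (fderiv ℝ (f' i) x)) = 0 := by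
    intro i
    have hsm : ContDiff ℝ 1 fun x => pull (w (f' i x)) (fderiv ℝ (f' i) x) :=
      contDiff_pull (hw1.comp ((hf's i).of_le (by exact_mod_cast le_top)))
        ((hf's i).fderiv_right (m := 1) (right_eq_inf.mp rfl))
    have h := altWeakD_extDeriv hsm g hg hc (subset_univ _)
    have he : ∀ x, extDeriv (fun x => pull (w (f' i x)) (fderiv ℝ (f' i) x)) x =
        pull (extDeriv w (f' i x)) (fderiv ℝ (f' i) x) := fun x =>
      extDeriv_pullback (hw1.differentiable one_ne_zero _) ((hf's i).of_le
        ENat.LEInfty.out).contDiffAt (r := 2) (by simp)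
    simpa only [he] using h
  obtain ⟨R, hR⟩ : ∃ R, ∀ x ∈ tsupport g, ‖f x‖ ≤ R :=
    (hc.image hf.continuous).isBounded.exists_norm_le.imp fun R h x hx => h _ ⟨x, hx, rfl⟩
  -- Radii at most `1` move the values of `f` by at most `K`, so all mollified maps send the support
  -- of `g` into one ball, on which `w` and `dw` are bounded.
  have hf'b : ∀ i, ∀ x ∈ tsupport g, f' i x ∈ Metric.closedBall (0 : EuclideanSpace ℝ (Fin n)) (R + K) := by
    intro i x hx
    rw [mem_closedBall_zero_iff]
    have h1 := dist_mollify_le hf i x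
    rw [dist_eq_norm] at h1
    calc ‖f' i x‖ = ‖(mollify i f x - f x) + f x‖ := by simp [f']
      _ ≤ _ := (norm_add_le _ _).trans (by linarith [hR x hx])
  obtain ⟨M, hM⟩ := (isCompact_closedBall (0 : EuclideanSpace ℝ (Fin n)) (R + K)).exists_bound_of_continuousOn
    hw1.continuous.continuousOn
  obtain ⟨M', hM'⟩ := (isCompact_closedBall (0 : EuclideanSpace ℝ (Fin n)) (R + K)).exists_bound_of_continuousOn
    (continuous_extDeriv hw1).continuousOn
  have hDb : ∀ i x, ‖fderiv ℝ (f' i) x‖ ≤ K := fun i x => by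
    rw [hD]; exact norm_mollify_le (fun y => norm_fderiv_le_of_lipschitz ℝ hf) i x
  have hgc : Continuous (fderiv ℝ g) := hg.continuous_fderiv (by simp)
  have hlim := tendsto_integral_of_dominated_convergence
    (F := fun i x => wedgeL (fderiv ℝ g x) (pull (w (f' i x)) (fderiv ℝ (f' i) x)) +
      g x • pull (extDeriv w (f' i x)) (fderiv ℝ (f' i) x))
    (f := fun x => wedgeL (fderiv ℝ g x) (pull (w (f x)) (fderiv ℝ f x)) +
      g x • pull (extDeriv w (f x)) (fderiv ℝ f x)) (μ := volume)
    (fun x => ((k : ℝ) + 1) * (‖fderiv ℝ g x‖ * (M * (K : ℝ) ^ k)) + ‖g x‖ * (M' * (K : ℝ) ^ (k + 1)))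
    (fun i => by
      refine Continuous.aestronglyMeasurable ?_
      have hDc : Continuous (fderiv ℝ (f' i)) := (hf's i).continuous_fderiv (by simp)
      refine Continuous.add ?_ (hg.continuous.smul ?_)
      · exact ((wedgeB.continuous.comp hgc).clm_apply
          (continuous_pull.comp ((hw1.continuous.comp (hf's i).continuous).prodMk hDc)))
      · exact continuous_pull.comp (((continuous_extDeriv hw1).comp (hf's i).continuous).prodMk hDc))
    (by
      refine Integrable.add ?_ ?_
      · exact (((hgc.norm.mul continuous_const).integrable_of_hasCompactSupport
          ((hc.fderiv ℝ).norm.mul_right))).const_mul _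
      · exact (hg.continuous.norm.mul continuous_const).integrable_of_hasCompactSupport
          (hc.norm.mul_right))
    (fun i => Eventually.of_forall fun x => by
      by_cases hx : x ∈ tsupport g
      · refine (norm_add_le _ _).trans (add_le_add ?_ ?_)
        · refine (norm_wedgeL_le _ _).trans (mul_le_mul_of_nonneg_left
            (mul_le_mul_of_nonneg_left ?_ (norm_nonneg _)) (by positivity))
          refine (norm_pull_le _ _).trans ?_
          exact mul_le_mul (hM _ (hf'b i x hx)) (pow_le_pow_left₀ (norm_nonneg _) (hDb i x) _)
            (by positivity) ((norm_nonneg _).trans (hM _ (hf'b i x hx)))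
        · rw [norm_smul]
          refine mul_le_mul_of_nonneg_left ((norm_pull_le _ _).trans ?_) (norm_nonneg _)
          exact mul_le_mul (hM' _ (hf'b i x hx)) (pow_le_pow_left₀ (norm_nonneg _) (hDb i x) _)
            (by positivity) ((norm_nonneg _).trans (hM' _ (hf'b i x hx)))
      · have h2 : g x = 0 := image_eq_zero_of_notMem_tsupport hx
        have h3 : fderiv ℝ g x = 0 := fderiv_of_notMem_tsupport (𝕜 := ℝ) hx
        rw [h2, h3, ← wedgeB_apply]
        simp)
    (by
      filter_upwards [ae_tendsto_mollify hfl] with x hx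
      have h1 : Tendsto (fun i => f' i x) atTop (𝓝 (f x)) :=
        tendsto_mollify_of_continuous hf.continuous x
      have h2 : Tendsto (fun i => fderiv ℝ (f' i) x) atTop (𝓝 (fderiv ℝ f x)) := by
        simpa only [hD] using hx
      have h3 : ∀ {l : ℕ} {u : EuclideanSpace ℝ (Fin n) → Alt n l}, Continuous u →
          Tendsto (fun i => pull (u (f' i x)) (fderiv ℝ (f' i) x)) atTop
            (𝓝 (pull (u (f x)) (fderiv ℝ f x))) := fun {l u} hu =>
        (continuous_pull.tendsto (u (f x), fderiv ℝ f x)).comp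
          (((hu.tendsto (f x)).comp h1).prodMk_nhds h2)
      exact (((wedgeB (fderiv ℝ g x)).continuous.tendsto _).comp (h3 hw1.continuous)).add
        ((h3 (continuous_extDeriv hw1)).const_smul _))
  simp only [hz] at hlim
  exact tendsto_nhds_unique hlim tendsto_const_nhds |>.symm ▸ rfl

end Pullback

/-! ### Mollified forms: convergence in `L^1` and commutation with `d` -/

section Mollification

open Filter Topology

variable {n k : ℕ}

section

variable {F : Type*} [NormedAddCommGroup F] [NormedSpace ℝ F]

lemma mollify_apply_sub (i : ℕ) (f : EuclideanSpace ℝ (Fin n) → F) (x : EuclideanSpace ℝ (Fin n)) :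
    mollify i f x = ∫ z, (bump n i).normed volume (x - z) • f z :=
  convolution_eq_swap _

lemma integrable_mollify_integrand (i : ℕ) {f : EuclideanSpace ℝ (Fin n) → F}
    (hf : LocallyIntegrable f) (x : EuclideanSpace ℝ (Fin n)) :
    Integrable fun z => (bump n i).normed volume (x - z) • f z := by
  refine hf.integrable_smul_left_of_hasCompactSupport
    ((bump n i).continuous_normed.comp (continuous_const.sub continuous_id)) ?_
  exact (bump n i).hasCompactSupport_normed.comp_homeomorph (Homeomorph.subLeft x)

lemma mollify_sub (i : ℕ) {f g : EuclideanSpace ℝ (Fin n) → F}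
    (hf : LocallyIntegrable f) (hg : LocallyIntegrable g) (x : EuclideanSpace ℝ (Fin n)) :
    mollify i (f - g) x = mollify i f x - mollify i g x := by
  rw [mollify_apply_sub, mollify_apply_sub, mollify_apply_sub, ← integral_sub
    (integrable_mollify_integrand i hf x) (integrable_mollify_integrand i hg x)]
  simp [smul_sub]

lemma lintegral_mollify_le (i : ℕ) {f : EuclideanSpace ℝ (Fin n) → F}
    (hf : AEStronglyMeasurable f volume) :
    ∫⁻ x, ‖mollify i f x‖ₑ ≤ ∫⁻ x, ‖f x‖ₑ := by
  have hm : AEMeasurable (Function.uncurry fun x t : EuclideanSpace ℝ (Fin n) =>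
      ‖(bump n i).normed volume t‖ₑ * ‖f (x - t)‖ₑ) (volume.prod volume) := by
    have h1 : AEMeasurable (fun q : EuclideanSpace ℝ (Fin n) × EuclideanSpace ℝ (Fin n) =>
        ‖(bump n i).normed volume q.2‖ₑ) (volume.prod volume) :=
      ((bump n i).continuous_normed.measurable.comp measurable_snd).enorm.aemeasurable
    have h2 : AEMeasurable (fun q : EuclideanSpace ℝ (Fin n) × EuclideanSpace ℝ (Fin n) =>
        ‖f (q.1 - q.2)‖ₑ) (volume.prod volume) :=
      (hf.comp_quasiMeasurePreserving
        (quasiMeasurePreserving_sub (volume : Measure (EuclideanSpace ℝ (Fin n))) volume)).enorm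
    exact h1.mul h2
  calc ∫⁻ x, ‖mollify i f x‖ₑ
      ≤ ∫⁻ x, ∫⁻ t, ‖(bump n i).normed volume t‖ₑ * ‖f (x - t)‖ₑ := by
        refine lintegral_mono fun x => ?_
        rw [mollify_apply]
        refine (enorm_integral_le_lintegral_enorm _).trans_eq ?_
        simp only [enorm_smul]
    _ = ∫⁻ t, ∫⁻ x, ‖(bump n i).normed volume t‖ₑ * ‖f (x - t)‖ₑ := lintegral_lintegral_swap hm
    _ = ∫⁻ t, ‖(bump n i).normed volume t‖ₑ * ∫⁻ x, ‖f x‖ₑ := by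
        refine lintegral_congr fun t => ?_
        rw [lintegral_const_mul' _ _ enorm_ne_top, lintegral_sub_right_eq_self (fun x => ‖f x‖ₑ) t]
    _ = (∫⁻ t, ‖(bump n i).normed volume t‖ₑ) * ∫⁻ x, ‖f x‖ₑ :=
        lintegral_mul_const _ (bump n i).continuous_normed.measurable.enorm
    _ = _ := by
        have : ∫⁻ t, ‖(bump n i).normed volume t‖ₑ = 1 := by
          rw [← ofReal_integral_norm_eq_lintegral_enorm (bump n i).integrable_normed]
          simp only [fun t => Real.norm_of_nonneg ((bump n i).nonneg_normed (μ := volume) t)]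
          rw [(bump n i).integral_normed, ENNReal.ofReal_one]
        rw [this, one_mul]

lemma tendsto_lintegral_mollify_sub_of_continuous [CompleteSpace F]
    {h : EuclideanSpace ℝ (Fin n) → F} (hh : Continuous h) (hc : HasCompactSupport h) :
    Tendsto (fun i => ∫⁻ x, ‖mollify i h x - h x‖ₑ) atTop (𝓝 0) := by
  obtain ⟨C, hC⟩ := hc.exists_bound_of_continuous hh
  set N := Metric.cthickening 1 (tsupport h)
  have hN : IsCompact N := hc.isCompact.cthickening
  have hlim : Tendsto (fun i => ∫⁻ x, ‖mollify i h x - h x‖ₑ) atTop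
      (𝓝 (∫⁻ _ : EuclideanSpace ℝ (Fin n), 0)) := by
    refine tendsto_lintegral_of_dominated_convergence'
      (N.indicator fun _ => ENNReal.ofReal (2 * C)) (fun i => ?_) (fun i => ?_) ?_ ?_
    · exact (((contDiff_mollify i hh.locallyIntegrable).continuous.sub
        hh).enorm.measurable).aemeasurable
    · refine Eventually.of_forall fun x => ?_
      change ‖mollify i h x - h x‖ₑ ≤ _
      by_cases hx : x ∈ N
      · rw [indicator_of_mem hx, ← ofReal_norm]
        refine ENNReal.ofReal_le_ofReal ((norm_sub_le _ _).trans ?_)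
        linarith [norm_mollify_le hC i x, hC x]
      · rw [indicator_of_notMem hx]
        have h0 : ∀ t, dist t x ≤ 1 → h t = 0 := by
          intro t ht
          by_contra hne
          exact hx (Metric.mem_cthickening_of_dist_le x t 1 _ (subset_closure hne)
            (by rwa [dist_comm]))
        have h1 : mollify i h x = 0 := by
          rw [mollify_apply]
          refine integral_eq_zero_of_ae (Eventually.of_forall fun t => ?_)
          change (bump n i).normed volume t • h (x - t) = 0
          by_cases ht : t ∈ Function.support ((bump n i).normed volume)
          · rw [(bump n i).support_normed_eq, mem_ball_zero_iff] at ht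
            have : h (x - t) = 0 := h0 _ (by
              rw [dist_eq_norm, sub_sub_cancel_left, norm_neg]
              exact ht.le.trans (bump_rOut_le_one i))
            simp [this]
          · rw [Function.notMem_support.1 ht]
            simp
        rw [h1, h0 x (by simp)]
        simp
    · rw [lintegral_indicator hN.measurableSet, setLIntegral_const]
      exact ENNReal.mul_ne_top ENNReal.ofReal_ne_top hN.measure_lt_top.ne
    · refine Eventually.of_forall fun x => ?_
      have := (tendsto_mollify_of_continuous hh x).sub_const (h x)
      simpa using this.enorm
  simpa using hlim

/-- Approximation by continuous functions of compact support, together with the fact that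
mollification does not increase the `L^1` norm. -/
lemma tendsto_lintegral_mollify_sub [CompleteSpace F] {f : EuclideanSpace ℝ (Fin n) → F}
    (hf : Integrable f) : Tendsto (fun i => ∫⁻ x, ‖mollify i f x - f x‖ₑ) atTop (𝓝 0) := by
  rw [ENNReal.tendsto_nhds_zero]
  intro ε hε
  have hε3 : ε / 3 ≠ 0 := by
    simp [hε.ne']
  obtain ⟨h, hc, hle, hcont, hint⟩ := hf.exists_hasCompactSupport_lintegral_sub_le hε3
  filter_upwards [(ENNReal.tendsto_nhds_zero.1
    (tendsto_lintegral_mollify_sub_of_continuous hcont hc)) (ε / 3)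
    (pos_iff_ne_zero.2 hε3)] with i hi
  have hsm := (contDiff_mollify i hint.locallyIntegrable).continuous
  have hsf := (contDiff_mollify i hf.locallyIntegrable).continuous
  calc ∫⁻ x, ‖mollify i f x - f x‖ₑ
      ≤ ∫⁻ x, (‖mollify i (f - h) x‖ₑ + (‖mollify i h x - h x‖ₑ + ‖f x - h x‖ₑ)) := by
        refine lintegral_mono fun x => ?_
        have : mollify i f x - f x = mollify i (f - h) x + ((mollify i h x - h x) - (f x - h x)) := by
          rw [mollify_sub i hf.locallyIntegrable hint.locallyIntegrable]; abel
        rw [this]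
        refine (enorm_add_le _ _).trans (add_le_add le_rfl ?_)
        exact enorm_sub_le
    _ = (∫⁻ x, ‖mollify i (f - h) x‖ₑ) + ((∫⁻ x, ‖mollify i h x - h x‖ₑ) +
          ∫⁻ x, ‖f x - h x‖ₑ) := by
        rw [lintegral_add_left, lintegral_add_left]
        · exact (hsm.sub hcont).enorm.measurable
        · exact (contDiff_mollify i (hf.sub hint).locallyIntegrable).continuous.enorm.measurable
    _ ≤ ε / 3 + (ε / 3 + ε / 3) := by
        refine add_le_add ?_ (add_le_add hi hle)
        exact (lintegral_mollify_le i (hf.sub hint).aestronglyMeasurable).trans hle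
    _ = ε := by rw [← add_assoc, ENNReal.add_thirds]

end

lemma fderiv_mollify_apply (i : ℕ) {s : EuclideanSpace ℝ (Fin n) → ℝ} (hs : LocallyIntegrable s)
    (y u : EuclideanSpace ℝ (Fin n)) :
    fderiv ℝ (mollify i s) y u = ∫ z, fderiv ℝ ((bump n i).normed volume) (y - z) u * s z := by
  have hcd : ContDiff ℝ 1 ((bump n i).normed (volume : Measure (EuclideanSpace ℝ (Fin n)))) :=
    (bump n i).contDiff_normed
  have h : mollify i s = convolution s ((bump n i).normed volume)
      (ContinuousLinearMap.lsmul ℝ ℝ).flip volume := (convolution_flip _).symm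
  rw [h, ((bump n i).hasCompactSupport_normed.hasFDerivAt_convolution_right _ hs hcd y).fderiv,
    convolution_precompR_apply _ hs ((bump n i).hasCompactSupport_normed.fderiv ℝ)
      (hcd.continuous_fderiv one_ne_zero)]
  rfl

/-- The value at `y` is the weak equation tested against the reflected bump `z ↦ φ (y - z)`; only
the ball carrying this bump has to lie in `U`. -/
lemma extDeriv_mollify {U : Set (EuclideanSpace ℝ (Fin n))}
    {θ : EuclideanSpace ℝ (Fin n) → Alt n k} {η : EuclideanSpace ℝ (Fin n) → Alt n (k + 1)}
    (hθ : LocallyIntegrable θ) (hη : LocallyIntegrable η) (h : AltWeakD U θ η) {i : ℕ}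
    {y : EuclideanSpace ℝ (Fin n)} (hy : Metric.closedBall y (bump n i).rOut ⊆ U) :
    extDeriv (mollify i θ) y = mollify i η y := by
  set φ := (bump n i).normed (volume : Measure (EuclideanSpace ℝ (Fin n))) with hφ
  have hφs : ContDiff ℝ ((⊤ : ℕ∞) : WithTop ℕ∞) φ := (bump n i).contDiff_normed
  have hφc : HasCompactSupport φ := (bump n i).hasCompactSupport_normed
  set g : EuclideanSpace ℝ (Fin n) → ℝ := fun z => φ (y - z) with hg
  have hgs : ContDiff ℝ ((⊤ : ℕ∞) : WithTop ℕ∞) g := hφs.comp (contDiff_const.sub contDiff_id)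
  have hgc : HasCompactSupport g := hφc.comp_homeomorph (Homeomorph.subLeft y)
  have hgU : tsupport g ⊆ U := by
    refine Subset.trans (closure_minimal (fun z hz => ?_) Metric.isClosed_closedBall) hy
    have hz' : y - z ∈ Function.support φ := hz
    rw [hφ, (bump n i).support_normed_eq, mem_ball_zero_iff] at hz'
    rw [Metric.mem_closedBall, dist_comm, dist_eq_norm]
    exact hz'.le
  have hgd : ∀ z, fderiv ℝ g z = -fderiv ℝ φ (y - z) := by
    intro z
    have h1 := (hφs.differentiable (by simp) (y - z)).hasFDerivAt.comp z
      ((hasFDerivAt_id z).const_sub y)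
    have h2 := h1.fderiv
    change fderiv ℝ (φ ∘ fun z => y - z) z = _
    refine h2.trans ?_
    ext v; simp
  have hd : Continuous (fderiv ℝ g) := hgs.continuous_fderiv (by simp)
  have hI1 := hθ.integrable_bilin (wedgeB (k := k)) hd (hgc.fderiv ℝ)
  have hI2 := hη.integrable_smul_left_of_hasCompactSupport hgs.continuous hgc
  have e := h g hgs hgc hgU
  have e' := (integral_add hI1 hI2).symm.trans e
  have hθi : ∀ v : Fin k → EuclideanSpace ℝ (Fin n), LocallyIntegrable fun z => θ z v := by
    intro v x
    obtain ⟨s, hs, hi⟩ := hθ x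
    exact ⟨s, hs, (ContinuousAlternatingMap.apply ℝ (EuclideanSpace ℝ (Fin n)) ℝ v :
      Alt n k →L[ℝ] ℝ).integrable_comp hi⟩
  have hdiff : DifferentiableAt ℝ (mollify i θ) y :=
    (contDiff_mollify i hθ).differentiable (by simp) y
  have hcoord : ∀ (v : Fin k → EuclideanSpace ℝ (Fin n)) (x : EuclideanSpace ℝ (Fin n)),
      mollify i θ x v = mollify i (fun z => θ z v) x := by
    intro v x
    rw [mollify_apply_sub, mollify_apply_sub]
    exact ((ContinuousAlternatingMap.apply ℝ (EuclideanSpace ℝ (Fin n)) ℝ v :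
      Alt n k →L[ℝ] ℝ).integral_comp_comm (integrable_mollify_integrand i hθ x)).symm
  have hext : extDeriv (mollify i θ) y = -∫ z, wedgeB (fderiv ℝ g z) (θ z) := by
    rw [← integral_neg]
    ext v
    have hc := (ContinuousAlternatingMap.apply ℝ (EuclideanSpace ℝ (Fin n)) ℝ v :
      Alt n (k + 1) →L[ℝ] ℝ).integral_comp_comm hI1.neg
    refine Eq.trans ?_ hc
    rw [extDeriv_apply hdiff]
    have h1 : ∀ a : Fin (k + 1), fderiv ℝ (fun x => mollify i θ x (a.removeNth v)) y (v a) =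
        ∫ z, fderiv ℝ φ (y - z) (v a) * θ z (a.removeNth v) := by
      intro a
      rw [← fderiv_mollify_apply i (hθi (a.removeNth v))]
      simp only [hcoord]
    have h3 : ∀ a : Fin (k + 1), Integrable fun z => fderiv ℝ φ (y - z) (v a) *
        θ z (a.removeNth v) := by
      intro a
      refine (hθi _).integrable_smul_left_of_hasCompactSupport
        (g := fun z => fderiv ℝ φ (y - z) (v a)) ?_ ?_
      · exact ((hφs.continuous_fderiv (by simp)).comp (continuous_const.sub
          continuous_id)).clm_apply continuous_const
      · refine ((hφc.fderiv ℝ).comp_homeomorph (Homeomorph.subLeft y)).mono fun z hz hz' => hz ?_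
        have : fderiv ℝ φ (y - z) = 0 := hz'
        simp [this]
    simp only [h1, zsmul_eq_mul, ← integral_const_mul]
    rw [← integral_finsetSum _ fun a _ => (h3 a).const_mul _]
    refine integral_congr_ae (Eventually.of_forall fun z => ?_)
    change _ = (-wedgeL (fderiv ℝ g z) (θ z)) v
    rw [ContinuousAlternatingMap.neg_apply, wedgeL_apply, ← Finset.sum_neg_distrib]
    refine Finset.sum_congr rfl fun a _ => ?_
    rw [hgd]
    push_cast
    change _ = -((-1) ^ (a : ℕ) * (-(fderiv ℝ φ (y - z) (v a)) * θ z (a.removeNth v)))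
    ring
  rw [hext, mollify_apply_sub]
  exact neg_eq_of_add_eq_zero_right e'

/-- Used with `N` a compact neighbourhood inside `D`: local integrability on `D` becomes global
integrability, so the form can be mollified on the whole space. -/
lemma AltWeakD.indicator {U N : Set (EuclideanSpace ℝ (Fin n))}
    {θ : EuclideanSpace ℝ (Fin n) → Alt n k} {η : EuclideanSpace ℝ (Fin n) → Alt n (k + 1)}
    (h : AltWeakD U θ η) (hN : N ⊆ U) : AltWeakD N (N.indicator θ) (N.indicator η) := by
  intro g hg hc hs
  rw [← h g hg hc (hs.trans hN)]
  refine integral_congr_ae (Eventually.of_forall fun x => ?_)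
  by_cases hx : x ∈ N
  · simp [hx]
  · simp only
    rw [weak_integrand_eq_zero _ _ hs hx, weak_integrand_eq_zero _ _ hs hx]

end Mollification

/-! ### Pullback of locally integrable forms by Lipschitz maps -/

section BiLipschitz

open Filter Topology

variable {n k : ℕ}

lemma alt_enorm_add_le (a b : Alt n k) : ‖a + b‖ₑ ≤ ‖a‖ₑ + ‖b‖ₑ := by
  rw [← ofReal_norm, ← ofReal_norm, ← ofReal_norm,
    ← ENNReal.ofReal_add (norm_nonneg _) (norm_nonneg _)]
  exact ENNReal.ofReal_le_ofReal (norm_add_le a b)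

lemma alt_enorm_zero : ‖(0 : Alt n k)‖ₑ = 0 := by
  rw [← ofReal_norm, norm_zero, ENNReal.ofReal_zero]

lemma integrable_indicator_of_locallyIntegrable {F : Type*} [NormedAddCommGroup F]
    {D N : Set (EuclideanSpace ℝ (Fin n))} (hN : IsCompact N) (hND : N ⊆ D)
    {θ : EuclideanSpace ℝ (Fin n) → F} (hθ : LocallyIntegrable θ (volume.restrict D)) :
    Integrable (N.indicator θ) := by
  rw [integrable_indicator_iff hN.measurableSet]
  have := (hθ.integrableOn_isCompact hN)
  rwa [IntegrableOn, Measure.restrict_restrict hN.measurableSet, inter_eq_left.2 hND] at this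

lemma lintegral_comp_le {X Y : Type*} [MeasurableSpace X] [MeasurableSpace Y] {μ : Measure X}
    {ν : Measure Y} {f : X → Y} {M : ℝ≥0∞} (hf : AEMeasurable f μ) (hmap : μ.map f ≤ M • ν)
    {u : Y → ℝ≥0∞} (hu : AEMeasurable u ν) : ∫⁻ x, u (f x) ∂μ ≤ M * ∫⁻ y, u y ∂ν := by
  have hac : μ.map f ≪ ν := (Measure.absolutelyContinuous_of_le_smul hmap)
  rw [← lintegral_map' (hu.mono_ac hac) hf]
  refine (lintegral_mono' hmap le_rfl).trans_eq ?_
  rw [lintegral_smul_measure, smul_eq_mul]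

lemma map_absolutelyContinuous_of_map_le {X Y : Type*} [MeasurableSpace X] [MeasurableSpace Y]
    {μ : Measure X} {ν : Measure Y} {f : X → Y} {M : ℝ≥0∞}
    (hmap : μ.map f ≤ M • ν) : μ.map f ≪ ν := Measure.absolutelyContinuous_of_le_smul hmap

lemma fderiv_eq_of_eqOn_isOpen {V : Set (EuclideanSpace ℝ (Fin n))} (hV : IsOpen V)
    {f F : EuclideanSpace ℝ (Fin n) → EuclideanSpace ℝ (Fin n)} (h : EqOn F f V)
    {x : EuclideanSpace ℝ (Fin n)} (hx : x ∈ V) : fderiv ℝ F x = fderiv ℝ f x :=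
  (h.eventuallyEq_of_mem (hV.mem_nhds hx)).fderiv_eq

lemma locallyIntegrable_pull {w : EuclideanSpace ℝ (Fin n) → Alt n k} (hw : Continuous w) {K : ℝ≥0}
    {f : EuclideanSpace ℝ (Fin n) → EuclideanSpace ℝ (Fin n)} (hf : LipschitzWith K f) :
    LocallyIntegrable fun x => pull (w (f x)) (fderiv ℝ f x) := by
  have h0 : LocallyIntegrable fun x => ‖w (f x)‖ * (K : ℝ) ^ k :=
    ((hw.comp hf.continuous).norm.mul continuous_const).locallyIntegrable
  refine h0.mono ?_ ?_
  · exact continuous_pull.comp_aestronglyMeasurable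
      ((hw.comp hf.continuous).aestronglyMeasurable.prodMk
        (measurable_fderiv ℝ f).aestronglyMeasurable)
  · refine Eventually.of_forall fun x => (norm_pull_le _ _).trans ((le_abs_self _).trans' ?_)
    exact mul_le_mul_of_nonneg_left (pow_le_pow_left₀ (norm_nonneg _)
      (norm_fderiv_le_of_lipschitz ℝ hf) _) (norm_nonneg _)

/-- The weak differential commutes with pullback under a Lipschitz map that does not increase
null sets. -/
lemma AltWeakD.pullback {V D : Set (EuclideanSpace ℝ (Fin n))} (hV : IsOpen V) (hD : IsOpen D)
    {f : EuclideanSpace ℝ (Fin n) → EuclideanSpace ℝ (Fin n)} {K : ℝ≥0}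
    (hf : LipschitzOnWith K f V) (hfm : MapsTo f V D) {M : ℝ≥0∞} (hM : M ≠ ∞)
    (hmap : (volume.restrict V).map f ≤ M • volume.restrict D)
    {θ : EuclideanSpace ℝ (Fin n) → Alt n k} {η : EuclideanSpace ℝ (Fin n) → Alt n (k + 1)}
    (hθ : LocallyIntegrable θ (volume.restrict D)) (hη : LocallyIntegrable η (volume.restrict D))
    (h : AltWeakD D θ η) :
    AltWeakD V (fun x => pull (θ (f x)) (fderiv ℝ f x)) (fun x => pull (η (f x)) (fderiv ℝ f x)) := by
  intro g hg hc hs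
  -- If the integrand is not integrable, its Bochner integral is zero by convention.
  by_cases hX : Integrable fun x => wedgeL (fderiv ℝ g x) (pull (θ (f x)) (fderiv ℝ f x)) +
      g x • pull (η (f x)) (fderiv ℝ f x)
  swap
  · exact integral_undef hX
  -- `altWeakD_pull_of_smooth` needs a map that is Lipschitz on the whole space. On the open set `V`
  -- the extension has the same values and derivatives as `f`.
  obtain ⟨F, hF, hFf'⟩ := hf.extend_finite_dimension
  have hFf : EqOn F f V := hFf'.symm
  set K' := lipschitzExtensionConstant (EuclideanSpace ℝ (Fin n)) * K
  have hfV : AEMeasurable f (volume.restrict V) :=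
    hf.continuousOn.aemeasurable hV.measurableSet
  set S := f '' tsupport g
  have hScpt : IsCompact S := hc.isCompact.image_of_continuousOn (hf.continuousOn.mono hs)
  have hSD : S ⊆ D := by
    rintro _ ⟨x, hx, rfl⟩; exact hfm (hs hx)
  obtain ⟨δ, hδ, hN⟩ := hScpt.exists_cthickening_subset_open hD hSD
  set N := Metric.cthickening δ S
  have hNc : IsCompact N := hScpt.cthickening
  have hθN : Integrable (N.indicator θ) := integrable_indicator_of_locallyIntegrable hNc hN hθ
  have hηN : Integrable (N.indicator η) := integrable_indicator_of_locallyIntegrable hNc hN hη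
  have hweak := h.indicator hN
  set X := fun x => wedgeL (fderiv ℝ g x) (pull (θ (f x)) (fderiv ℝ f x)) +
      g x • pull (η (f x)) (fderiv ℝ f x)
  obtain ⟨G, hG⟩ := hc.exists_bound_of_continuous hg.continuous
  obtain ⟨G', hG'⟩ := (hc.fderiv ℝ).exists_bound_of_continuous (hg.continuous_fderiv (by simp))
  set C₁ : ℝ≥0∞ := ENNReal.ofReal ((k + 1) * (G' * (K' : ℝ) ^ k))
  set C₂ : ℝ≥0∞ := ENNReal.ofReal (G * (K' : ℝ) ^ (k + 1))
  -- The integral for the mollified form vanishes, so the one sought equals a difference. This is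
  -- bounded by `L^1` distances on the target, the measure inequality `hmap` supplying the factor
  -- `M`.
  have hbound : ∀ᶠ i in atTop, ‖∫ x, X x‖ₑ ≤
      C₁ * (M * ∫⁻ y, ‖mollify i (N.indicator θ) y - N.indicator θ y‖ₑ) +
      C₂ * (M * ∫⁻ y, ‖mollify i (N.indicator η) y - N.indicator η y‖ₑ) := by
    -- Once the mollification radius is below `δ`, the balls centred on `S` lie in `N`, where
    -- `extDeriv_mollify` applies.
    filter_upwards [bump_rOut_tendsto (n := n) |>.eventually (gt_mem_nhds hδ)] with i hi
    have hsmθ := contDiff_mollify i hθN.locallyIntegrable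
    have hsmη := contDiff_mollify i hηN.locallyIntegrable
    have hz := altWeakD_pull_of_smooth hsmθ hF g hg hc (subset_univ _)
    have hI := integrable_weak_integrand (μ := volume)
      (locallyIntegrable_pull hsmθ.continuous hF)
      (locallyIntegrable_pull (continuous_extDeriv (hsmθ.of_le (by exact_mod_cast le_top))) hF)
      hg hc
    rw [← sub_zero (∫ x, X x), ← hz, ← integral_sub hX hI]
    refine (enorm_integral_le_lintegral_enorm _).trans ?_
    have hpt : ∀ x, ‖X x - (wedgeL (fderiv ℝ g x) (pull (mollify i (N.indicator θ) (F x))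
        (fderiv ℝ F x)) + g x • pull (extDeriv (mollify i (N.indicator θ)) (F x))
          (fderiv ℝ F x))‖ₑ ≤ V.indicator (fun x =>
        C₁ * ‖mollify i (N.indicator θ) (f x) - N.indicator θ (f x)‖ₑ +
        C₂ * ‖mollify i (N.indicator η) (f x) - N.indicator η (f x)‖ₑ) x := by
      intro x
      by_cases hx : x ∈ tsupport g
      · have hxV : x ∈ V := hs hx
        have hFx : F x = f x := hFf hxV
        have hDx : fderiv ℝ F x = fderiv ℝ f x := fderiv_eq_of_eqOn_isOpen hV hFf hxV
        have hDn : ‖fderiv ℝ f x‖ ≤ K' := hDx ▸ norm_fderiv_le_of_lipschitz ℝ hF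
        have hfS : f x ∈ S := ⟨x, hx, rfl⟩
        have hball : Metric.closedBall (f x) (bump n i).rOut ⊆ N := fun y hy =>
          Metric.mem_cthickening_of_dist_le y (f x) δ S hfS (hy.trans hi.le)
        have hfN : f x ∈ N := hball (Metric.mem_closedBall_self (bump n i).rOut_pos.le)
        rw [indicator_of_mem hxV, hFx, hDx,
          extDeriv_mollify hθN.locallyIntegrable hηN.locallyIntegrable hweak hball,
          indicator_of_mem hfN, indicator_of_mem hfN]
        have hsplit : X x - (wedgeL (fderiv ℝ g x) (pull (mollify i (N.indicator θ) (f x))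
            (fderiv ℝ f x)) + g x • pull (mollify i (N.indicator η) (f x)) (fderiv ℝ f x)) =
            -(wedgeL (fderiv ℝ g x) (pull (mollify i (N.indicator θ) (f x) - θ (f x))
            (fderiv ℝ f x)) + g x • pull (mollify i (N.indicator η) (f x) - η (f x))
              (fderiv ℝ f x)) := by
          have hp : ∀ {l : ℕ} (a b : Alt n l), pull (a - b) (fderiv ℝ f x) =
              pull a (fderiv ℝ f x) - pull b (fderiv ℝ f x) := fun a b => rfl
          rw [hp, hp, ← wedgeB_apply _ (_ - _), map_sub, smul_sub]
          simp only [X, wedgeB_apply]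
          abel
        rw [hsplit, enorm_neg]
        refine (alt_enorm_add_le _ _).trans (add_le_add ?_ ?_)
        · rw [← ofReal_norm, ← ofReal_norm, ← ENNReal.ofReal_mul' (norm_nonneg _)]
          refine ENNReal.ofReal_le_ofReal ((norm_wedgeL_le _ _).trans ?_)
          rw [mul_assoc, mul_assoc]
          refine mul_le_mul_of_nonneg_left ?_ (by positivity)
          refine mul_le_mul (hG' x) ?_ (norm_nonneg _) ((norm_nonneg _).trans (hG' x))
          refine (norm_pull_le _ _).trans ?_
          rw [mul_comm]
          exact mul_le_mul_of_nonneg_right (pow_le_pow_left₀ (norm_nonneg _) hDn _) (norm_nonneg _)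
        · rw [← ofReal_norm, ← ofReal_norm, ← ENNReal.ofReal_mul' (norm_nonneg _)]
          refine ENNReal.ofReal_le_ofReal ?_
          rw [norm_smul, mul_assoc]
          refine mul_le_mul (hG x) ?_ (norm_nonneg _) ((norm_nonneg _).trans (hG x))
          refine (norm_pull_le _ _).trans ?_
          rw [mul_comm]
          exact mul_le_mul_of_nonneg_right (pow_le_pow_left₀ (norm_nonneg _) hDn _) (norm_nonneg _)
      · have h2 : g x = 0 := image_eq_zero_of_notMem_tsupport hx
        have h3 : fderiv ℝ g x = 0 := fderiv_of_notMem_tsupport (𝕜 := ℝ) hx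
        have h4 : ∀ {l : ℕ} (a : Alt n l), wedgeL (0 : EuclideanSpace ℝ (Fin n) →L[ℝ] ℝ) a = 0 := by
          intro l a
          rw [← wedgeB_apply]; simp
        simp only [X, h2, h3, h4, zero_smul, add_zero, sub_zero]
        rw [alt_enorm_zero]
        exact bot_le
    have haeθ : AEMeasurable (fun y => ‖mollify i (N.indicator θ) y - N.indicator θ y‖ₑ) volume :=
      (hsmθ.continuous.aestronglyMeasurable.sub hθN.aestronglyMeasurable).enorm
    have haeη : AEMeasurable (fun y => ‖mollify i (N.indicator η) y - N.indicator η y‖ₑ) volume :=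
      (hsmη.continuous.aestronglyMeasurable.sub hηN.aestronglyMeasurable).enorm
    have hac : (volume.restrict V).map f ≪ volume :=
      (map_absolutelyContinuous_of_map_le hmap).trans Measure.restrict_le_self.absolutelyContinuous
    refine (lintegral_mono hpt).trans ?_
    have hm1 : AEMeasurable (fun x => C₁ * ‖mollify i (N.indicator θ) (f x) -
        N.indicator θ (f x)‖ₑ) (volume.restrict V) :=
      ((haeθ.mono_ac hac).comp_aemeasurable hfV).const_mul _
    rw [lintegral_indicator hV.measurableSet, lintegral_add_left' hm1,
      lintegral_const_mul' _ _ ENNReal.ofReal_ne_top, lintegral_const_mul' _ _ ENNReal.ofReal_ne_top]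
    refine add_le_add (mul_le_mul_right ?_ _) (mul_le_mul_right ?_ _)
    · exact (lintegral_comp_le hfV hmap haeθ.restrict).trans
        (mul_le_mul_right (setLIntegral_le_lintegral _ _) _)
    · exact (lintegral_comp_le hfV hmap haeη.restrict).trans
        (mul_le_mul_right (setLIntegral_le_lintegral _ _) _)
  have hlim : Tendsto (fun i => C₁ * (M * ∫⁻ y, ‖mollify i (N.indicator θ) y - N.indicator θ y‖ₑ) +
      C₂ * (M * ∫⁻ y, ‖mollify i (N.indicator η) y - N.indicator η y‖ₑ)) atTop (𝓝 0) := by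
    have h1 := ENNReal.Tendsto.const_mul (a := C₁) (ENNReal.Tendsto.const_mul (a := M)
      (tendsto_lintegral_mollify_sub hθN) (Or.inr hM)) (Or.inr ENNReal.ofReal_ne_top)
    have h2 := ENNReal.Tendsto.const_mul (a := C₂) (ENNReal.Tendsto.const_mul (a := M)
      (tendsto_lintegral_mollify_sub hηN) (Or.inr hM)) (Or.inr ENNReal.ofReal_ne_top)
    simpa using h1.add h2
  have := ge_of_tendsto hlim hbound
  rw [← ofReal_norm, nonpos_iff_eq_zero, ENNReal.ofReal_eq_zero] at this
  exact norm_le_zero_iff.1 this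

/-- Lebesgue measure is a multiple of the `n`-dimensional Hausdorff measure, which a Lipschitz map
enlarges by at most `L^n`; no area formula is involved. -/
lemma volume_image_le {L : ℝ≥0} {s : Set (EuclideanSpace ℝ (Fin n))}
    {α : EuclideanSpace ℝ (Fin n) → EuclideanSpace ℝ (Fin n)} (h : LipschitzOnWith L α s) :
    volume (α '' s) ≤ (L : ℝ≥0∞) ^ n * volume s := by
  rw [← EuclideanSpace.euclideanHausdorffMeasure_eq_volume n,
    Measure.euclideanHausdorffMeasure_def]
  simp only [Measure.smul_apply]
  have h1 := h.hausdorffMeasure_image_le (d := n) (by positivity)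
  rw [ENNReal.rpow_natCast] at h1
  rw [mul_smul_comm]
  gcongr

end BiLipschitz

/-! ### Change of variables and chain rule for bi-Lipschitz maps -/

section BiLipschitz

open Filter Topology

variable {n k : ℕ} {C L : ℝ≥0} {D V : Set (EuclideanSpace ℝ (Fin n))}
  {β α : EuclideanSpace ℝ (Fin n) → EuclideanSpace ℝ (Fin n)}

lemma IsBiLipschitz.symm (h : IsBiLipschitz C L D V β α) : IsBiLipschitz L C V D α β :=
  ⟨h.mapsTo_inv, h.mapsTo, h.right_inv, h.left_inv, h.lipschitz_inv, h.lipschitz⟩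

lemma IsBiLipschitz.aemeasurable (h : IsBiLipschitz C L D V β α) (hD : MeasurableSet D) :
    AEMeasurable β (volume.restrict D) :=
  h.lipschitz.continuousOn.aemeasurable hD

/-- The preimage of `s` in `D` is contained in the image of `s ∩ V` under `α`, so the constant is
that of the inverse map. -/
lemma IsBiLipschitz.map_le (h : IsBiLipschitz C L D V β α) (hD : MeasurableSet D)
    (hV : MeasurableSet V) :
    (volume.restrict D).map β ≤ ((L : ℝ≥0∞) ^ n) • volume.restrict V := by
  refine Measure.le_iff.2 fun s hs => ?_
  rw [Measure.map_apply_of_aemeasurable (h.aemeasurable hD) hs, Measure.restrict_apply' hD,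
    Measure.smul_apply, Measure.restrict_apply' hV, smul_eq_mul]
  refine (measure_mono ?_).trans (volume_image_le (h.lipschitz_inv.mono inter_subset_right))
  rintro x ⟨hx, hxD⟩
  exact ⟨β x, ⟨hx, h.mapsTo hxD⟩, h.left_inv hxD⟩

lemma IsBiLipschitz.ae_differentiableAt (h : IsBiLipschitz C L D V β α) (hD : IsOpen D) :
    ∀ᵐ x ∂volume.restrict D, DifferentiableAt ℝ β x := by
  rw [ae_restrict_iff' hD.measurableSet]
  filter_upwards [h.lipschitz.ae_differentiableWithinAt_of_mem] with x hx hxD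
  exact (hx hxD).differentiableAt (hD.mem_nhds hxD)

lemma IsBiLipschitz.norm_fderiv_le (h : IsBiLipschitz C L D V β α) (hD : IsOpen D)
    {x : EuclideanSpace ℝ (Fin n)} (hx : x ∈ D) : ‖fderiv ℝ β x‖ ≤ C :=
  norm_fderiv_le_of_lipschitzOn ℝ (hD.mem_nhds hx) h.lipschitz

lemma IsBiLipschitz.ae_comp (h : IsBiLipschitz C L D V β α) (hD : MeasurableSet D)
    (hV : MeasurableSet V) {P : EuclideanSpace ℝ (Fin n) → Prop}
    (hP : ∀ᵐ y ∂volume.restrict V, P y) : ∀ᵐ x ∂volume.restrict D, P (β x) :=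
  ae_of_ae_map (h.aemeasurable hD)
    ((map_absolutelyContinuous_of_map_le (h.map_le hD hV)).ae_le hP)

/-- The chain rule for `α ∘ β = id` holds wherever both derivatives exist. The points of `V` where
`α` is not differentiable form a null set, whose preimage under `β` is null by
`IsBiLipschitz.map_le`. -/
lemma IsBiLipschitz.ae_pull_pull (h : IsBiLipschitz C L D V β α) (hD : IsOpen D) (hV : IsOpen V)
    (u : EuclideanSpace ℝ (Fin n) → Alt n k) :
    ∀ᵐ x ∂volume.restrict D,
      pull (pull (u (α (β x))) (fderiv ℝ α (β x))) (fderiv ℝ β x) = u x := by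
  filter_upwards [h.ae_differentiableAt hD, h.ae_comp hD.measurableSet hV.measurableSet
    (h.symm.ae_differentiableAt hV), ae_restrict_mem hD.measurableSet] with x hβ hα hx
  have h1 : fderiv ℝ (α ∘ β) x = (fderiv ℝ α (β x)).comp (fderiv ℝ β x) := fderiv_comp x hα hβ
  have h2 : fderiv ℝ (α ∘ β) x = ContinuousLinearMap.id ℝ _ := by
    have h3 : EqOn (α ∘ β) id D := fun y hy => h.left_inv hy
    rw [fderiv_eq_of_eqOn_isOpen hD h3 hx, fderiv_id]
  rw [h2] at h1
  ext v
  rw [h.left_inv hx]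
  change u x (fun a => (fderiv ℝ α (β x)).comp (fderiv ℝ β x) (v a)) = u x v
  rw [← h1]
  rfl

end BiLipschitz

/-! ### Contraction with a vector -/

namespace Form

variable {n k : ℕ}

/-- The contraction of an alternating form with a vector. -/
def contr : EuclideanSpace ℝ (Fin n) →L[ℝ] Alt n (k + 1) →L[ℝ] Alt n k :=
  (ContinuousAlternatingMap.curryLeftLI (𝕜 := ℝ) (E := EuclideanSpace ℝ (Fin n)) (F := ℝ)
    (n := k)).toContinuousLinearMap.flip

lemma contr_apply (X : EuclideanSpace ℝ (Fin n)) (w : Alt n (k + 1)) :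
    contr X w = w.curryLeft X := rfl

lemma norm_contr_le (X : EuclideanSpace ℝ (Fin n)) (w : Alt n (k + 1)) :
    ‖contr X w‖ ≤ ‖X‖ * ‖w‖ := by
  rw [contr_apply, mul_comm]
  exact (w.curryLeft.le_opNorm X).trans_eq (by rw [ContinuousAlternatingMap.norm_curryLeft])

/-- Contraction is an antiderivation: the first term of the alternating sum gives `ξ X • w`, and the
remaining indices shift by one and change sign. -/
lemma contr_wedgeL (X : EuclideanSpace ℝ (Fin n)) (ξ : EuclideanSpace ℝ (Fin n) →L[ℝ] ℝ)
    (w : Alt n (k + 1)) : contr X (wedgeL ξ w) = ξ X • w - wedgeL ξ (contr X w) := by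
  ext v
  rw [contr_apply, ContinuousAlternatingMap.curryLeft_apply_apply, wedgeL_apply, Fin.sum_univ_succ,
    ContinuousAlternatingMap.sub_apply, ContinuousAlternatingMap.smul_apply, wedgeL_apply,
    sub_eq_add_neg, ← Finset.sum_neg_distrib]
  congr 1
  · simp only [Matrix.vecCons, Fin.val_zero, pow_zero, one_mul, Fin.cons_zero, smul_eq_mul,
      Fin.removeNth_zero, Fin.tail_cons]
  · refine Finset.sum_congr rfl fun a _ => ?_
    rw [contr_apply, ContinuousAlternatingMap.curryLeft_apply_apply]
    have : a.succ.removeNth (Matrix.vecCons X v) = Matrix.vecCons X (a.removeNth v) := by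
      rw [Matrix.vecCons, Matrix.vecCons]
      ext i : 1
      cases i using Fin.cases <;> simp [Fin.removeNth]
    rw [this, Fin.val_succ, pow_succ, Matrix.cons_val_succ]
    ring

/-- Alternatizing the curried form multiplies it by its number of slots; the left side is this
operation written in the standard basis. -/
lemma sum_wedgeL_contr (w : Alt n (k + 1)) :
    ∑ i : Fin n, wedgeL (EuclideanSpace.proj (𝕜 := ℝ) i)
      (contr (EuclideanSpace.single i 1) w) = ((k : ℝ) + 1) • w := by
  have h1 := ContinuousAlternatingMap.alternatizeUncurryFin_curryLeft w
  have h2 : w.curryLeft = ∑ i : Fin n,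
      ((EuclideanSpace.proj (𝕜 := ℝ) i : EuclideanSpace ℝ (Fin n) →L[ℝ] ℝ).smulRight
        (w.curryLeft (EuclideanSpace.single i 1))) := by
    ext x v
    have hx : x = ∑ i, x i • EuclideanSpace.single i (1 : ℝ) := by
      conv_lhs => rw [← (EuclideanSpace.basisFun (Fin n) ℝ).sum_repr x]
      simp
    conv_lhs => rw [hx, map_sum]
    simp
  rw [h2] at h1
  have h3 := map_sum (ContinuousAlternatingMap.alternatizeUncurryFinCLM ℝ
    (EuclideanSpace ℝ (Fin n)) ℝ (n := k)) (fun i : Fin n =>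
      ((EuclideanSpace.proj (𝕜 := ℝ) i : EuclideanSpace ℝ (Fin n) →L[ℝ] ℝ).smulRight
        (w.curryLeft (EuclideanSpace.single i 1)))) Finset.univ
  refine Eq.trans ?_ ((h3.symm.trans h1).trans ?_)
  · rfl
  · rw [← Nat.cast_smul_eq_nsmul ℝ]; push_cast; rfl

lemma sum_contr_wedgeL (w : Alt n (k + 1)) :
    ∑ i : Fin n, contr (EuclideanSpace.single i 1)
      (wedgeL (EuclideanSpace.proj (𝕜 := ℝ) i) w) = ((n : ℝ) - (k + 1)) • w := by
  simp only [contr_wedgeL, Finset.sum_sub_distrib, sum_wedgeL_contr]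
  refine Eq.trans ?_ (sub_smul (n : ℝ) ((k : ℝ) + 1) w).symm
  simp [Nat.cast_smul_eq_nsmul]

lemma eq_sum_single (X : EuclideanSpace ℝ (Fin n)) :
    X = ∑ i, X i • EuclideanSpace.single i (1 : ℝ) := by
  conv_lhs => rw [← (EuclideanSpace.basisFun (Fin n) ℝ).sum_repr X]
  simp

end Form

/-! ### Closed forms and the radial field -/

section Cone

open Filter Topology

variable {n m : ℕ}

lemma integral_add_smul_sub_sum {X F ι : Type*} [MeasurableSpace X] {μ : Measure X}
    [NormedAddCommGroup F] [NormedSpace ℝ F] [Fintype ι] {a b : X → F} {f : ι → X → F}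
    (ha : Integrable a μ) (hb : Integrable b μ) (hf : ∀ i, Integrable (f i) μ) (c : ℝ) :
    ∫ z, (a z + c • b z - ∑ i, f i z) ∂μ =
      (∫ z, a z ∂μ) + c • (∫ z, b z ∂μ) - ∑ i, ∫ z, f i z ∂μ := by
  rw [integral_sub (f := fun z => a z + c • b z) (ha.add (hb.smul c))
      (integrable_finsetSum _ fun i _ => hf i),
    integral_add (g := fun z => c • b z) ha (hb.smul c), integral_finsetSum _ fun i _ => hf i,
    integral_smul]

/-- A weakly closed form tested against the coefficients of the radial field. -/
lemma AltWeakD.integral_contr {B : Set (EuclideanSpace ℝ (Fin n))}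
    {v : EuclideanSpace ℝ (Fin n) → Alt n (m + 1)} (hv : LocallyIntegrable v)
    (h0 : AltWeakD B v 0) (y : EuclideanSpace ℝ (Fin n))
    {h : EuclideanSpace ℝ (Fin n) → ℝ} (hh : ContDiff ℝ ((⊤ : ℕ∞) : WithTop ℕ∞) h)
    (hc : HasCompactSupport h) (hs : tsupport h ⊆ B) :
    ∫ z, wedgeL (fderiv ℝ h z) (contr (z - y) (v z)) =
      (∫ z, fderiv ℝ h z (z - y) • v z) + ((n : ℝ) - (m + 1)) • ∫ z, h z • v z := by
  have hdc : Continuous (fderiv ℝ h) := hh.continuous_fderiv (by simp)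
  have hdcs : HasCompactSupport (fderiv ℝ h) := hc.fderiv ℝ
  -- Weak closedness tested against the coordinate function `z_i - y_i` times `h`.
  have hA : ∀ i : Fin n, ∫ z, ((z i - y i) • wedgeL (fderiv ℝ h z) (v z) +
      h z • wedgeL (EuclideanSpace.proj (𝕜 := ℝ) i) (v z)) = 0 := by
    intro i
    set q : EuclideanSpace ℝ (Fin n) → ℝ := fun z => (z i - y i)
    have hq : ContDiff ℝ ((⊤ : ℕ∞) : WithTop ℕ∞) q :=
      (EuclideanSpace.proj (𝕜 := ℝ) i : EuclideanSpace ℝ (Fin n) →L[ℝ] ℝ).contDiff.sub contDiff_const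
    have h1 := h0 (fun z => q z * h z) (hq.mul hh) hc.mul_left
      ((closure_mono (Function.support_mul_subset_right _ _)).trans hs)
    rw [← h1]
    refine integral_congr_ae (Eventually.of_forall fun z => ?_)
    have hqd : HasFDerivAt q (EuclideanSpace.proj (𝕜 := ℝ) i : EuclideanSpace ℝ (Fin n) →L[ℝ] ℝ) z :=
      (EuclideanSpace.proj (𝕜 := ℝ) i : EuclideanSpace ℝ (Fin n) →L[ℝ] ℝ).hasFDerivAt.sub_const _
    have hhd : HasFDerivAt h (fderiv ℝ h z) z :=
      (hh.differentiable (by simp) z).hasFDerivAt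
    have h2 : fderiv ℝ (fun z => q z * h z) z =
        q z • fderiv ℝ h z + h z • (EuclideanSpace.proj (𝕜 := ℝ) i : EuclideanSpace ℝ (Fin n) →L[ℝ] ℝ) :=
      (hqd.mul hhd).fderiv
    simp only [h2, ← wedgeB_apply, map_add, map_smul, _root_.add_apply, _root_.smul_apply,
      Pi.zero_apply, smul_zero, add_zero, q]
  have hi1 : Integrable fun z => wedgeL (fderiv ℝ h z) (v z) :=
    hv.integrable_bilin wedgeB hdc hdcs
  have hi2 : Integrable fun z => h z • v z := hv.integrable_smul_left_of_hasCompactSupport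
    hh.continuous hc
  have hi3 : ∀ i : Fin n, Integrable fun z => (z i - y i) • wedgeL (fderiv ℝ h z) (v z) := by
    intro i
    have := hv.integrable_bilin wedgeB (ξ := fun z => (z i - y i) • fderiv ℝ h z)
      (by fun_prop) (hdcs.mono fun z hz h' => hz (by simp [h']))
    simpa only [map_smul, _root_.smul_apply, wedgeB_apply] using this
  have hi4 : ∀ i : Fin n, Integrable fun z =>
      h z • wedgeL (EuclideanSpace.proj (𝕜 := ℝ) i) (v z) := by
    intro i
    have := hv.integrable_bilin wedgeB
      (ξ := fun z => h z • (EuclideanSpace.proj (𝕜 := ℝ) i : EuclideanSpace ℝ (Fin n) →L[ℝ] ℝ))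
      (hh.continuous.smul continuous_const) (hc.mono fun z hz h' => hz (by simp [h']))
    simpa only [map_smul, _root_.smul_apply, wedgeB_apply] using this
  -- The antiderivation rule for the field `z - y`. The last sum consists of contractions of the
  -- integrands of `hA` and so integrates to zero; the multiple of `h v` compensates for the terms
  -- with `dx_i`, by `sum_contr_wedgeL`.
  have hpt : ∀ z, wedgeL (fderiv ℝ h z) (contr (z - y) (v z)) =
      fderiv ℝ h z (z - y) • v z + ((n : ℝ) - (m + 1)) • h z • v z -
      ∑ i : Fin n, contr (EuclideanSpace.single i 1) ((z i - y i) • wedgeL (fderiv ℝ h z) (v z) +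
      h z • wedgeL (EuclideanSpace.proj (𝕜 := ℝ) i) (v z)) := by
    intro z
    have e1 : ∑ i : Fin n, contr (EuclideanSpace.single i 1)
        ((z i - y i) • wedgeL (fderiv ℝ h z) (v z)) = contr (z - y) (wedgeL (fderiv ℝ h z) (v z)) := by
      conv_rhs => rw [eq_sum_single (z - y)]
      simp
    have e2 : ∑ i : Fin n, contr (EuclideanSpace.single i 1)
        (h z • wedgeL (EuclideanSpace.proj (𝕜 := ℝ) i) (v z)) =
        ((n : ℝ) - (m + 1)) • h z • v z := by
      simp only [map_smul]
      rw [← Finset.smul_sum, sum_contr_wedgeL, smul_comm]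
    simp only [map_add, Finset.sum_add_distrib]
    rw [e1, e2, contr_wedgeL]
    abel
  have hi5 : Integrable fun z => fderiv ℝ h z (z - y) • v z := by
    refine hv.integrable_smul_left_of_hasCompactSupport
      (hdc.clm_apply (continuous_id.sub continuous_const)) (hdcs.mono' fun z hz => ?_)
    refine subset_tsupport _ fun h' => hz ?_
    simp [h']
  have hi6 : ∀ i : Fin n, Integrable fun z => contr (EuclideanSpace.single i (1 : ℝ))
      ((z i - y i) • wedgeL (fderiv ℝ h z) (v z) +
      h z • wedgeL (EuclideanSpace.proj (𝕜 := ℝ) i) (v z)) :=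
    fun i => (contr (EuclideanSpace.single i (1 : ℝ))).integrable_comp ((hi3 i).add (hi4 i))
  have : ∀ i : Fin n, ∫ z, contr (EuclideanSpace.single i (1 : ℝ))
      ((z i - y i) • wedgeL (fderiv ℝ h z) (v z) +
      h z • wedgeL (EuclideanSpace.proj (𝕜 := ℝ) i) (v z)) = 0 := by
    intro i
    rw [ContinuousLinearMap.integral_comp_comm _ ((hi3 i).add (hi4 i)), hA i, map_zero]
  refine (integral_congr_ae (Eventually.of_forall hpt)).trans
    ((integral_add_smul_sub_sum hi5 hi2 hi6 _).trans ?_)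
  rw [Finset.sum_eq_zero fun i _ => this i]
  exact sub_zero _

end Cone

/-! ### Homotheties and dilated test functions -/

section Homothety

open Filter Topology

variable {n m : ℕ}

lemma map_homothety (y : EuclideanSpace ℝ (Fin n)) {t : ℝ} (ht : 0 < t) :
    Measure.map (fun x => y + t • (x - y)) (volume : Measure (EuclideanSpace ℝ (Fin n))) =
      ENNReal.ofReal ((t ^ n)⁻¹) • volume := by
  have h1 : (fun x : EuclideanSpace ℝ (Fin n) => y + t • (x - y)) =
      (fun x => y + x) ∘ (fun x => t • x) ∘ fun x => x - y := rfl
  rw [h1, ← Measure.map_map (by fun_prop) (by fun_prop),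
    ← Measure.map_map (by fun_prop) (by fun_prop), (measurePreserving_sub_right volume y).map_eq,
    Measure.map_addHaar_smul volume ht.ne', Measure.map_smul, map_add_left_eq_self]
  rw [finrank_euclideanSpace, Fintype.card_fin, abs_of_pos (by positivity)]

lemma lintegral_homothety (y : EuclideanSpace ℝ (Fin n)) {t : ℝ} (ht : 0 < t)
    {u : EuclideanSpace ℝ (Fin n) → ℝ≥0∞} (hu : Measurable u) :
    ∫⁻ x, u (y + t • (x - y)) = ENNReal.ofReal ((t ^ n)⁻¹) * ∫⁻ x, u x := by
  rw [← lintegral_map (f := u) (g := fun x => y + t • (x - y)) hu (by fun_prop), map_homothety y ht,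
    lintegral_smul_measure, smul_eq_mul]

lemma integral_homothety {F : Type*} [NormedAddCommGroup F] [NormedSpace ℝ F]
    (y : EuclideanSpace ℝ (Fin n)) {t : ℝ} (ht : 0 < t) (u : EuclideanSpace ℝ (Fin n) → F) :
    ∫ x, u (y + t • (x - y)) = (t ^ n)⁻¹ • ∫ x, u x := by
  have h1 := integral_sub_right_eq_self (μ := (volume : Measure (EuclideanSpace ℝ (Fin n))))
    (fun x => u (y + t • x)) y
  rw [h1, Measure.integral_comp_smul volume (fun x => u (y + x)) t, finrank_euclideanSpace,
    Fintype.card_fin, abs_of_pos (by positivity), integral_add_left_eq_self]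

lemma eLpNorm_ofReal_eq {X F : Type*} [MeasurableSpace X] {μ : Measure X} [NormedAddCommGroup F]
    {p : ℝ} (hp : 0 < p) (f : X → F) :
    eLpNorm f (ENNReal.ofReal p) μ = (∫⁻ x, ‖f x‖ₑ ^ p ∂μ) ^ (1 / p) := by
  rw [eLpNorm_eq_lintegral_rpow_enorm_toReal (by simpa using hp) ENNReal.ofReal_ne_top,
    ENNReal.toReal_ofReal hp.le]

lemma lintegral_enorm_le_of_one_le {X F : Type*} [MeasurableSpace X] {μ : Measure X}
    [NormedAddCommGroup F] {p : ℝ} (hp : 1 ≤ p) {f : X → F} (hf : AEStronglyMeasurable f μ) :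
    ∫⁻ x, ‖f x‖ₑ ∂μ ≤ (∫⁻ x, ‖f x‖ₑ ^ p ∂μ) ^ (1 / p) * μ univ ^ (1 - 1 / p) := by
  have h := eLpNorm'_le_eLpNorm'_mul_rpow_measure_univ one_pos hp hf
  simpa [eLpNorm'] using h

/-- The integral of a `p`-integrable function against a bounded compactly supported one, after a
homothety. -/
lemma norm_integral_comp_homothety_le {F : Type*} [NormedAddCommGroup F] [NormedSpace ℝ F]
    {p : ℝ} (hp : 1 ≤ p) {v : EuclideanSpace ℝ (Fin n) → F} (hv : StronglyMeasurable v)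
    (hvp : MemLp v (ENNReal.ofReal p)) {g : EuclideanSpace ℝ (Fin n) → ℝ} (hg : Continuous g)
    (hc : HasCompactSupport g) (y : EuclideanSpace ℝ (Fin n)) :
    ∃ K : ℝ, ∀ t : ℝ, 0 < t → ‖∫ x, g x • v (y + t • (x - y))‖ ≤ K * t ^ (-((n : ℝ) / p)) := by
  have hp0 : 0 < p := by linarith
  obtain ⟨G, hG⟩ := hc.exists_bound_of_continuous hg
  set S := tsupport g
  have hS : volume S ≠ ∞ := hc.isCompact.measure_lt_top.ne
  set N := eLpNorm v (ENNReal.ofReal p) volume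
  -- Hölder on the support of `g`; the homothety then multiplies the `L^p` norm of `v` by
  -- `t^{-n/p}`.
  refine ⟨(ENNReal.ofReal G * (N * volume S ^ (1 - 1 / p))).toReal, fun t ht => ?_⟩
  have hm : StronglyMeasurable fun x => v (y + t • (x - y)) :=
    hv.comp_measurable (by fun_prop)
  have h1 : ‖∫ x, g x • v (y + t • (x - y))‖ₑ ≤
      (ENNReal.ofReal G * (N * volume S ^ (1 - 1 / p))) * ENNReal.ofReal (t ^ (-((n : ℝ) / p))) := by
    calc _ ≤ ∫⁻ x, ‖g x • v (y + t • (x - y))‖ₑ := enorm_integral_le_lintegral_enorm _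
      _ = ∫⁻ x in S, ‖g x • v (y + t • (x - y))‖ₑ := by
        rw [← lintegral_indicator (isClosed_tsupport g).measurableSet]
        refine lintegral_congr fun x => ?_
        by_cases hx : x ∈ S
        · rw [indicator_of_mem hx]
        · rw [indicator_of_notMem hx, image_eq_zero_of_notMem_tsupport hx]; simp
      _ ≤ ∫⁻ x in S, ENNReal.ofReal G * ‖v (y + t • (x - y))‖ₑ := by
        refine lintegral_mono fun x => ?_
        rw [enorm_smul, ← ofReal_norm (g x)]
        exact mul_le_mul_left (ENNReal.ofReal_le_ofReal (hG x)) _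
      _ = ENNReal.ofReal G * ∫⁻ x in S, ‖v (y + t • (x - y))‖ₑ :=
        lintegral_const_mul' _ _ ENNReal.ofReal_ne_top
      _ ≤ ENNReal.ofReal G * ((∫⁻ x in S, ‖v (y + t • (x - y))‖ₑ ^ p) ^ (1 / p) *
          volume S ^ (1 - 1 / p)) := by
        refine mul_le_mul_right ?_ _
        simpa using lintegral_enorm_le_of_one_le (μ := volume.restrict S) hp
          hm.aestronglyMeasurable
      _ ≤ ENNReal.ofReal G * ((ENNReal.ofReal ((t ^ n)⁻¹) * ∫⁻ x, ‖v x‖ₑ ^ p) ^ (1 / p) *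
          volume S ^ (1 - 1 / p)) := by
        refine mul_le_mul_right (mul_le_mul_left (ENNReal.rpow_le_rpow ?_ (by positivity)) _) _
        rw [← lintegral_homothety y ht (u := fun x => ‖v x‖ₑ ^ p)
          ((StronglyMeasurable.enorm hv).pow_const p)]
        exact setLIntegral_le_lintegral _ _
      _ = _ := by
        rw [ENNReal.mul_rpow_of_nonneg _ _ (by positivity), ← eLpNorm_ofReal_eq hp0,
          ENNReal.ofReal_rpow_of_pos (by positivity)]
        have : ((t ^ n)⁻¹) ^ (1 / p) = t ^ (-((n : ℝ) / p)) := by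
          rw [← Real.rpow_natCast, ← Real.rpow_neg ht.le, ← Real.rpow_mul ht.le]
          congr 1; ring
        rw [this]; ring
  have hfin : ENNReal.ofReal G * (N * volume S ^ (1 - 1 / p)) ≠ ∞ := by
    refine ENNReal.mul_ne_top ENNReal.ofReal_ne_top (ENNReal.mul_ne_top hvp.eLpNorm_ne_top ?_)
    refine ENNReal.rpow_ne_top_of_nonneg ?_ hS
    rw [sub_nonneg, div_le_one hp0]; exact hp
  have h2 := ENNReal.toReal_mono (ENNReal.mul_ne_top hfin ENNReal.ofReal_ne_top) h1
  rwa [ENNReal.toReal_mul, toReal_enorm, ENNReal.toReal_ofReal (by positivity)] at h2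

/-- The derivative of the integral of a fixed function against dilates of a test function. -/
lemma hasDerivAt_integral_dilate {F : Type*} [NormedAddCommGroup F] [NormedSpace ℝ F]
    {v : EuclideanSpace ℝ (Fin n) → F} (hv : Integrable v) {g : EuclideanSpace ℝ (Fin n) → ℝ}
    (hg : ContDiff ℝ ((⊤ : ℕ∞) : WithTop ℕ∞) g) (hc : HasCompactSupport g)
    (y : EuclideanSpace ℝ (Fin n)) {t : ℝ} (ht : 0 < t) :
    HasDerivAt (fun s => ∫ z, g (y + s⁻¹ • (z - y)) • v z)
      ((-t⁻¹) • ∫ z, (t⁻¹ * fderiv ℝ g (y + t⁻¹ • (z - y)) (z - y)) • v z) t := by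
  have e1 : (-t⁻¹) • ∫ z, (t⁻¹ * fderiv ℝ g (y + t⁻¹ • (z - y)) (z - y)) • v z =
      ∫ z, (-t⁻¹ * fderiv ℝ g (y + t⁻¹ • (z - y)) (t⁻¹ • (z - y))) • v z := by
    rw [← integral_smul]
    refine integral_congr_ae (Eventually.of_forall fun z => ?_)
    simp only [map_smul, smul_eq_mul, mul_smul]
  rw [e1]
  have hdc : Continuous (fderiv ℝ g) := hg.continuous_fderiv (by simp)
  obtain ⟨G₀, hG₀⟩ := hc.exists_bound_of_continuous hg.continuous
  have hc' : HasCompactSupport fun x => fderiv ℝ g x (x - y) :=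
    (hc.fderiv ℝ).mono' fun z hz => subset_tsupport _ fun h' => hz (by simp [h'])
  obtain ⟨G, hG⟩ := hc'.exists_bound_of_continuous (hdc.clm_apply (continuous_id.sub continuous_const))
  have hpos : ∀ s ∈ Ioi (t / 2), 0 < s := fun s hs => lt_trans (by positivity) (mem_Ioi.1 hs)
  -- For `s > t/2` the factor `s⁻¹` is at most `2/t`, and the rest is the bounded function `x ↦
  -- Dg(x)(x - y)` at the dilated point. Hence the derivative is written with `s⁻¹ • (z - y)`
  -- inside.
  refine (hasDerivAt_integral_of_dominated_loc_of_deriv_le (s := Ioi (t / 2))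
    (F := fun s z => g (y + s⁻¹ • (z - y)) • v z)
    (F' := fun s z => (-s⁻¹ * fderiv ℝ g (y + s⁻¹ • (z - y)) (s⁻¹ • (z - y))) • v z)
    (bound := fun z => (2 / t * G) * ‖v z‖)
    (Ioi_mem_nhds (by linarith)) ?_ ?_ ?_ ?_ (hv.norm.const_mul _) ?_).2
  · refine Eventually.of_forall fun s => ?_
    exact ((hg.continuous.comp (by fun_prop)).aestronglyMeasurable).smul hv.aestronglyMeasurable
  · exact hv.bdd_smul (C := G₀) (hg.continuous.comp (by fun_prop)).aestronglyMeasurable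
      (Eventually.of_forall fun z => hG₀ _)
  · refine AEStronglyMeasurable.smul (Continuous.aestronglyMeasurable ?_) hv.aestronglyMeasurable
    exact continuous_const.mul ((hdc.comp (by fun_prop)).clm_apply (by fun_prop))
  · refine Eventually.of_forall fun z s hs => ?_
    have hs0 := hpos s hs
    rw [norm_smul, norm_mul, norm_neg, Real.norm_of_nonneg (inv_pos.2 hs0).le]
    refine mul_le_mul_of_nonneg_right (mul_le_mul ?_ ?_ (norm_nonneg _) (by positivity))
      (norm_nonneg _)
    · rw [inv_eq_one_div, div_le_div_iff₀ hs0 ht]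
      have := mem_Ioi.1 hs
      linarith
    · simpa using hG (y + s⁻¹ • (z - y))
  · refine Eventually.of_forall fun z s hs => ?_
    have hs0 := hpos s hs
    have h1 : HasDerivAt (fun s : ℝ => y + s⁻¹ • (z - y)) ((-(s ^ 2)⁻¹) • (z - y)) s :=
      ((hasDerivAt_inv hs0.ne').smul_const (z - y)).const_add y
    have h2 := ((hg.differentiable (by simp) _).hasFDerivAt.comp_hasDerivAt s h1).smul_const (v z)
    have h3 : fderiv ℝ g (y + s⁻¹ • (z - y)) (-(s ^ 2)⁻¹ • (z - y)) =
        -s⁻¹ * fderiv ℝ g (y + s⁻¹ • (z - y)) (s⁻¹ • (z - y)) := by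
      rw [map_smul, map_smul, smul_eq_mul, smul_eq_mul, sq, mul_inv]
      ring
    rw [h3] at h2
    exact h2

end Homothety

/-! ### The homotopy formula for a fixed centre -/

section ConeIdentity

open Filter Topology

variable {n m : ℕ}

/-- The integrand of the homotopy operator with centre `q.2` at the time `q.1`. -/
def coneKernel (v : EuclideanSpace ℝ (Fin n) → Alt n (m + 1)) (x : EuclideanSpace ℝ (Fin n))
    (q : ℝ × EuclideanSpace ℝ (Fin n)) : Alt n m :=
  q.1 ^ m • contr (x - q.2) (v (q.2 + q.1 • (x - q.2)))

lemma hasFDerivAt_dilate {g : EuclideanSpace ℝ (Fin n) → ℝ}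
    (hg : ContDiff ℝ ((⊤ : ℕ∞) : WithTop ℕ∞) g) (y : EuclideanSpace ℝ (Fin n)) (s : ℝ)
    (z : EuclideanSpace ℝ (Fin n)) :
    HasFDerivAt (fun z => g (y + s • (z - y))) (s • fderiv ℝ g (y + s • (z - y))) z := by
  have h1 : HasFDerivAt (fun z : EuclideanSpace ℝ (Fin n) => y + s • (z - y))
      (s • ContinuousLinearMap.id ℝ (EuclideanSpace ℝ (Fin n))) z :=
    (((hasFDerivAt_id z).sub_const y).const_smul s).const_add y
  have h2 := (hg.differentiable (by simp) (y + s • (z - y))).hasFDerivAt.comp z h1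
  rw [ContinuousLinearMap.comp_smul, ContinuousLinearMap.comp_id] at h2
  exact h2

lemma dilate_homothety (x y : EuclideanSpace ℝ (Fin n)) {t : ℝ} (ht : 0 < t) :
    y + t⁻¹ • (y + t • (x - y) - y) = x := by
  rw [add_sub_cancel_left, smul_smul, inv_mul_cancel₀ ht.ne', one_smul]; abel

lemma homothety_dilate (x y : EuclideanSpace ℝ (Fin n)) {t : ℝ} (ht : 0 < t) :
    y + t • (y + t⁻¹ • (x - y) - y) = x := by
  rw [add_sub_cancel_left, smul_smul, mul_inv_cancel₀ ht.ne', one_smul]; abel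

lemma hasCompactSupport_dilate {g : EuclideanSpace ℝ (Fin n) → ℝ} (hc : HasCompactSupport g)
    (y : EuclideanSpace ℝ (Fin n)) {t : ℝ} (ht : 0 < t) :
    HasCompactSupport fun z => g (y + t⁻¹ • (z - y)) := by
  refine HasCompactSupport.intro (hc.isCompact.image (f := fun x => y + t • (x - y))
    (by fun_prop)) fun z hz => ?_
  refine image_eq_zero_of_notMem_tsupport fun h => hz ⟨_, h, ?_⟩
  exact homothety_dilate z y ht

lemma tsupport_dilate_subset {B : Set (EuclideanSpace ℝ (Fin n))}
    {y : EuclideanSpace ℝ (Fin n)} (hB : StarConvex ℝ y B) {g : EuclideanSpace ℝ (Fin n) → ℝ}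
    (hs : tsupport g ⊆ B) {t : ℝ} (ht : 0 < t) (ht1 : t ≤ 1) :
    tsupport (fun z => g (y + t⁻¹ • (z - y))) ⊆ B := by
  intro z hz
  have h1 : y + t⁻¹ • (z - y) ∈ tsupport g :=
    tsupport_comp_subset_preimage g (f := fun z => y + t⁻¹ • (z - y)) (by fun_prop) hz
  have h2 := hB.add_smul_sub_mem (hs h1) ht.le ht1
  rwa [homothety_dilate z y ht] at h2

/-- The substitution `z = y + t(x - y)` replaces `g` by its dilate. For `t ≤ 1` the dilate is still
supported in the star-shaped set `B`, so `AltWeakD.integral_contr` applies to it. -/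
lemma integral_wedgeL_coneKernel {B : Set (EuclideanSpace ℝ (Fin n))}
    {y : EuclideanSpace ℝ (Fin n)} (hB : StarConvex ℝ y B)
    {v : EuclideanSpace ℝ (Fin n) → Alt n (m + 1)} (hv : Integrable v) (h0 : AltWeakD B v 0)
    {g : EuclideanSpace ℝ (Fin n) → ℝ} (hg : ContDiff ℝ ((⊤ : ℕ∞) : WithTop ℕ∞) g)
    (hc : HasCompactSupport g) (hs : tsupport g ⊆ B) {t : ℝ} (ht : 0 < t) (ht1 : t ≤ 1) :
    ∫ x, wedgeL (fderiv ℝ g x) (coneKernel v x (t, y)) =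
      (t ^ m * (t ^ n)⁻¹) • ((∫ z, (t⁻¹ * fderiv ℝ g (y + t⁻¹ • (z - y)) (z - y)) • v z) +
        ((n : ℝ) - (m + 1)) • ∫ z, g (y + t⁻¹ • (z - y)) • v z) := by
  have h1 := (h0.integral_contr hv.locallyIntegrable y (h := fun z => g (y + t⁻¹ • (z - y)))
    (hg.comp (by fun_prop)) (hasCompactSupport_dilate hc y ht) (tsupport_dilate_subset hB hs ht ht1))
  have hd : ∀ z, fderiv ℝ (fun z => g (y + t⁻¹ • (z - y))) z =
      t⁻¹ • fderiv ℝ g (y + t⁻¹ • (z - y)) := fun z => (hasFDerivAt_dilate hg y t⁻¹ z).fderiv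
  have e1 : (∫ z, (t⁻¹ * fderiv ℝ g (y + t⁻¹ • (z - y)) (z - y)) • v z) =
      ∫ z, fderiv ℝ (fun z => g (y + t⁻¹ • (z - y))) z (z - y) • v z := by
    refine integral_congr_ae (Eventually.of_forall fun z => ?_)
    simp only [hd, _root_.smul_apply, smul_eq_mul]
  rw [e1, ← h1, mul_smul, ← integral_homothety y ht, ← integral_smul]
  refine integral_congr_ae (Eventually.of_forall fun x => ?_)
  simp only [hd, coneKernel, add_sub_cancel_left, ← wedgeB_apply, map_smul,
    _root_.smul_apply]
  rw [inv_smul_smul₀ ht.ne', add_sub_cancel, smul_inv_smul₀ ht.ne']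

/-- The exponent `m + 1 - n` is chosen so that differentiating the power produces exactly the
multiple of `M` in `integral_wedgeL_coneKernel`: the time integrand becomes an exact derivative. -/
lemma hasDerivAt_pow_smul {F : Type*} [NormedAddCommGroup F] [NormedSpace ℝ F] {M : ℝ → F} {A : F}
    {t : ℝ} (ht : 0 < t) (hM : HasDerivAt M ((-t⁻¹) • A) t) :
    HasDerivAt (fun t => (t ^ (m + 1) * (t ^ n)⁻¹) • M t)
      (-((t ^ m * (t ^ n)⁻¹) • (A + ((n : ℝ) - (m + 1)) • M t))) t := by
  have a1 := hasDerivAt_pow (m + 1) t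
  have a2 := (hasDerivAt_pow n t).inv (by positivity)
  have hc1 : HasDerivAt (fun t : ℝ => t ^ (m + 1) * (t ^ n)⁻¹)
      (((m : ℝ) + 1 - n) * (t ^ m * (t ^ n)⁻¹)) t := by
    refine (a1.mul a2).congr_deriv ?_
    rcases n with _ | n
    · simp
    · simp only [Nat.add_sub_cancel, Pi.inv_apply]
      push_cast
      field_simp
      ring
  refine (hc1.smul hM).congr_deriv ?_
  have e2 : (t ^ (m + 1) * (t ^ n)⁻¹) • (-t⁻¹) • A = -((t ^ m * (t ^ n)⁻¹) • A) := by
    rw [smul_smul, ← neg_smul]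
    congr 1
    field_simp
    ring
  rw [e2]
  module

/-- The homotopy formula, tested against `g`. -/
lemma integral_integral_coneKernel {B : Set (EuclideanSpace ℝ (Fin n))}
    {y : EuclideanSpace ℝ (Fin n)} (hB : StarConvex ℝ y B) {p : ℝ} (hp : 1 ≤ p)
    (hnp : (n : ℝ) / p < m + 1)
    {v : EuclideanSpace ℝ (Fin n) → Alt n (m + 1)} (hv : Integrable v) (hvm : StronglyMeasurable v)
    (hvp : MemLp v (ENNReal.ofReal p)) (h0 : AltWeakD B v 0)
    {g : EuclideanSpace ℝ (Fin n) → ℝ} (hg : ContDiff ℝ ((⊤ : ℕ∞) : WithTop ℕ∞) g)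
    (hc : HasCompactSupport g) (hs : tsupport g ⊆ B)
    (hint : IntegrableOn (fun t : ℝ => ∫ x, wedgeL (fderiv ℝ g x) (coneKernel v x (t, y)))
      (Ioo 0 1)) :
    ∫ t in Ioo (0 : ℝ) 1, ∫ x, wedgeL (fderiv ℝ g x) (coneKernel v x (t, y)) =
      -∫ x, g x • v x := by
  set M : ℝ → Alt n (m + 1) := fun t => ∫ z, g (y + t⁻¹ • (z - y)) • v z
  -- After undoing the dilation, `Φ t = t^{m+1} ∫ g(x) v(y + t(x-y)) dx`. It is of order at most
  -- `t^{m+1-n/p}` near `0`, hence vanishes there, and equals `∫ g v` at `1`.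
  set Φ : ℝ → Alt n (m + 1) := fun t => (t ^ (m + 1) * (t ^ n)⁻¹) • M t
  have hderiv : ∀ t : ℝ, 0 < t → t ≤ 1 → HasDerivAt Φ
      (-∫ x, wedgeL (fderiv ℝ g x) (coneKernel v x (t, y))) t := by
    intro t ht ht1
    have hM := hasDerivAt_integral_dilate hv hg hc y ht
    rw [integral_wedgeL_coneKernel hB hv h0 hg hc hs ht ht1]
    exact hasDerivAt_pow_smul (n := n) (m := m) (M := M) ht hM
  have hlim0 : Tendsto Φ (𝓝[>] 0) (𝓝 0) := by
    obtain ⟨K, hK⟩ := norm_integral_comp_homothety_le hp hvm hvp hg.continuous hc y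
    have hb : ∀ᶠ t in 𝓝[>] (0 : ℝ), ‖Φ t‖ ≤ K * t ^ ((m : ℝ) + 1 - n / p) := by
      filter_upwards [self_mem_nhdsWithin] with t ht
      have ht0 : 0 < t := ht
      have e1 : ∫ x, g x • v (y + t • (x - y)) = (t ^ n)⁻¹ • M t := by
        rw [← integral_homothety y ht0]
        simp only [dilate_homothety _ y ht0]
      have e2 : Φ t = t ^ (m + 1) • ∫ x, g x • v (y + t • (x - y)) := by
        rw [e1, smul_smul]
      rw [e2, norm_smul, Real.norm_of_nonneg (by positivity)]
      calc t ^ (m + 1) * _ ≤ t ^ (m + 1) * (K * t ^ (-((n : ℝ) / p))) :=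
            mul_le_mul_of_nonneg_left (hK t ht0) (by positivity)
        _ = K * t ^ ((m : ℝ) + 1 - n / p) := by
          rw [sub_eq_add_neg, Real.rpow_add ht0, ← Real.rpow_natCast]; push_cast; ring
    refine squeeze_zero_norm' hb ?_
    have h1 : Tendsto (fun t : ℝ => t ^ ((m : ℝ) + 1 - n / p)) (𝓝 0) (𝓝 0) := by
      have := (Real.continuousAt_rpow_const (0 : ℝ) ((m : ℝ) + 1 - n / p)
        (Or.inr (by linarith))).tendsto
      rwa [Real.zero_rpow (by linarith)] at this
    simpa using (h1.mono_left nhdsWithin_le_nhds).const_mul K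
  have hlim1 : Tendsto Φ (𝓝[<] 1) (𝓝 (∫ x, g x • v x)) := by
    have h1 := (hderiv 1 one_pos le_rfl).continuousAt.tendsto
    have e1 : Φ 1 = ∫ x, g x • v x := by simp [Φ, M]
    rw [e1] at h1
    exact h1.mono_left nhdsWithin_le_nhds
  have hii : IntervalIntegrable
      (fun t : ℝ => -∫ x, wedgeL (fderiv ℝ g x) (coneKernel v x (t, y))) volume 0 1 :=
    ((intervalIntegrable_iff_integrableOn_Ioo_of_le zero_le_one).2 hint).neg
  have h := intervalIntegral.integral_eq_sub_of_hasDerivAt_of_tendsto zero_lt_one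
    (fun t ht => hderiv t ht.1 ht.2.le) hii hlim0 hlim1
  rw [intervalIntegral.integral_neg, intervalIntegral.integral_of_le zero_le_one,
    integral_Ioc_eq_integral_Ioo, sub_zero] at h
  rw [← h, neg_neg]

end ConeIdentity

/-! ### `L^p` bounds for the averaged homotopy operator -/

section ConeOperator

open Filter Topology

variable {n m : ℕ}

/-- The homotopy operator averaged over the times and centres. -/
def cone (ν : Measure (ℝ × EuclideanSpace ℝ (Fin n)))
    (v : EuclideanSpace ℝ (Fin n) → Alt n (m + 1)) (x : EuclideanSpace ℝ (Fin n)) : Alt n m :=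
  ∫ q, coneKernel v x q ∂ν

lemma stronglyMeasurable_smul_bilin {X F G W : Type*} [MeasurableSpace X]
    [NormedAddCommGroup F] [NormedSpace ℝ F] [NormedAddCommGroup G] [NormedSpace ℝ G]
    [NormedAddCommGroup W] [NormedSpace ℝ W] {a : X → ℝ} (ha : StronglyMeasurable a)
    (B : F →L[ℝ] G →L[ℝ] W) {ξ : X → F} (hξ : StronglyMeasurable ξ) {w : X → G}
    (hw : StronglyMeasurable w) : StronglyMeasurable fun x => a x • B (ξ x) (w x) :=
  ha.smul (B.isBoundedBilinearMap.continuous.comp_stronglyMeasurable (hξ.prodMk hw))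

lemma stronglyMeasurable_coneKernel {v : EuclideanSpace ℝ (Fin n) → Alt n (m + 1)}
    (hv : StronglyMeasurable v) :
    StronglyMeasurable (Function.uncurry (coneKernel v)) := by
  have h1 : StronglyMeasurable
      fun z : EuclideanSpace ℝ (Fin n) × ℝ × EuclideanSpace ℝ (Fin n) => z.1 - z.2.2 :=
    Continuous.stronglyMeasurable (by fun_prop)
  have h2 : StronglyMeasurable fun z : EuclideanSpace ℝ (Fin n) × ℝ × EuclideanSpace ℝ (Fin n) =>
      v (z.2.2 + z.2.1 • (z.1 - z.2.2)) := hv.comp_measurable (by fun_prop)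
  have h3 : StronglyMeasurable
      fun z : EuclideanSpace ℝ (Fin n) × ℝ × EuclideanSpace ℝ (Fin n) => z.2.1 ^ m :=
    Continuous.stronglyMeasurable (by fun_prop)
  exact stronglyMeasurable_smul_bilin h3 contr h1 h2

lemma measurable_enorm_coneKernel {v : EuclideanSpace ℝ (Fin n) → Alt n (m + 1)}
    (hv : StronglyMeasurable v) (p : ℝ) :
    Measurable fun z : EuclideanSpace ℝ (Fin n) × ℝ × EuclideanSpace ℝ (Fin n) =>
      ‖coneKernel v z.1 z.2‖ₑ ^ p :=
  (StronglyMeasurable.enorm (stronglyMeasurable_coneKernel hv)).pow_const p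

lemma enorm_coneKernel_le (v : EuclideanSpace ℝ (Fin n) → Alt n (m + 1))
    {x y : EuclideanSpace ℝ (Fin n)} {t R : ℝ} (ht : 0 < t) (hR : ‖x - y‖ ≤ R) :
    ‖coneKernel v x (t, y)‖ₑ ≤ ENNReal.ofReal (t ^ m * R) * ‖v (y + t • (x - y))‖ₑ := by
  rw [← ofReal_norm, ← ofReal_norm, ← ENNReal.ofReal_mul' (norm_nonneg _)]
  refine ENNReal.ofReal_le_ofReal ?_
  rw [coneKernel, norm_smul, Real.norm_of_nonneg (by positivity), mul_assoc]
  refine mul_le_mul_of_nonneg_left ((norm_contr_le _ _).trans ?_) (by positivity)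
  exact mul_le_mul_of_nonneg_right hR (norm_nonneg _)

/-- Tonelli puts the integral over `x` innermost. For fixed time and centre the kernel contributes
`(t^m R)^p` and the homothety `t^{-n}`, which combine to `R^p t^{pm-n}`. -/
lemma lintegral_coneKernel_le {p : ℝ} (hp : 1 ≤ p) {B : Set (EuclideanSpace ℝ (Fin n))}
    (hB : MeasurableSet B) {μ : Measure (EuclideanSpace ℝ (Fin n))} [IsProbabilityMeasure μ]
    {R : ℝ} (hR0 : 0 ≤ R) (hR : ∀ᵐ y ∂μ, ∀ x ∈ B, ‖x - y‖ ≤ R) {T : Set ℝ} (hTm : MeasurableSet T)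
    (hT : T ⊆ Ioi 0) {v : EuclideanSpace ℝ (Fin n) → Alt n (m + 1)} (hv : StronglyMeasurable v) :
    ∫⁻ x in B, ∫⁻ q, ‖coneKernel v x q‖ₑ ^ p ∂((volume.restrict T).prod μ) ≤
      ENNReal.ofReal (R ^ p) * (∫⁻ t in T, ENNReal.ofReal (t ^ (p * m - n))) *
        ∫⁻ x, ‖v x‖ₑ ^ p := by
  have hp0 : 0 < p := by linarith
  have hK := measurable_enorm_coneKernel hv p
  have hmv : Measurable fun x => ‖v x‖ₑ ^ p := (StronglyMeasurable.enorm hv).pow_const p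
  rw [lintegral_lintegral_swap hK.aemeasurable]
  rw [lintegral_prod _ (Measurable.aemeasurable ?_)]
  swap
  · exact (hK.comp measurable_swap).lintegral_prod_right'
  have key : ∀ t ∈ T, ∀ᵐ y ∂μ, ∫⁻ x in B, ‖coneKernel v x (t, y)‖ₑ ^ p ≤
      ENNReal.ofReal (R ^ p) * ENNReal.ofReal (t ^ (p * m - n)) * ∫⁻ x, ‖v x‖ₑ ^ p := by
    intro t htT
    have ht : 0 < t := hT htT
    filter_upwards [hR] with y hy
    have e : ENNReal.ofReal (R ^ p) * ENNReal.ofReal (t ^ (p * m - n)) =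
        ENNReal.ofReal (t ^ m * R) ^ p * ENNReal.ofReal ((t ^ n)⁻¹) := by
      rw [ENNReal.ofReal_rpow_of_nonneg (by positivity) hp0.le,
        ← ENNReal.ofReal_mul (by positivity), ← ENNReal.ofReal_mul (by positivity)]
      congr 1
      rw [Real.mul_rpow (by positivity) hR0, Real.rpow_sub ht, Real.rpow_natCast, mul_comm p,
        Real.rpow_mul ht.le, Real.rpow_natCast]
      ring
    rw [e, mul_assoc, ← lintegral_homothety y ht hmv, ← lintegral_const_mul' _ _ (by
      refine ENNReal.rpow_ne_top_of_nonneg hp0.le ENNReal.ofReal_ne_top)]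
    refine (setLIntegral_mono' hB fun x hx => ?_).trans (setLIntegral_le_lintegral B _)
    rw [← ENNReal.mul_rpow_of_nonneg _ _ hp0.le]
    exact ENNReal.rpow_le_rpow (enorm_coneKernel_le v ht (hy x hx)) hp0.le
  calc _ ≤ ∫⁻ t in T, ENNReal.ofReal (R ^ p) * ENNReal.ofReal (t ^ (p * m - n)) *
        ∫⁻ x, ‖v x‖ₑ ^ p := by
        refine setLIntegral_mono' hTm fun t ht => ?_
        refine (lintegral_mono_ae (key t ht)).trans_eq ?_
        rw [lintegral_const, measure_univ, mul_one]
    _ = _ := by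
        rw [lintegral_mul_const _ (by fun_prop), lintegral_const_mul _ (by fun_prop)]

/-- The measure on times and centres has mass at most `1`, so the `p`-th power of the integral is at
most the integral of the `p`-th power. The set `T` stays free: `(0,1)` gives the full bound, `(s,1)`
a small remainder. -/
lemma eLpNorm_cone_le {p : ℝ} (hp : 1 ≤ p) {B : Set (EuclideanSpace ℝ (Fin n))}
    (hB : MeasurableSet B) {μ : Measure (EuclideanSpace ℝ (Fin n))} [IsProbabilityMeasure μ]
    {R : ℝ} (hR0 : 0 ≤ R) (hR : ∀ᵐ y ∂μ, ∀ x ∈ B, ‖x - y‖ ≤ R) {T : Set ℝ} (hTm : MeasurableSet T)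
    (hT : T ⊆ Ioo 0 1) {v : EuclideanSpace ℝ (Fin n) → Alt n (m + 1)} (hv : StronglyMeasurable v) :
    eLpNorm (cone ((volume.restrict T).prod μ) v) (ENNReal.ofReal p) (volume.restrict B) ≤
      ENNReal.ofReal R * (∫⁻ t in T, ENNReal.ofReal (t ^ (p * m - n))) ^ (1 / p) *
        eLpNorm v (ENNReal.ofReal p) volume := by
  have hp0 : 0 < p := by linarith
  have hν : ((volume.restrict T).prod μ) univ ≤ 1 := by
    rw [← univ_prod_univ, Measure.prod_prod, measure_univ (μ := μ), mul_one,
      Measure.restrict_apply_univ]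
    exact (measure_mono hT).trans (by simp)
  have hJ : ∀ x, ‖cone ((volume.restrict T).prod μ) v x‖ₑ ^ p ≤
      ∫⁻ q, ‖coneKernel v x q‖ₑ ^ p ∂((volume.restrict T).prod μ) := by
    intro x
    have hm : AEStronglyMeasurable (coneKernel v x) ((volume.restrict T).prod μ) :=
      ((stronglyMeasurable_coneKernel hv).comp_measurable measurable_prodMk_left).aestronglyMeasurable
    have h1 := (enorm_integral_le_lintegral_enorm (coneKernel v x)).trans
      (lintegral_enorm_le_of_one_le hp hm)
    have h2 : ((volume.restrict T).prod μ) univ ^ (1 - 1 / p) ≤ 1 :=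
      ENNReal.rpow_le_one hν (by rw [sub_nonneg, div_le_one hp0]; exact hp)
    have h3 := h1.trans (mul_le_of_le_one_right' h2)
    refine (ENNReal.rpow_le_rpow h3 hp0.le).trans_eq ?_
    rw [← ENNReal.rpow_mul, one_div_mul_cancel hp0.ne', ENNReal.rpow_one]
  rw [eLpNorm_ofReal_eq hp0, eLpNorm_ofReal_eq hp0]
  refine (ENNReal.rpow_le_rpow ((lintegral_mono hJ).trans
    (lintegral_coneKernel_le hp hB hR0 hR hTm (fun t ht => (hT ht).1) hv)) (by positivity)).trans_eq ?_
  rw [ENNReal.mul_rpow_of_nonneg _ _ (by positivity), ENNReal.mul_rpow_of_nonneg _ _ (by positivity),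
    ENNReal.ofReal_rpow_of_nonneg (by positivity) (by positivity), ← Real.rpow_mul hR0,
    mul_one_div_cancel hp0.ne', Real.rpow_one]

lemma lintegral_rpow_Ioo {a s : ℝ} (ha : -1 < a) (hs : 0 ≤ s) (hs1 : s ≤ 1) :
    ∫⁻ t in Ioo s 1, ENNReal.ofReal (t ^ a) = ENNReal.ofReal ((1 - s ^ (a + 1)) / (a + 1)) := by
  have h1 : IntervalIntegrable (fun t : ℝ => t ^ a) volume s 1 :=
    intervalIntegral.intervalIntegrable_rpow' ha
  have h2 := integral_rpow (a := s) (b := 1) (r := a) (Or.inl ha)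
  rw [Real.one_rpow, intervalIntegral.integral_of_le hs1, integral_Ioc_eq_integral_Ioo] at h2
  rw [← h2, ofReal_integral_eq_lintegral_ofReal
    ((intervalIntegrable_iff_integrableOn_Ioo_of_le hs1).1 h1)]
  filter_upwards [ae_restrict_mem measurableSet_Ioo] with t ht
  exact Real.rpow_nonneg (hs.trans ht.1.le) _

lemma integrable_coneKernel {p : ℝ} (hp : 1 ≤ p) (hpn : -1 < p * m - n)
    {B : Set (EuclideanSpace ℝ (Fin n))}
    (hB : MeasurableSet B) (hBfin : volume B ≠ ∞)
    {μ : Measure (EuclideanSpace ℝ (Fin n))} [IsProbabilityMeasure μ]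
    {R : ℝ} (hR0 : 0 ≤ R) (hR : ∀ᵐ y ∂μ, ∀ x ∈ B, ‖x - y‖ ≤ R)
    {v : EuclideanSpace ℝ (Fin n) → Alt n (m + 1)} (hv : StronglyMeasurable v)
    (hvp : MemLp v (ENNReal.ofReal p)) :
    Integrable (Function.uncurry (coneKernel v))
      ((volume.restrict B).prod ((volume.restrict (Ioo 0 1)).prod μ)) := by
  have hp0 : 0 < p := by linarith
  have : IsFiniteMeasure (volume.restrict B) := ⟨by simpa using hBfin.lt_top⟩
  have hm : AEStronglyMeasurable (Function.uncurry (coneKernel v))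
      ((volume.restrict B).prod ((volume.restrict (Ioo 0 1)).prod μ)) :=
    (stronglyMeasurable_coneKernel hv).aestronglyMeasurable
  refine MemLp.integrable (q := ENNReal.ofReal p) (by simpa using hp) ⟨hm, ?_⟩
  rw [eLpNorm_ofReal_eq hp0]
  refine ENNReal.rpow_lt_top_of_nonneg (by positivity) ?_
  refine ne_of_eq_of_ne (lintegral_prod (fun z => ‖coneKernel v z.1 z.2‖ₑ ^ p)
    (measurable_enorm_coneKernel hv p).aemeasurable) ?_
  refine ne_top_of_le_ne_top ?_ (lintegral_coneKernel_le hp hB hR0 hR measurableSet_Ioo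
    (fun t ht => ht.1) hv)
  rw [lintegral_rpow_Ioo hpn le_rfl zero_le_one]
  refine ENNReal.mul_ne_top (ENNReal.mul_ne_top ENNReal.ofReal_ne_top ENNReal.ofReal_ne_top) ?_
  have h1 := hvp.eLpNorm_ne_top
  rw [eLpNorm_ofReal_eq hp0] at h1
  intro h2
  rw [h2, ENNReal.top_rpow_of_pos (by positivity)] at h1
  exact h1 rfl

end ConeOperator

/-! ### The averaged operator produces primitives -/

section ConeWeak

open Filter Topology

variable {n m : ℕ}

lemma integral_bilin_integral {X Q F G W : Type*} [MeasurableSpace X] [MeasurableSpace Q]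
    [NormedAddCommGroup F] [NormedSpace ℝ F] [NormedAddCommGroup G] [NormedSpace ℝ G]
    [CompleteSpace G] [NormedAddCommGroup W] [NormedSpace ℝ W] [CompleteSpace W]
    {ρ : Measure X} {ν : Measure Q} [SFinite ρ] [SFinite ν] (B : F →L[ℝ] G →L[ℝ] W) {ξ : X → F}
    {K : X → Q → G} (hξ : AEStronglyMeasurable ξ ρ) {c : ℝ} (hc : ∀ x, ‖ξ x‖ ≤ c)
    (hK : Integrable (Function.uncurry K) (ρ.prod ν)) :
    Integrable (fun z : X × Q => B (ξ z.1) (K z.1 z.2)) (ρ.prod ν) ∧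
      Integrable (fun x => B (ξ x) (∫ q, K x q ∂ν)) ρ ∧
      ∫ x, B (ξ x) (∫ q, K x q ∂ν) ∂ρ = ∫ q, ∫ x, B (ξ x) (K x q) ∂ρ ∂ν := by
  have h1 : Integrable (fun z : X × Q => B (ξ z.1) (K z.1 z.2)) (ρ.prod ν) := by
    refine (hK.norm.const_mul (‖B‖ * c)).mono' ?_ (Eventually.of_forall fun z => ?_)
    · exact B.isBoundedBilinearMap.continuous.comp_aestronglyMeasurable
        (hξ.comp_fst.prodMk hK.aestronglyMeasurable)
    · refine (B.le_opNorm₂ _ _).trans ?_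
      exact mul_le_mul_of_nonneg_right (mul_le_mul_of_nonneg_left (hc _) (norm_nonneg B))
        (norm_nonneg _)
  have h2 : Integrable (fun x => B (ξ x) (∫ q, K x q ∂ν)) ρ := by
    refine (hK.integral_prod_left.norm.const_mul (‖B‖ * c)).mono' ?_ (Eventually.of_forall fun x => ?_)
    · exact B.isBoundedBilinearMap.continuous.comp_aestronglyMeasurable
        (hξ.prodMk hK.integral_prod_left.aestronglyMeasurable)
    · refine (B.le_opNorm₂ _ _).trans ?_
      exact mul_le_mul_of_nonneg_right (mul_le_mul_of_nonneg_left (hc _) (norm_nonneg B))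
        (norm_nonneg _)
  refine ⟨h1, h2, ?_⟩
  rw [← integral_integral_swap (f := fun x q => B (ξ x) (K x q)) h1]
  refine integral_congr_ae ?_
  filter_upwards [hK.prod_right_ae] with x hx
  exact ((B (ξ x)).integral_comp_comm hx).symm

lemma integrable_of_restrict {X F : Type*} [MeasurableSpace X] [NormedAddCommGroup F]
    {μ : Measure X} {s : Set X} {f : X → F} (h : Integrable f (μ.restrict s))
    (h0 : ∀ x, x ∉ s → f x = 0) : Integrable f μ :=
  (integrableOn_iff_integrable_of_support_subset fun x hx => by
    by_contra hxs; exact hx (h0 x hxs)).1 h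

/-- Fubini moves the test integral inside the average. Almost every centre lies in the convex set
`B`, which is star-shaped about it, and there the time integral is `-∫ g v`; this value does not
depend on the centre and `μ` has mass one. -/
lemma AltWeakD.cone {p : ℝ} (hp : 1 ≤ p) (hpn : -1 < p * m - n)
    {B : Set (EuclideanSpace ℝ (Fin n))} (hB : MeasurableSet B) (hBc : Convex ℝ B)
    (hBfin : volume B ≠ ∞) {μ : Measure (EuclideanSpace ℝ (Fin n))} [IsProbabilityMeasure μ]
    {R : ℝ} (hR0 : 0 ≤ R) (hR : ∀ᵐ y ∂μ, ∀ x ∈ B, ‖x - y‖ ≤ R) (hμ : ∀ᵐ y ∂μ, y ∈ B)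
    {v : EuclideanSpace ℝ (Fin n) → Alt n (m + 1)} (hvm : StronglyMeasurable v)
    (hvi : Integrable v) (hvp : MemLp v (ENNReal.ofReal p)) (h0 : AltWeakD B v 0) :
    AltWeakD B (cone ((volume.restrict (Ioo 0 1)).prod μ) v) v := by
  intro g hg hc hs
  have hp0 : 0 < p := by linarith
  set ν : Measure (ℝ × EuclideanSpace ℝ (Fin n)) := (volume.restrict (Ioo (0 : ℝ) 1)).prod μ
  have hK := integrable_coneKernel hp hpn hB hBfin hR0 hR hvm hvp
  have hdc : Continuous (fderiv ℝ g) := hg.continuous_fderiv (by simp)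
  obtain ⟨G, hG⟩ := (hc.fderiv ℝ).exists_bound_of_continuous hdc
  obtain ⟨hI, hI3, hF⟩ := integral_bilin_integral wedgeB (hdc.aestronglyMeasurable) hG hK
  simp only [wedgeB_apply] at hI hI3 hF
  have hoff : ∀ x, x ∉ B → fderiv ℝ g x = 0 := fun x hx =>
    fderiv_of_notMem_tsupport (𝕜 := ℝ) fun h => hx (hs h)
  have hw0 : ∀ {l : ℕ} (a : Alt n l), wedgeL (0 : EuclideanSpace ℝ (Fin n) →L[ℝ] ℝ) a = 0 := by
    intro l a
    rw [← wedgeB_apply, map_zero]; rfl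
  have hset : ∀ q, ∫ x in B, wedgeL (fderiv ℝ g x) (coneKernel v x q) =
      ∫ x, wedgeL (fderiv ℝ g x) (coneKernel v x q) := fun q =>
    setIntegral_eq_integral_of_forall_compl_eq_zero fun x hx => by rw [hoff x hx, hw0]
  simp only [hset] at hF
  have hI2 : Integrable (fun q => ∫ x, wedgeL (fderiv ℝ g x) (coneKernel v x q)) ν := by
    have := hI.integral_prod_right
    simpa only [hset] using this
  have hinner : ∀ᵐ y ∂μ, ∫ t in Ioo (0 : ℝ) 1, ∫ x, wedgeL (fderiv ℝ g x) (coneKernel v x (t, y)) =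
      -∫ x, g x • v x := by
    filter_upwards [hI2.prod_left_ae, hμ] with y hy hyB
    refine integral_integral_coneKernel (hBc.starConvex hyB) hp ?_ hvi hvm hvp h0 hg hc hs hy
    -- `n < pm + 1 ≤ p(m + 1)`.
    rw [div_lt_iff₀ hp0]
    nlinarith
  have h1 : ∫ q, (∫ x, wedgeL (fderiv ℝ g x) (coneKernel v x q)) ∂ν = -∫ x, g x • v x := by
    rw [integral_prod_symm _ hI2, integral_congr_ae hinner, integral_const]
    simp
  have hi1 : Integrable fun x => wedgeL (fderiv ℝ g x) (_root_.cone ν v x) :=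
    integrable_of_restrict hI3 fun x hx => by rw [hoff x hx, hw0]
  have hi2 : Integrable fun x => g x • v x :=
    hvi.locallyIntegrable.integrable_smul_left_of_hasCompactSupport hg.continuous hc
  refine (integral_add hi1 hi2).trans ?_
  have h3 : ∫ x, wedgeL (fderiv ℝ g x) (_root_.cone ν v x) = -∫ x, g x • v x := by
    rw [← h1, ← hF]
    exact (setIntegral_eq_integral_of_forall_compl_eq_zero fun x hx => by rw [hoff x hx, hw0]).symm
  rw [h3, neg_add_cancel]

end ConeWeak

/-! ### Finite nets, and the kernel seen from the form -/

section ConeCompact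

open Filter Topology

variable {n m : ℕ}

/-- Arzelà–Ascoli in the form of nets: up to `ε` the maps are determined by their values on a finite
`δ`-net of `B`, and these values fill a bounded subset of a finite-dimensional space. The net
consists of members of the family itself. -/
lemma exists_finite_net_of_lipschitz {X F ι : Type*} [PseudoMetricSpace X] [NormedAddCommGroup F]
    [NormedSpace ℝ F] [FiniteDimensional ℝ F] {B : Set X} (hB : TotallyBounded B) (G : ι → X → F)
    {c Λ : ℝ} (hc : ∀ i, ∀ x ∈ B, ‖G i x‖ ≤ c)
    (hΛ : ∀ i, ∀ x ∈ B, ∀ x' ∈ B, ‖G i x - G i x'‖ ≤ Λ * dist x x') {ε : ℝ} (hε : 0 < ε) :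
    ∃ S : Set ι, S.Finite ∧ ∀ i, ∃ j ∈ S, ∀ x ∈ B, ‖G i x - G j x‖ ≤ ε := by
  -- The Lipschitz variation over distance `δ` is at most `ε/3`; adding `1` avoids a zero
  -- denominator.
  set δ : ℝ := ε / 3 / (|Λ| + 1)
  have hδ : 0 < δ := by positivity
  have hΛδ : |Λ| * δ ≤ ε / 3 := by
    have : δ * (|Λ| + 1) = ε / 3 := div_mul_cancel₀ _ (by positivity)
    nlinarith
  obtain ⟨t, htB, htf, hcov⟩ := Metric.finite_approx_of_totallyBounded hB δ hδ
  have : Fintype t := htf.fintype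
  have : ProperSpace F := FiniteDimensional.proper ℝ F
  set V : ι → t → F := fun i x => G i x
  have hbd : Bornology.IsBounded (range V) := by
    refine (isBounded_iff_forall_norm_le).2 ⟨|c|, ?_⟩
    rintro _ ⟨i, rfl⟩
    exact (pi_norm_le_iff_of_nonneg (abs_nonneg c)).2 fun x =>
      (hc i x (htB x.2)).trans (le_abs_self c)
  obtain ⟨T, hTr, hTf, hTc⟩ := Metric.finite_approx_of_totallyBounded
    (hbd.isCompact_closure.totallyBounded.subset subset_closure) (ε / 3) (by positivity)
  have hex : ∀ y ∈ T, ∃ i, V i = y := fun y hy => hTr hy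
  choose g hg using hex
  have := hTf.to_subtype
  refine ⟨range fun y : T => g y.1 y.2, finite_range _, fun i => ?_⟩
  obtain ⟨y, hyT, hy⟩ := mem_iUnion₂.1 (hTc (mem_range_self i))
  refine ⟨g y hyT, ⟨⟨y, hyT⟩, rfl⟩, fun x hx => ?_⟩
  obtain ⟨x', hx't, hx'⟩ := mem_iUnion₂.1 (hcov hx)
  have h1 : ‖G i x' - G (g y hyT) x'‖ ≤ ε / 3 := by
    have h2 : dist (V i) y < ε / 3 := hy
    rw [← hg y hyT, dist_eq_norm] at h2
    exact (norm_le_pi_norm (V i - V (g y hyT)) ⟨x', hx't⟩).trans h2.le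
  have hd : |Λ| * dist x x' ≤ ε / 3 :=
    (mul_le_mul_of_nonneg_left (le_of_lt hx') (abs_nonneg _)).trans hΛδ
  have h3 : ∀ k, ‖G k x - G k x'‖ ≤ ε / 3 := fun k =>
    (hΛ k x hx x' (htB hx't)).trans ((mul_le_mul_of_nonneg_right (le_abs_self _) dist_nonneg).trans hd)
  have e : G i x - G (g y hyT) x =
      (G i x - G i x') + (G i x' - G (g y hyT) x') - (G (g y hyT) x - G (g y hyT) x') := by abel
  rw [e]
  refine (norm_sub_le _ _).trans ?_
  have := norm_add_le (G i x - G i x') (G i x' - G (g y hyT) x')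
  linarith [h3 i, h3 (g y hyT)]

/-- The direction of the kernel of the averaged homotopy operator in the variable of the form. -/
def farDir (φ : EuclideanSpace ℝ (Fin n) → ℝ) (a : ℝ) (x z : EuclideanSpace ℝ (Fin n)) :
    EuclideanSpace ℝ (Fin n) := (φ (x + a • (z - x)) * a) • (x - z)

lemma norm_farDir_le {φ : EuclideanSpace ℝ (Fin n) → ℝ} {P a₀ d : ℝ} (hP : ∀ x, ‖φ x‖ ≤ P)
    {a : ℝ} (ha0 : 0 ≤ a) (ha : a ≤ a₀) {x z : EuclideanSpace ℝ (Fin n)} (hd : ‖x - z‖ ≤ d) :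
    ‖farDir φ a x z‖ ≤ P * a₀ * d := by
  have hP0 := (norm_nonneg _).trans (hP x)
  rw [farDir, norm_smul, norm_mul, Real.norm_of_nonneg ha0]
  exact mul_le_mul (mul_le_mul (hP _) ha ha0 hP0) hd (norm_nonneg _)
    (mul_nonneg hP0 (ha0.trans ha))

lemma norm_farDir_sub_le {φ : EuclideanSpace ℝ (Fin n) → ℝ} {P a₀ d : ℝ} {K : ℝ≥0}
    (hP : ∀ x, ‖φ x‖ ≤ P) (hK : LipschitzWith K φ) {a : ℝ} (ha1 : 1 ≤ a) (ha : a ≤ a₀)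
    {x x' z : EuclideanSpace ℝ (Fin n)} (hd : ‖x - z‖ ≤ d) :
    ‖farDir φ a x z - farDir φ a x' z‖ ≤ (K * a₀ * a₀ * d + P * a₀) * ‖x - x'‖ := by
  have hP0 := (norm_nonneg _).trans (hP x)
  have hd0 := (norm_nonneg _).trans hd
  have ha0 : 0 ≤ a := by linarith
  have e : farDir φ a x z - farDir φ a x' z =
      ((φ (x + a • (z - x)) - φ (x' + a • (z - x'))) * a) • (x - z) +
        (φ (x' + a • (z - x')) * a) • (x - x') := by
    simp only [farDir]; module
  have h1 : ‖φ (x + a • (z - x)) - φ (x' + a • (z - x'))‖ ≤ K * (a₀ * ‖x - x'‖) := by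
    refine (hK.norm_sub_le _ _).trans (mul_le_mul_of_nonneg_left ?_ K.2)
    have e2 : x + a • (z - x) - (x' + a • (z - x')) = (1 - a) • (x - x') := by module
    rw [e2, norm_smul]
    refine mul_le_mul_of_nonneg_right ?_ (norm_nonneg _)
    rw [Real.norm_eq_abs, abs_le]
    constructor <;> linarith
  rw [e, add_mul]
  refine (norm_add_le _ _).trans (add_le_add ?_ ?_)
  · rw [norm_smul, norm_mul, Real.norm_of_nonneg ha0]
    calc _ ≤ (K * (a₀ * ‖x - x'‖)) * a₀ * d := by
          refine mul_le_mul (mul_le_mul h1 ha ha0 ?_) hd (norm_nonneg _) ?_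
          · have := ha0.trans ha
            positivity
          · have := ha0.trans ha
            positivity
      _ = _ := by ring
  · rw [norm_smul, norm_mul, Real.norm_of_nonneg ha0]
    exact mul_le_mul_of_nonneg_right (mul_le_mul (hP _) ha ha0 hP0) (norm_nonneg _)

/-- The average over the centres of the homotopy operator at a fixed time. -/
def farAvg (φ : EuclideanSpace ℝ (Fin n) → ℝ) (v : EuclideanSpace ℝ (Fin n) → Alt n (m + 1))
    (x : EuclideanSpace ℝ (Fin n)) (t : ℝ) : Alt n m :=
  (t ^ m * ((1 - t) ^ n)⁻¹) • ∫ z, contr (farDir φ (1 - t)⁻¹ x z) (v z)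

/-- Substituting `z = y + t(x - y)` for the centre frees the argument of `v` from `x`. The centre `y
= x + (z - x)/(1 - t)` now appears only in the density and in `x - y = (x - z)/(1 - t)`, at the
price of `(1 - t)^{-n}`, which is harmless away from `t = 1`. -/
lemma integral_coneKernel_eq_farAvg {φ : EuclideanSpace ℝ (Fin n) → ℝ} (hφ : Continuous φ)
    (hφ0 : ∀ x, 0 ≤ φ x) (v : EuclideanSpace ℝ (Fin n) → Alt n (m + 1))
    (x : EuclideanSpace ℝ (Fin n)) {t : ℝ} (ht : t < 1) :
    ∫ y, coneKernel v x (t, y) ∂(volume.withDensity fun y => ENNReal.ofReal (φ y)) =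
      farAvg φ v x t := by
  have ht' : 0 < 1 - t := by linarith
  rw [integral_withDensity_eq_integral_toReal_smul (by fun_prop) (by simp), farAvg, mul_smul,
    ← integral_homothety x ht', ← integral_smul]
  refine integral_congr_ae (Eventually.of_forall fun y => ?_)
  have e1 : x + (1 - t)⁻¹ • (x + (1 - t) • (y - x) - x) = y := dilate_homothety y x ht'
  have e2 : x + (1 - t) • (y - x) = y + t • (x - y) := by module
  have e3 : x - (y + t • (x - y)) = (1 - t) • (x - y) := by module
  simp only [farDir, e1]
  rw [e2, e3, ENNReal.toReal_ofReal (hφ0 y), coneKernel, smul_smul (φ y * _), mul_assoc,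
    inv_mul_cancel₀ ht'.ne', mul_one, map_smul, smul_comm]
  rfl

end ConeCompact

/-! ### Equi-Lipschitz bounds away from time one -/

section ConeFar

open Filter Topology

variable {n m : ℕ}

lemma integral_bilin_bounds {X F G W : Type*} [MeasurableSpace X]
    [NormedAddCommGroup F] [NormedSpace ℝ F] [NormedAddCommGroup G] [NormedSpace ℝ G]
    [NormedAddCommGroup W] [NormedSpace ℝ W] {μ : Measure X} (B : F →L[ℝ] G →L[ℝ] W)
    (hB : ∀ a b, ‖B a b‖ ≤ ‖a‖ * ‖b‖) {w : X → G} (hw : Integrable w μ) {ξ ξ' : X → F}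
    (hξ : AEStronglyMeasurable ξ μ) (hξ' : AEStronglyMeasurable ξ' μ) {c e : ℝ}
    (hc : ∀ x, w x ≠ 0 → ‖ξ x‖ ≤ c) (hc' : ∀ x, w x ≠ 0 → ‖ξ' x‖ ≤ c)
    (he : ∀ x, w x ≠ 0 → ‖ξ x - ξ' x‖ ≤ e) :
    ‖∫ x, B (ξ x) (w x) ∂μ‖ ≤ c * ∫ x, ‖w x‖ ∂μ ∧
      ‖∫ x, B (ξ x) (w x) ∂μ - ∫ x, B (ξ' x) (w x) ∂μ‖ ≤ e * ∫ x, ‖w x‖ ∂μ := by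
  have hbd : ∀ (ζ : X → F) (b : ℝ), (∀ x, w x ≠ 0 → ‖ζ x‖ ≤ b) → ∀ x, ‖B (ζ x) (w x)‖ ≤ b * ‖w x‖ := by
    intro ζ b hb x
    by_cases hx : w x = 0
    · simp [hx]
    · exact (hB _ _).trans (mul_le_mul_of_nonneg_right (hb x hx) (norm_nonneg _))
  have hint : ∀ ζ : X → F, AEStronglyMeasurable ζ μ → (∀ x, w x ≠ 0 → ‖ζ x‖ ≤ c) →
      Integrable (fun x => B (ζ x) (w x)) μ := fun ζ hζ h =>
    (hw.norm.const_mul c).mono' (B.isBoundedBilinearMap.continuous.comp_aestronglyMeasurable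
      (hζ.prodMk hw.aestronglyMeasurable)) (Eventually.of_forall (hbd ζ c h))
  constructor
  · rw [← integral_const_mul]
    exact norm_integral_le_of_norm_le (hw.norm.const_mul c) (Eventually.of_forall (hbd ξ c hc))
  · rw [← integral_sub (hint ξ hξ hc) (hint ξ' hξ' hc'), ← integral_const_mul]
    refine norm_integral_le_of_norm_le (hw.norm.const_mul e) (Eventually.of_forall fun x => ?_)
    have := hbd (fun x => ξ x - ξ' x) e he x
    simpa only [map_sub, _root_.sub_apply] using this

lemma norm_smul_sub_smul {F : Type*} [NormedAddCommGroup F] [NormedSpace ℝ F] (c : ℝ) (a b : F) :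
    ‖c • a - c • b‖ = ‖c‖ * ‖a - b‖ := by
  rw [← smul_sub, norm_smul]

lemma stronglyMeasurable_smul_integral {X Y F G W : Type*} [MeasurableSpace X] [MeasurableSpace Y]
    [NormedAddCommGroup F] [NormedSpace ℝ F] [NormedAddCommGroup G] [NormedSpace ℝ G]
    [NormedAddCommGroup W] [NormedSpace ℝ W] {ν : Measure Y} [SFinite ν] {a : X → ℝ}
    (ha : StronglyMeasurable a) (B : F →L[ℝ] G →L[ℝ] W) {ξ : X × Y → F}
    (hξ : StronglyMeasurable ξ) {w : X × Y → G} (hw : StronglyMeasurable w) :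
    StronglyMeasurable fun x => a x • ∫ y, B (ξ (x, y)) (w (x, y)) ∂ν :=
  ha.smul (B.isBoundedBilinearMap.continuous.comp_stronglyMeasurable
    (hξ.prodMk hw)).integral_prod_right'

/-- All dependence on `x` sits in `farDir`, so the bounds use only the `L^1` norm of `v`. Since `v`
vanishes off the ball, only `z` within `2r` of `x` matter, and `(1 - t)⁻¹ ≤ (1 - s)⁻¹` makes the
constants uniform in `t`. -/
lemma farAvg_bounds {c : EuclideanSpace ℝ (Fin n)} {r : ℝ}
    {φ : EuclideanSpace ℝ (Fin n) → ℝ} {P : ℝ} {K : ℝ≥0} (hP : ∀ x, ‖φ x‖ ≤ P)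
    (hK : LipschitzWith K φ) {s : ℝ} (hs : s < 1)
    {v : EuclideanSpace ℝ (Fin n) → Alt n (m + 1)} (hv : Integrable v)
    (hv0 : ∀ z, z ∉ Metric.ball c r → v z = 0) {x x' : EuclideanSpace ℝ (Fin n)}
    (hx : x ∈ Metric.ball c r) (hx' : x' ∈ Metric.ball c r) {t : ℝ} (ht0 : 0 < t) (hts : t ≤ s) :
    ‖farAvg φ v x t‖ ≤ ((1 - s)⁻¹ ^ n * (P * (1 - s)⁻¹ * (2 * r))) * ∫ z, ‖v z‖ ∧
      ‖farAvg φ v x t - farAvg φ v x' t‖ ≤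
        ((1 - s)⁻¹ ^ n * (K * (1 - s)⁻¹ * (1 - s)⁻¹ * (2 * r) + P * (1 - s)⁻¹)) * ‖x - x'‖ *
          ∫ z, ‖v z‖ := by
  have hs' : 0 < 1 - s := by linarith
  have ht' : 0 < 1 - t := by linarith
  have ha1 : 1 ≤ (1 - t)⁻¹ := (one_le_inv₀ ht').2 (by linarith)
  have ha : (1 - t)⁻¹ ≤ (1 - s)⁻¹ := inv_anti₀ hs' (by linarith)
  have hd : ∀ y ∈ Metric.ball c r, ∀ z, v z ≠ 0 → ‖y - z‖ ≤ 2 * r := by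
    intro y hy z hz
    have hzB : z ∈ Metric.ball c r := by
      by_contra h; exact hz (hv0 z h)
    rw [← dist_eq_norm]
    have := dist_triangle_right y z c
    have h1 := Metric.mem_ball.1 hy
    have h2 := Metric.mem_ball.1 hzB
    linarith
  have hm : ∀ y : EuclideanSpace ℝ (Fin n), Continuous fun z => farDir φ (1 - t)⁻¹ y z := by
    intro y
    have := hK.continuous
    unfold farDir
    fun_prop
  obtain ⟨h1, h2⟩ := integral_bilin_bounds (contr (n := n) (k := m)) norm_contr_le hv
    (ξ := fun z => farDir φ (1 - t)⁻¹ x z) (ξ' := fun z => farDir φ (1 - t)⁻¹ x' z)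
    (hm x).aestronglyMeasurable (hm x').aestronglyMeasurable
    (fun z hz => norm_farDir_le hP (by linarith) ha (hd x hx z hz))
    (fun z hz => norm_farDir_le hP (by linarith) ha (hd x' hx' z hz))
    (fun z hz => norm_farDir_sub_le hP hK ha1 ha (hd x hx z hz))
  have hcoef : ‖t ^ m * ((1 - t) ^ n)⁻¹‖ ≤ (1 - s)⁻¹ ^ n := by
    rw [Real.norm_of_nonneg (by positivity), ← inv_pow]
    calc _ ≤ 1 * (1 - s)⁻¹ ^ n := by
          refine mul_le_mul (pow_le_one₀ ht0.le (by linarith))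
            (pow_le_pow_left₀ (by positivity) ha n) (by positivity) zero_le_one
      _ = _ := one_mul _
  constructor
  · rw [farAvg, norm_smul, mul_assoc]
    exact mul_le_mul hcoef h1 (norm_nonneg _) (by positivity)
  · rw [mul_assoc, mul_assoc]
    refine (norm_smul_sub_smul _ _ _).le.trans ?_
    refine mul_le_mul hcoef (h2.trans_eq (by ring)) (norm_nonneg _) (by positivity)

lemma stronglyMeasurable_farAvg {φ : EuclideanSpace ℝ (Fin n) → ℝ} (hφ : Continuous φ)
    {v : EuclideanSpace ℝ (Fin n) → Alt n (m + 1)} (hv : StronglyMeasurable v)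
    (x : EuclideanSpace ℝ (Fin n)) : StronglyMeasurable (farAvg φ v x) := by
  have h1 : StronglyMeasurable fun q : ℝ × EuclideanSpace ℝ (Fin n) =>
      farDir φ (1 - q.1)⁻¹ x q.2 := by
    refine Measurable.stronglyMeasurable ?_
    unfold farDir
    have := hφ.measurable
    fun_prop
  have h2 : StronglyMeasurable fun q : ℝ × EuclideanSpace ℝ (Fin n) => v q.2 :=
    hv.comp_measurable measurable_snd
  have h4 : StronglyMeasurable fun t : ℝ => t ^ m * ((1 - t) ^ n)⁻¹ :=
    Measurable.stronglyMeasurable (by fun_prop)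
  have h5 := stronglyMeasurable_smul_integral
    (ν := (volume : Measure (EuclideanSpace ℝ (Fin n)))) h4 (contr (n := n) (k := m)) h1 h2
  have h6 : (fun t : ℝ => (t ^ m * ((1 - t) ^ n)⁻¹) •
      ∫ z, contr (farDir φ (1 - t)⁻¹ x z) (v z)) = farAvg φ v x := rfl
  rw [← h6]
  exact h5

/-- The part of the averaged homotopy operator away from the time `1`. -/
def farPart (φ : EuclideanSpace ℝ (Fin n) → ℝ) (s : ℝ)
    (v : EuclideanSpace ℝ (Fin n) → Alt n (m + 1)) (x : EuclideanSpace ℝ (Fin n)) : Alt n m :=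
  ∫ t in Ioc 0 s, farAvg φ v x t

lemma norm_setIntegral_Ioc_bounds {F : Type*} [NormedAddCommGroup F] [NormedSpace ℝ F]
    {f f' : ℝ → F} (hf : StronglyMeasurable f) (hf' : StronglyMeasurable f') {s b e : ℝ}
    (hs0 : 0 ≤ s) (hs1 : s ≤ 1) (hb0 : 0 ≤ b) (he0 : 0 ≤ e) (hb : ∀ t ∈ Ioc 0 s, ‖f t‖ ≤ b)
    (hb' : ∀ t ∈ Ioc 0 s, ‖f' t‖ ≤ b) (he : ∀ t ∈ Ioc 0 s, ‖f t - f' t‖ ≤ e) :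
    ‖∫ t in Ioc 0 s, f t‖ ≤ b ∧ ‖(∫ t in Ioc 0 s, f t) - ∫ t in Ioc 0 s, f' t‖ ≤ e := by
  have hvol : volume.real (Ioc (0 : ℝ) s) ≤ 1 := by simp [hs0, hs1]
  have hlt : volume (Ioc (0 : ℝ) s) < ∞ := by simp
  have hi : ∀ g : ℝ → F, StronglyMeasurable g → (∀ t ∈ Ioc 0 s, ‖g t‖ ≤ b) →
      IntegrableOn g (Ioc 0 s) := fun g hg h =>
    IntegrableOn.of_bound hlt hg.aestronglyMeasurable b
      ((ae_restrict_mem measurableSet_Ioc).mono h)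
  constructor
  · exact (norm_setIntegral_le_of_norm_le_const hlt hb).trans
      (mul_le_of_le_one_right hb0 hvol)
  · rw [← integral_sub (hi f hf hb) (hi f' hf' hb')]
    exact (norm_setIntegral_le_of_norm_le_const hlt he).trans
      (mul_le_of_le_one_right he0 hvol)

end ConeFar

/-! ### Precompactness of the images under the averaged operator -/

section ConeNet

open Filter Topology

variable {n m : ℕ}

/-- A single centre has no regularizing effect; a Lipschitz density of centres makes the part away
from time `1` Lipschitz in `x`. -/
lemma exists_bump_density (c : EuclideanSpace ℝ (Fin n)) {r : ℝ} (hr : 0 < r) :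
    ∃ φ : EuclideanSpace ℝ (Fin n) → ℝ, (∀ x, 0 ≤ φ x) ∧ (∃ P, ∀ x, ‖φ x‖ ≤ P) ∧
      (∃ K, LipschitzWith K φ) ∧
      IsProbabilityMeasure (volume.withDensity fun y => ENNReal.ofReal (φ y)) ∧
      ∀ᵐ y ∂(volume.withDensity fun y => ENNReal.ofReal (φ y)), y ∈ Metric.ball c r := by
  set b : ContDiffBump c := ⟨r / 2, r, by positivity, by linarith⟩
  have hsm : ContDiff ℝ 1 (b.normed volume) := b.contDiff_normed
  refine ⟨b.normed volume, b.nonneg_normed,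
    b.hasCompactSupport_normed.exists_bound_of_continuous hsm.continuous,
    hsm.lipschitzWith_of_hasCompactSupport b.hasCompactSupport_normed one_ne_zero, ⟨?_⟩, ?_⟩
  · rw [withDensity_apply _ MeasurableSet.univ, Measure.restrict_univ,
      ← ofReal_integral_eq_lintegral_ofReal b.integrable_normed
        (Eventually.of_forall b.nonneg_normed), b.integral_normed, ENNReal.ofReal_one]
  · rw [ae_withDensity_iff (by have := hsm.continuous.measurable; fun_prop)]
    refine Eventually.of_forall fun y hy => ?_
    have : y ∈ Function.support (b.normed volume) := fun h => hy (by rw [h, ENNReal.ofReal_zero])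
    rwa [b.support_normed_eq] at this

lemma integral_prod_Ioo_split {Y F : Type*} [MeasurableSpace Y] [NormedAddCommGroup F]
    [NormedSpace ℝ F] {μ : Measure Y} [SFinite μ] {f : ℝ × Y → F} {s : ℝ} (hs0 : 0 < s)
    (hs1 : s < 1) (hf : Integrable f ((volume.restrict (Ioo 0 1)).prod μ)) {h : ℝ → F}
    (hh : ∀ t ∈ Ioc 0 s, ∫ y, f (t, y) ∂μ = h t) :
    ∫ q, f q ∂((volume.restrict (Ioo 0 1)).prod μ) =
      ∫ q, f q ∂((volume.restrict (Ioo s 1)).prod μ) + ∫ t in Ioc 0 s, h t := by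
  have hi := hf.integral_prod_left
  have hf' : Integrable f ((volume.restrict (Ioo s 1)).prod μ) :=
    hf.mono_measure (Measure.prod_mono (Measure.restrict_mono (Ioo_subset_Ioo_left hs0.le) le_rfl)
      le_rfl)
  rw [integral_prod _ hf, integral_prod _ hf', ← setIntegral_congr_fun measurableSet_Ioc hh,
    ← Ioc_union_Ioo_eq_Ioo hs0.le hs1, setIntegral_union _ measurableSet_Ioo, add_comm]
  · exact IntegrableOn.mono_set hi (Ioc_subset_Ioo_right hs1)
  · exact IntegrableOn.mono_set hi (Ioo_subset_Ioo_left hs0.le)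
  · exact Set.disjoint_left.2 fun t ht ht' => (ht.2.trans_lt ht'.1).false

lemma eLpNorm_sub_le_of_split {X F : Type*} [MeasurableSpace X] [NormedAddCommGroup F]
    {μ : Measure X} {p : ℝ≥0∞} (hp : 1 ≤ p) {f f' a a' g g' : X → F}
    (hf : AEStronglyMeasurable f μ) (hf' : AEStronglyMeasurable f' μ)
    (ha : AEStronglyMeasurable a μ) (ha' : AEStronglyMeasurable a' μ)
    (h : ∀ᵐ x ∂μ, f x = a x + g x) (h' : ∀ᵐ x ∂μ, f' x = a' x + g' x) :
    eLpNorm (fun x => f x - f' x) p μ ≤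
      eLpNorm a p μ + eLpNorm a' p μ + eLpNorm (fun x => g x - g' x) p μ := by
  have hg : AEStronglyMeasurable (fun x => g x - g' x) μ := by
    refine ((hf.sub ha).sub (hf'.sub ha')).congr ?_
    filter_upwards [h, h'] with x hx hx'
    simp only [Pi.sub_apply, hx, hx', add_sub_cancel_left]
  have e : (fun x => f x - f' x) =ᵐ[μ] (a - a') + fun x => g x - g' x := by
    filter_upwards [h, h'] with x hx hx'
    simp only [Pi.add_apply, Pi.sub_apply, hx, hx']
    abel
  rw [eLpNorm_congr_ae e]
  exact (eLpNorm_add_le (ha.sub ha') hg hp).trans (add_le_add_left (eLpNorm_sub_le ha ha' hp) _)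

lemma stronglyMeasurable_cone (ν : Measure (ℝ × EuclideanSpace ℝ (Fin n))) [SFinite ν]
    {v : EuclideanSpace ℝ (Fin n) → Alt n (m + 1)} (hv : StronglyMeasurable v) :
    StronglyMeasurable (cone ν v) :=
  (stronglyMeasurable_coneKernel hv).integral_prod_right

lemma integral_norm_le_of_eLpNorm_le {X F : Type*} [MeasurableSpace X] [NormedAddCommGroup F]
    {μ : Measure X} {p : ℝ} (hp : 1 ≤ p) {B : Set X} (hB : MeasurableSet B) (hBfin : μ B ≠ ∞)
    {v : X → F} (hv : AEStronglyMeasurable v μ) (hv0 : ∀ z, z ∉ B → v z = 0) {M : ℝ≥0∞}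
    (hM : M ≠ ∞) (hvM : eLpNorm v (ENNReal.ofReal p) μ ≤ M) :
    ∫ z, ‖v z‖ ∂μ ≤ (M * μ B ^ (1 - 1 / p)).toReal := by
  have hp0 : 0 < p := by linarith
  rw [integral_norm_eq_lintegral_enorm hv]
  have hfin : μ B ^ (1 - 1 / p) ≠ ∞ :=
    ENNReal.rpow_ne_top_of_nonneg (by rw [sub_nonneg, div_le_one hp0]; exact hp) hBfin
  refine ENNReal.toReal_mono (ENNReal.mul_ne_top hM hfin) ?_
  have e : ∫⁻ z, ‖v z‖ₑ ∂μ = ∫⁻ z in B, ‖v z‖ₑ ∂μ := by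
    rw [← lintegral_indicator hB]
    refine lintegral_congr fun z => ?_
    by_cases hz : z ∈ B
    · rw [indicator_of_mem hz]
    · rw [indicator_of_notMem hz, hv0 z hz, enorm_zero]
  rw [e]
  refine (lintegral_enorm_le_of_one_le (μ := μ.restrict B) hp hv.restrict).trans ?_
  rw [← eLpNorm_ofReal_eq hp0, Measure.restrict_apply_univ]
  exact mul_le_mul_left ((eLpNorm_mono_measure v Measure.restrict_le_self).trans hvM) _

/-- Chooses where to split the times: the slab `(s,1)` has arbitrarily small weight as `s` tends to
`1`. -/
lemma exists_time_small {p a : ℝ} (hp : 0 < p) (A : ℝ≥0∞) (hA : A ≠ ∞) {ε : ℝ≥0∞}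
    (hε : ε ≠ 0) :
    ∃ s : ℝ, 0 < s ∧ s < 1 ∧ ENNReal.ofReal ((1 - s ^ (a + 1)) / (a + 1)) ^ (1 / p) * A ≤ ε := by
  have h1 : Tendsto (fun s : ℝ => (1 - s ^ (a + 1)) / (a + 1)) (𝓝 1) (𝓝 0) := by
    have := (Real.continuousAt_rpow_const 1 (a + 1) (Or.inl one_ne_zero)).tendsto
    rw [Real.one_rpow] at this
    simpa using (this.const_sub 1).div_const (a + 1)
  have h2 : Tendsto (fun s : ℝ => ENNReal.ofReal ((1 - s ^ (a + 1)) / (a + 1)) ^ (1 / p) * A)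
      (𝓝 1) (𝓝 0) := by
    have h3 := (ENNReal.continuous_rpow_const (y := 1 / p)).tendsto 0 |>.comp
      (by simpa using ENNReal.tendsto_ofReal h1)
    rw [ENNReal.zero_rpow_of_pos (by positivity)] at h3
    simpa using ENNReal.Tendsto.mul_const h3 (Or.inr hA)
  have h4 : ∀ᶠ s in 𝓝[<] (1 : ℝ), 0 < s ∧ s < 1 ∧
      ENNReal.ofReal ((1 - s ^ (a + 1)) / (a + 1)) ^ (1 / p) * A ≤ ε := by
    filter_upwards [nhdsWithin_le_nhds (h2.eventually (Iic_mem_nhds (pos_iff_ne_zero.2 hε))),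
      nhdsWithin_le_nhds (Ioi_mem_nhds (zero_lt_one)), self_mem_nhdsWithin] with s hs hs0 hs1
    exact ⟨hs0, hs1, hs⟩
  exact h4.exists

/-- The times are split at `s`. The part over `(s,1)` has norm at most `ε/3` for every member of the
family, and the far parts have a finite net in the supremum norm. The three thirds are two near
parts and one difference of far parts. -/
lemma exists_finite_net_cone {p : ℝ} (hp : 1 ≤ p) (hpn : -1 < p * m - n)
    {c : EuclideanSpace ℝ (Fin n)} {r : ℝ} (hr : 0 < r) {φ : EuclideanSpace ℝ (Fin n) → ℝ}
    (hφ0 : ∀ x, 0 ≤ φ x) (hφP : ∃ P, ∀ x, ‖φ x‖ ≤ P) (hφK : ∃ K, LipschitzWith K φ)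
    [IsProbabilityMeasure (volume.withDensity fun y => ENNReal.ofReal (φ y))]
    (hφB : ∀ᵐ y ∂(volume.withDensity fun y => ENNReal.ofReal (φ y)), y ∈ Metric.ball c r)
    {ι : Type*} {v : ι → EuclideanSpace ℝ (Fin n) → Alt n (m + 1)}
    (hvm : ∀ i, StronglyMeasurable (v i)) (hvi : ∀ i, Integrable (v i))
    (hv0 : ∀ i z, z ∉ Metric.ball c r → v i z = 0) {M : ℝ≥0∞} (hM : M ≠ ∞)
    (hvM : ∀ i, eLpNorm (v i) (ENNReal.ofReal p) volume ≤ M) {ε : ℝ≥0∞} (hε : ε ≠ 0) :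
    ∃ S : Set ι, S.Finite ∧ ∀ i, ∃ j ∈ S,
      eLpNorm (fun x => cone ((volume.restrict (Ioo 0 1)).prod
          (volume.withDensity fun y => ENNReal.ofReal (φ y))) (v i) x -
        cone ((volume.restrict (Ioo 0 1)).prod
          (volume.withDensity fun y => ENNReal.ofReal (φ y))) (v j) x)
        (ENNReal.ofReal p) (volume.restrict (Metric.ball c r)) ≤ ε := by
  obtain ⟨P, hP⟩ := hφP
  obtain ⟨K, hK⟩ := hφK
  have hP0 : 0 ≤ P := (norm_nonneg _).trans (hP 0)
  have hp0 : 0 < p := by linarith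
  set μ : Measure (EuclideanSpace ℝ (Fin n)) := volume.withDensity fun y => ENNReal.ofReal (φ y)
  set B := Metric.ball c r
  have hBm : MeasurableSet B := measurableSet_ball
  have hBfin : volume B ≠ ∞ := measure_ball_lt_top.ne
  have hR : ∀ᵐ y ∂μ, ∀ x ∈ B, ‖x - y‖ ≤ 2 * r := by
    filter_upwards [hφB] with y hy x hx
    rw [← dist_eq_norm]
    have := dist_triangle_right x y c
    have h1 := Metric.mem_ball.1 hx
    have h2 := Metric.mem_ball.1 hy
    linarith
  have hε3 : ε / 3 ≠ 0 := by simp [hε]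
  obtain ⟨s, hs0, hs1, hs⟩ := exists_time_small (a := p * m - n) hp0 (ENNReal.ofReal (2 * r) * M)
    (ENNReal.mul_ne_top ENNReal.ofReal_ne_top hM) hε3
  have hnear : ∀ i, eLpNorm (cone ((volume.restrict (Ioo s 1)).prod μ) (v i)) (ENNReal.ofReal p)
      (volume.restrict B) ≤ ε / 3 := by
    intro i
    refine (eLpNorm_cone_le hp hBm (by positivity) hR measurableSet_Ioo
      (Ioo_subset_Ioo_left hs0.le) (hvm i)).trans (le_trans ?_ hs)
    rw [lintegral_rpow_Ioo hpn hs0.le hs1.le, mul_comm (ENNReal.ofReal (2 * r)), mul_assoc]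
    exact mul_le_mul_right (mul_le_mul_right (hvM i) _) _
  have hvp : ∀ i, MemLp (v i) (ENNReal.ofReal p) := fun i =>
    ⟨(hvm i).aestronglyMeasurable, (hvM i).trans_lt hM.lt_top⟩
  have hsplit : ∀ i, ∀ᵐ x ∂(volume.restrict B), cone ((volume.restrict (Ioo 0 1)).prod μ) (v i) x =
      cone ((volume.restrict (Ioo s 1)).prod μ) (v i) x + farPart φ s (v i) x := by
    intro i
    filter_upwards [(integrable_coneKernel hp hpn hBm hBfin (by positivity) hR (hvm i)
      (hvp i)).prod_right_ae] with x hx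
    exact integral_prod_Ioo_split hs0 hs1 hx fun t ht =>
      integral_coneKernel_eq_farAvg hK.continuous hφ0 (v i) x (ht.2.trans_lt hs1)
  set N : ℝ := (M * volume B ^ (1 - 1 / p)).toReal
  have hN : ∀ i, ∫ z, ‖v i z‖ ≤ N := fun i =>
    integral_norm_le_of_eLpNorm_le hp hBm hBfin (hvm i).aestronglyMeasurable (hv0 i) hM (hvM i)
  have hs' : 0 < 1 - s := by linarith
  set c₁ : ℝ := (1 - s)⁻¹ ^ n * (P * (1 - s)⁻¹ * (2 * r))
  set c₂ : ℝ := (1 - s)⁻¹ ^ n * (K * (1 - s)⁻¹ * (1 - s)⁻¹ * (2 * r) + P * (1 - s)⁻¹)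
  have hc₁ : 0 ≤ c₁ := by positivity
  have hc₂ : 0 ≤ c₂ := by positivity
  have hfar : ∀ i, ∀ x ∈ B, ∀ x' ∈ B, ‖farPart φ s (v i) x‖ ≤ c₁ * N ∧
      ‖farPart φ s (v i) x - farPart φ s (v i) x'‖ ≤ c₂ * N * dist x x' := by
    intro i x hx x' hx'
    have hN0 : 0 ≤ N := ENNReal.toReal_nonneg
    have hb := fun {x x'} hx hx' t (ht : t ∈ Ioc 0 s) =>
      farAvg_bounds (c := c) (r := r) (x := x) (x' := x') hP hK hs1 (hvi i) (hv0 i) hx hx' ht.1 ht.2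
    refine norm_setIntegral_Ioc_bounds (stronglyMeasurable_farAvg hK.continuous (hvm i) x)
      (stronglyMeasurable_farAvg hK.continuous (hvm i) x') hs0.le hs1.le (by positivity)
      (by positivity) (fun t ht => ((hb hx hx' t ht).1).trans (mul_le_mul_of_nonneg_left (hN i) hc₁))
      (fun t ht => ((hb hx' hx t ht).1).trans (mul_le_mul_of_nonneg_left (hN i) hc₁))
      (fun t ht => ((hb hx hx' t ht).2).trans ?_)
    rw [mul_right_comm, dist_eq_norm]
    exact mul_le_mul_of_nonneg_right (mul_le_mul_of_nonneg_left (hN i) hc₂) (norm_nonneg _)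
  -- A supremum bound `ε'` on the ball becomes an `L^p` bound after multiplication by the `1/p`-th
  -- power of its volume.
  obtain ⟨ε', hε'0, hε'⟩ := ENNReal.exists_nnreal_pos_mul_lt
    (a := volume B ^ (ENNReal.ofReal p).toReal⁻¹)
    (ENNReal.rpow_ne_top_of_nonneg (by positivity) hBfin) hε3
  have hBt : TotallyBounded B :=
    (Metric.isBounded_ball.isCompact_closure).totallyBounded.subset subset_closure
  obtain ⟨S, hS, hSi⟩ := exists_finite_net_of_lipschitz hBt (fun i => farPart φ s (v i))
      (fun i x hx => (hfar i x hx x hx).1) (fun i x hx x' hx' => (hfar i x hx x' hx').2)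
      (NNReal.coe_pos.2 hε'0)
  refine ⟨S, hS, fun i => ?_⟩
  obtain ⟨j, hj, hij⟩ := hSi i
  refine ⟨j, hj, ?_⟩
  refine (eLpNorm_sub_le_of_split (by simpa using hp)
    (stronglyMeasurable_cone _ (hvm i)).aestronglyMeasurable
    (stronglyMeasurable_cone _ (hvm j)).aestronglyMeasurable
    (stronglyMeasurable_cone _ (hvm i)).aestronglyMeasurable
    (stronglyMeasurable_cone _ (hvm j)).aestronglyMeasurable (hsplit i) (hsplit j)).trans ?_
  have h3 : eLpNorm (fun x => farPart φ s (v i) x - farPart φ s (v j) x) (ENNReal.ofReal p)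
      (volume.restrict B) ≤ ε / 3 := by
    refine (eLpNorm_le_of_ae_bound ((ae_restrict_mem hBm).mono hij)).trans ?_
    rw [Measure.restrict_apply_univ, mul_comm, ENNReal.ofReal_coe_nnreal]
    exact hε'.le
  refine (add_le_add (add_le_add (hnear i) (hnear j)) h3).trans_eq ?_
  exact ENNReal.add_thirds ε

end ConeNet

/-! ### Uniform convexity of `L^p` and convergence of almost minimal elements -/

section UniformConvexity

open Filter Topology

lemma norm_midpoint_rpow_le {F : Type*} [NormedAddCommGroup F] [NormedSpace ℝ F] {p : ℝ}
    (hp : 1 < p) (a b : F) : ‖(1 / 2 : ℝ) • (a + b)‖ ^ p ≤ (‖a‖ ^ p + ‖b‖ ^ p) / 2 := by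
  have h1 : ‖(1 / 2 : ℝ) • (a + b)‖ ≤ 1 / 2 * ‖a‖ + 1 / 2 * ‖b‖ := by
    rw [norm_smul, ← mul_add]
    norm_num
    exact norm_add_le a b
  refine (Real.rpow_le_rpow (norm_nonneg _) h1 (by linarith)).trans ?_
  have h2 := (convexOn_rpow hp.le).2 (norm_nonneg a : ‖a‖ ∈ Ici 0) (norm_nonneg b)
    (by norm_num : (0 : ℝ) ≤ 1 / 2) (by norm_num : (0 : ℝ) ≤ 1 / 2) (by norm_num)
  simp only [smul_eq_mul] at h2
  linarith

/-- If the norms agree, strict convexity of the norm gives the strict inequality; if they differ,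
strict convexity of `t ↦ t^p` does. -/
lemma norm_midpoint_rpow_lt {F : Type*} [NormedAddCommGroup F] [NormedSpace ℝ F]
    [StrictConvexSpace ℝ F] {p : ℝ} (hp : 1 < p) {a b : F} (hab : a ≠ b) :
    ‖(1 / 2 : ℝ) • (a + b)‖ ^ p < (‖a‖ ^ p + ‖b‖ ^ p) / 2 := by
  have hn : ‖(1 / 2 : ℝ) • (a + b)‖ = 1 / 2 * ‖a + b‖ := by
    rw [norm_smul]; norm_num
  rcases eq_or_ne ‖a‖ ‖b‖ with h | h
  · have h1 : ‖a + b‖ < ‖a‖ + ‖b‖ := by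
      refine norm_add_lt_of_not_sameRay fun hs => hab ?_
      exact hs.eq_of_norm_eq h
    have h2 : ‖(1 / 2 : ℝ) • (a + b)‖ < ‖a‖ := by rw [hn]; linarith
    have h3 := Real.rpow_lt_rpow (norm_nonneg _) h2 (by linarith : 0 < p)
    rw [← h]; linarith
  · have h1 : ‖(1 / 2 : ℝ) • (a + b)‖ ≤ 1 / 2 * ‖a‖ + 1 / 2 * ‖b‖ := by
      rw [hn, ← mul_add]
      exact mul_le_mul_of_nonneg_left (norm_add_le a b) (by norm_num)
    refine (Real.rpow_le_rpow (norm_nonneg _) h1 (by linarith)).trans_lt ?_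
    have h2 := (strictConvexOn_rpow hp).2 (norm_nonneg a : ‖a‖ ∈ Ici 0) (norm_nonneg b) h
      (by norm_num : (0 : ℝ) < 1 / 2) (by norm_num : (0 : ℝ) < 1 / 2) (by norm_num)
    simp only [smul_eq_mul] at h2
    linarith

/-- A pointwise form of uniform convexity. -/
lemma exists_norm_sub_rpow_le {F : Type*} [NormedAddCommGroup F] [NormedSpace ℝ F]
    [StrictConvexSpace ℝ F] [FiniteDimensional ℝ F] {p : ℝ} (hp : 1 < p) {ε : ℝ} (hε : 0 < ε) :
    ∃ C : ℝ, 0 ≤ C ∧ ∀ a b : F, ‖a - b‖ ^ p ≤ ε * (‖a‖ ^ p + ‖b‖ ^ p) +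
      C * ((‖a‖ ^ p + ‖b‖ ^ p) / 2 - ‖(1 / 2 : ℝ) • (a + b)‖ ^ p) := by
  have hp0 : 0 < p := by linarith
  have : ProperSpace F := FiniteDimensional.proper ℝ F
  have hcr : ∀ f : F × F → F, Continuous f → Continuous fun q => ‖f q‖ ^ p := fun f hf =>
    hf.norm.rpow_const fun _ => Or.inr hp0.le
  -- By homogeneity the pairs may be normalized to `‖a‖^p + ‖b‖^p = 1`. Pairs with `‖a - b‖^p < ε`
  -- are covered by the first term; the others form this compact set, where the midpoint defect has
  -- a positive lower bound `δ`.
  set S : Set (F × F) := {q | ‖q.1‖ ^ p + ‖q.2‖ ^ p = 1 ∧ ε ≤ ‖q.1 - q.2‖ ^ p}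
  set Δ : F × F → ℝ := fun q => (‖q.1‖ ^ p + ‖q.2‖ ^ p) / 2 - ‖(1 / 2 : ℝ) • (q.1 + q.2)‖ ^ p
  have hΔc : Continuous Δ :=
    (((hcr _ continuous_fst).add (hcr _ continuous_snd)).div_const 2).sub
      (hcr (fun q => (1 / 2 : ℝ) • (q.1 + q.2)) (by fun_prop))
  have hle1 : ∀ x : F, ‖x‖ ^ p ≤ 1 → ‖x‖ ≤ 1 := fun x h =>
    (Real.rpow_le_rpow_iff (norm_nonneg x) zero_le_one hp0).1 (by rwa [Real.one_rpow])
  have hScl : IsClosed S :=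
    (isClosed_eq ((hcr _ continuous_fst).add (hcr _ continuous_snd)) continuous_const).inter
      (isClosed_le continuous_const (hcr (fun q => q.1 - q.2) (by fun_prop)))
  have hSb : S ⊆ Metric.closedBall 0 1 := by
    rintro q ⟨h1, -⟩
    rw [mem_closedBall_zero_iff, Prod.norm_def, max_le_iff]
    have h2 : 0 ≤ ‖q.1‖ ^ p := by positivity
    have h3 : 0 ≤ ‖q.2‖ ^ p := by positivity
    exact ⟨hle1 _ (by linarith), hle1 _ (by linarith)⟩
  have hSc : IsCompact S := (isCompact_closedBall _ _).of_isClosed_subset hScl hSb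
  have hδ : ∃ δ : ℝ, 0 < δ ∧ ∀ q ∈ S, δ ≤ Δ q := by
    rcases S.eq_empty_or_nonempty with hS | hS
    · exact ⟨1, one_pos, by simp [hS]⟩
    · obtain ⟨q, hq, hmin⟩ := hSc.exists_isMinOn hS hΔc.continuousOn
      refine ⟨Δ q, sub_pos.2 (norm_midpoint_rpow_lt hp fun h => ?_), fun q' hq' => hmin hq'⟩
      have := hq.2
      rw [h, sub_self, norm_zero, Real.zero_rpow hp0.ne'] at this
      linarith
  obtain ⟨δ, hδ0, hδ⟩ := hδ
  -- On the cone over `S` one has `‖a - b‖^p ≤ 2^p s`, and `δ s` is at most the defect.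
  refine ⟨2 ^ p / δ, by positivity, fun a b => ?_⟩
  set s := ‖a‖ ^ p + ‖b‖ ^ p with hs
  have hs0 : 0 ≤ s := by positivity
  rcases hs0.eq_or_lt with h0 | hspos
  · have ha : ‖a‖ ^ p = 0 := le_antisymm (by
      have : 0 ≤ ‖b‖ ^ p := by positivity
      linarith) (by positivity)
    have hb : ‖b‖ ^ p = 0 := le_antisymm (by
      have : 0 ≤ ‖a‖ ^ p := by positivity
      linarith) (by positivity)
    rw [Real.rpow_eq_zero (norm_nonneg _) hp0.ne', norm_eq_zero] at ha hb
    simp [← h0, ha, hb, Real.zero_rpow hp0.ne']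
  set k : ℝ := s ^ (-(1 / p))
  have hk0 : 0 < k := Real.rpow_pos_of_pos hspos _
  have hkp : k ^ p = s⁻¹ := by
    rw [← Real.rpow_mul hs0, neg_mul, one_div_mul_cancel hp0.ne', Real.rpow_neg_one]
  have hsc : ∀ x : F, ‖k • x‖ ^ p = s⁻¹ * ‖x‖ ^ p := fun x => by
    rw [norm_smul, Real.norm_of_nonneg hk0.le, Real.mul_rpow hk0.le (norm_nonneg _), hkp]
  have hΔs : Δ (k • a, k • b) = s⁻¹ * (s / 2 - ‖(1 / 2 : ℝ) • (a + b)‖ ^ p) := by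
    have e : (1 / 2 : ℝ) • (k • a + k • b) = k • ((1 / 2 : ℝ) • (a + b)) := by module
    simp only [Δ]
    rw [e, hsc, hsc, hsc, hs]
    ring
  have hΔ0 := norm_midpoint_rpow_le hp a b
  rw [← hs] at hΔ0
  by_cases hq : ε ≤ ‖k • a - k • b‖ ^ p
  · have hmem : (k • a, k • b) ∈ S := by
      refine ⟨?_, hq⟩
      simp only [hsc]
      rw [← mul_add, ← hs, inv_mul_cancel₀ hspos.ne']
    have h1 := hδ _ hmem
    rw [hΔs] at h1
    have h2 : ‖a - b‖ ^ p ≤ 2 ^ p * s := by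
      have h3 : ‖a - b‖ ≤ 2 * max ‖a‖ ‖b‖ := by
        have := norm_sub_le a b
        have h4 := le_max_left ‖a‖ ‖b‖
        have h5 := le_max_right ‖a‖ ‖b‖
        linarith
      refine (Real.rpow_le_rpow (norm_nonneg _) h3 hp0.le).trans ?_
      rw [Real.mul_rpow (by norm_num) (by positivity)]
      refine mul_le_mul_of_nonneg_left ?_ (by positivity)
      have ha : 0 ≤ ‖a‖ ^ p := by positivity
      have hb : 0 ≤ ‖b‖ ^ p := by positivity
      rcases max_cases ‖a‖ ‖b‖ with ⟨h, -⟩ | ⟨h, -⟩ <;> rw [h] <;> linarith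
    have h3 : δ * s ≤ s / 2 - ‖(1 / 2 : ℝ) • (a + b)‖ ^ p := by
      rw [inv_mul_eq_div, le_div_iff₀ hspos] at h1
      exact h1
    have h4 : 2 ^ p * s = 2 ^ p / δ * (δ * s) := by field_simp
    have h5 := mul_le_mul_of_nonneg_left h3 (by positivity : 0 ≤ 2 ^ p / δ)
    have h6 : 0 ≤ ε * s := by positivity
    linarith
  · rw [← smul_sub, hsc, not_le, inv_mul_lt_iff₀ hspos] at hq
    have h5 : 0 ≤ 2 ^ p / δ * (s / 2 - ‖(1 / 2 : ℝ) • (a + b)‖ ^ p) :=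
      mul_nonneg (by positivity) (by linarith)
    linarith

lemma Lp_norm_rpow_eq {X F : Type*} [MeasurableSpace X] {μ : Measure X} [NormedAddCommGroup F]
    {p : ℝ} (hp : 0 < p) (f : Lp F (ENNReal.ofReal p) μ) :
    ‖f‖ ^ p = ∫ x, ‖f x‖ ^ p ∂μ := by
  rw [Lp.norm_def, (Lp.memLp f).eLpNorm_eq_integral_rpow_norm (by simpa using hp)
    ENNReal.ofReal_ne_top, ENNReal.toReal_ofReal hp.le, ENNReal.toReal_ofReal (by positivity),
    ← Real.rpow_mul (by positivity), inv_mul_cancel₀ hp.ne', Real.rpow_one]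

lemma Lp_integrable_norm_rpow {X F : Type*} [MeasurableSpace X] {μ : Measure X}
    [NormedAddCommGroup F] {p : ℝ} (hp : 0 < p) (f : Lp F (ENNReal.ofReal p) μ) :
    Integrable (fun x => ‖f x‖ ^ p) μ := by
  have := (Lp.memLp f).integrable_norm_rpow (by simpa using hp) ENNReal.ofReal_ne_top
  rwa [ENNReal.toReal_ofReal hp.le] at this

/-- The pointwise inequality is linear in `p`-th powers of norms and hence integrates term by term.
It treats all `p > 1` at once, unlike Clarkson's inequalities. -/
lemma Lp_exists_norm_sub_rpow_le {X F : Type*} [MeasurableSpace X] {μ : Measure X}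
    [NormedAddCommGroup F] [NormedSpace ℝ F] [StrictConvexSpace ℝ F] [FiniteDimensional ℝ F]
    {p : ℝ} (hp : 1 < p) {ε : ℝ} (hε : 0 < ε) :
    ∃ C : ℝ, 0 ≤ C ∧ ∀ f g : Lp F (ENNReal.ofReal p) μ,
      ‖f - g‖ ^ p ≤ ε * (‖f‖ ^ p + ‖g‖ ^ p) +
        C * ((‖f‖ ^ p + ‖g‖ ^ p) / 2 - ‖(1 / 2 : ℝ) • (f + g)‖ ^ p) := by
  have hp0 : 0 < p := by linarith
  obtain ⟨C, hC, h⟩ := exists_norm_sub_rpow_le (F := F) hp hε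
  refine ⟨C, hC, fun f g => ?_⟩
  have e1 : ‖f - g‖ ^ p = ∫ x, ‖f x - g x‖ ^ p ∂μ := by
    rw [Lp_norm_rpow_eq hp0]
    refine integral_congr_ae ?_
    filter_upwards [Lp.coeFn_sub f g] with x hx
    rw [hx, Pi.sub_apply]
  have e2 : (fun x => ‖((1 / 2 : ℝ) • (f + g) : Lp F (ENNReal.ofReal p) μ) x‖ ^ p) =ᵐ[μ]
      fun x => ‖(1 / 2 : ℝ) • (f x + g x)‖ ^ p := by
    filter_upwards [Lp.coeFn_smul (1 / 2 : ℝ) (f + g), Lp.coeFn_add f g] with x hx hx'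
    rw [hx, Pi.smul_apply, hx', Pi.add_apply]
  have hi := Lp_integrable_norm_rpow hp0 ((1 / 2 : ℝ) • (f + g) : Lp F (ENNReal.ofReal p) μ)
  have hf := Lp_integrable_norm_rpow hp0 f
  have hg := Lp_integrable_norm_rpow hp0 g
  have hs := Lp_integrable_norm_rpow hp0 (f - g)
  have hs' : Integrable (fun x => ‖f x - g x‖ ^ p) μ := by
    refine hs.congr ?_
    filter_upwards [Lp.coeFn_sub f g] with x hx
    rw [hx, Pi.sub_apply]
  have hfg : Integrable (fun x => ‖f x‖ ^ p + ‖g x‖ ^ p) μ := hf.add hg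
  have hd : Integrable (fun x => (‖f x‖ ^ p + ‖g x‖ ^ p) / 2 - ‖(1 / 2 : ℝ) • (f x + g x)‖ ^ p) μ :=
    (hfg.div_const 2).sub (hi.congr e2)
  have e3 : ∫ x, (ε * (‖f x‖ ^ p + ‖g x‖ ^ p) +
      C * ((‖f x‖ ^ p + ‖g x‖ ^ p) / 2 - ‖(1 / 2 : ℝ) • (f x + g x)‖ ^ p)) ∂μ =
      ε * (∫ x, ‖f x‖ ^ p ∂μ + ∫ x, ‖g x‖ ^ p ∂μ) +
        C * ((∫ x, ‖f x‖ ^ p ∂μ + ∫ x, ‖g x‖ ^ p ∂μ) / 2 -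
          ∫ x, ‖(1 / 2 : ℝ) • (f x + g x)‖ ^ p ∂μ) := by
    rw [integral_add (hfg.const_mul ε) (hd.const_mul C), integral_const_mul, integral_const_mul,
      integral_sub (hfg.div_const 2) (hi.congr e2), integral_div, integral_add hf hg]
  rw [e1, Lp_norm_rpow_eq hp0, Lp_norm_rpow_eq hp0, Lp_norm_rpow_eq hp0, integral_congr_ae e2, ← e3]
  exact integral_mono hs' ((hfg.const_mul ε).add (hd.const_mul C)) fun x => h (f x) (g x)

/-- In a uniformly convex space, a decreasing sequence of convex sets meeting a ball contains a
convergent sequence of almost minimal elements. -/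
lemma exists_tendsto_of_antitone_convex {E : Type*} [NormedAddCommGroup E] [NormedSpace ℝ E]
    [CompleteSpace E] {p : ℝ} (hp : 0 < p)
    (H : ∀ ε : ℝ, 0 < ε → ∃ C : ℝ, 0 ≤ C ∧ ∀ f g : E, ‖f - g‖ ^ p ≤ ε * (‖f‖ ^ p + ‖g‖ ^ p) +
        C * ((‖f‖ ^ p + ‖g‖ ^ p) / 2 - ‖(1 / 2 : ℝ) • (f + g)‖ ^ p))
    {W : ℕ → Set E} (hW : Antitone W) (hWc : ∀ i, Convex ℝ (W i)) {M : ℝ}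
    (hM : ∀ i, ∃ w ∈ W i, ‖w‖ ≤ M) :
    ∃ (w : ℕ → E) (l : E), (∀ i, w i ∈ W i) ∧ Tendsto w atTop (𝓝 l) ∧ ‖l‖ ≤ M ∧
      ∀ x, (∀ i, x ∈ W i) → ‖l‖ ≤ ‖x‖ := by
  have hM0 : 0 ≤ M := by
    obtain ⟨w, -, hw⟩ := hM 0
    exact (norm_nonneg w).trans hw
  set V : ℕ → Set ℝ := fun i => (fun w => ‖w‖ ^ p) '' W i
  have hVb : ∀ i, BddBelow (V i) := fun i => ⟨0, by rintro _ ⟨w, -, rfl⟩; positivity⟩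
  have hVn : ∀ i, (V i).Nonempty := fun i => by
    obtain ⟨w, hw, -⟩ := hM i
    exact ⟨_, w, hw, rfl⟩
  -- The infima increase with `i` and stay below `M^p`, so they converge; this convergence forces
  -- almost minimizers to be Cauchy.
  set N : ℕ → ℝ := fun i => sInf (V i)
  have hNle : ∀ i, ∀ w ∈ W i, N i ≤ ‖w‖ ^ p := fun i w hw => csInf_le (hVb i) ⟨w, hw, rfl⟩
  have hNmono : Monotone N := fun i j hij => csInf_le_csInf (hVb i) (hVn j) (image_mono (hW hij))
  have hNM : ∀ i, N i ≤ M ^ p := fun i => by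
    obtain ⟨w, hw, hwM⟩ := hM i
    exact (hNle i w hw).trans (Real.rpow_le_rpow (norm_nonneg _) hwM hp.le)
  have hex : ∀ i : ℕ, ∃ w ∈ W i, ‖w‖ ^ p < N i + 1 / ((i : ℝ) + 1) := fun i => by
    obtain ⟨_, ⟨w, hw, rfl⟩, h⟩ := exists_lt_of_csInf_lt (hVn i)
      (lt_add_of_pos_right (N i) (by positivity : 0 < 1 / ((i : ℝ) + 1)))
    exact ⟨w, hw, h⟩
  choose w hw hwN using hex
  have hNlim : Tendsto N atTop (𝓝 (⨆ i, N i)) :=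
    tendsto_atTop_ciSup hNmono ⟨M ^ p, by rintro _ ⟨i, rfl⟩; exact hNM i⟩
  have hNsup : ∀ i, N i ≤ ⨆ i, N i := fun i =>
    le_ciSup ⟨M ^ p, by rintro _ ⟨i, rfl⟩; exact hNM i⟩ i
  have h1lim : Tendsto (fun i : ℕ => 1 / ((i : ℝ) + 1)) atTop (𝓝 0) :=
    tendsto_one_div_add_atTop_nhds_zero_nat
  have hcauchy : CauchySeq w := by
    refine Metric.cauchySeq_iff'.2 fun ε hε => ?_
    have hA : 0 < 2 * (M ^ p + 1) := by positivity
    -- Almost minimizers satisfy `‖w j‖^p + ‖w i‖^p ≤ 2(M^p + 1)`, so the first term of the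
    -- convexity inequality is at most `ε^p/2`.
    obtain ⟨C, hC, hH⟩ := H (ε ^ p / 2 / (2 * (M ^ p + 1))) (by positivity)
    have hlim : Tendsto (fun i : ℕ => C * (((⨆ i, N i) - N i) / 2 + 1 / ((i : ℝ) + 1))) atTop
        (𝓝 0) := by
      have := (((hNlim.const_sub (⨆ i, N i)).div_const 2).add h1lim).const_mul C
      simpa using this
    obtain ⟨i, hi⟩ := (hlim.eventually (gt_mem_nhds (by positivity : 0 < ε ^ p / 2))).exists
    refine ⟨i, fun j hij => ?_⟩
    -- For `j ≥ i` both points lie in the convex set `W i`, hence so does the midpoint. This bounds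
    -- the defect by `(sup N - N i)/2 + 1/(i+1)`.
    have hmid : N i ≤ ‖(1 / 2 : ℝ) • (w j + w i)‖ ^ p := by
      refine hNle i _ ?_
      have := hWc i (hW hij (hw j)) (hw i) (by norm_num : (0 : ℝ) ≤ 1 / 2)
        (by norm_num : (0 : ℝ) ≤ 1 / 2) (by norm_num)
      rwa [smul_add]
    have hji : 1 / ((j : ℝ) + 1) ≤ 1 / ((i : ℝ) + 1) :=
      one_div_le_one_div_of_le (by positivity) (by have : (i : ℝ) ≤ j := by exact_mod_cast hij
                                                   linarith)
    have hb : ∀ k : ℕ, 1 / ((k : ℝ) + 1) ≤ 1 := fun k => by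
      rw [div_le_one (by positivity)]
      have : (0 : ℝ) ≤ k := by positivity
      linarith
    have h1 := hH (w j) (w i)
    have h2 : ε ^ p / 2 / (2 * (M ^ p + 1)) * (‖w j‖ ^ p + ‖w i‖ ^ p) ≤ ε ^ p / 2 := by
      rw [div_mul_eq_mul_div, div_le_iff₀ hA]
      refine mul_le_mul_of_nonneg_left ?_ (by positivity)
      have := hwN j
      have := hwN i
      linarith [hNM i, hNM j, hb i, hb j]
    have h3 : C * ((‖w j‖ ^ p + ‖w i‖ ^ p) / 2 - ‖(1 / 2 : ℝ) • (w j + w i)‖ ^ p) ≤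
        C * (((⨆ i, N i) - N i) / 2 + 1 / ((i : ℝ) + 1)) := by
      refine mul_le_mul_of_nonneg_left ?_ hC
      have := hwN j
      have := hwN i
      linarith [hNsup j]
    rw [dist_eq_norm]
    refine lt_of_not_ge fun h => ?_
    have h4 := Real.rpow_le_rpow hε.le h hp.le
    linarith
  obtain ⟨l, hl⟩ := cauchySeq_tendsto_of_complete hcauchy
  have hlp : Tendsto (fun i => ‖w i‖ ^ p) atTop (𝓝 (‖l‖ ^ p)) :=
    hl.norm.rpow_const (Or.inr hp.le)
  have hbound : ∀ b : ℝ, 0 ≤ b → (∀ i, N i ≤ b ^ p) → ‖l‖ ≤ b := by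
    intro b hb0 hb
    refine (Real.rpow_le_rpow_iff (norm_nonneg _) hb0 hp).1 ?_
    have h2 : Tendsto (fun i : ℕ => b ^ p + 1 / ((i : ℝ) + 1)) atTop (𝓝 (b ^ p)) := by
      simpa using h1lim.const_add (b ^ p)
    exact le_of_tendsto_of_tendsto' hlp h2 fun i => (hwN i).le.trans (by linarith [hb i])
  exact ⟨w, l, hw, hl, hbound M hM0 hNM, fun x hx => hbound _ (norm_nonneg _) fun i =>
    hNle i x (hx i)⟩

end UniformConvexity

/-! ### The classical differential in terms of alternating maps -/

namespace Form

variable {n k l : ℕ}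

lemma toAlt_wedge_dx_single (i : Fin n) (a : Form n k) :
    toAlt (wedge (k + 1) (dx i) a) = wedgeL (EuclideanSpace.proj (𝕜 := ℝ) i) (toAlt a) := by
  rw [← toAlt_wedge_dx, Finset.sum_eq_single i]
  · simp
  · intro j _ hj
    simp [hj.symm]
  · simp

lemma alternatizeUncurryFin_eq_sum
    (A : EuclideanSpace ℝ (Fin n) →L[ℝ] Alt n k) :
    ContinuousAlternatingMap.alternatizeUncurryFin A =
      ∑ i : Fin n, wedgeL (EuclideanSpace.proj (𝕜 := ℝ) i) (A (EuclideanSpace.single i 1)) := by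
  have h2 : A = ∑ i : Fin n,
      ((EuclideanSpace.proj (𝕜 := ℝ) i : EuclideanSpace ℝ (Fin n) →L[ℝ] ℝ).smulRight
        (A (EuclideanSpace.single i 1))) := by
    ext x v
    conv_lhs => rw [eq_sum_single x, map_sum]
    simp
  conv_lhs => rw [h2]
  exact map_sum (ContinuousAlternatingMap.alternatizeUncurryFinCLM ℝ
    (EuclideanSpace ℝ (Fin n)) ℝ (n := k)) (fun i : Fin n =>
      ((EuclideanSpace.proj (𝕜 := ℝ) i : EuclideanSpace ℝ (Fin n) →L[ℝ] ℝ).smulRight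
        (A (EuclideanSpace.single i 1)))) Finset.univ

lemma toAlt_extD {φ : EuclideanSpace ℝ (Fin n) → Form n k} {x : EuclideanSpace ℝ (Fin n)}
    (hφ : DifferentiableAt ℝ φ x) :
    toAlt (extD (k + 1) φ x) = extDeriv (fun y => toAlt (φ y)) x := by
  have h : fderiv ℝ (fun y => toAlt (φ y)) x = toAlt.comp (fderiv ℝ φ x) :=
    (toAlt.hasFDerivAt.comp x hφ.hasFDerivAt).fderiv
  rw [extDeriv, h, alternatizeUncurryFin_eq_sum, extD, map_sum]
  exact Finset.sum_congr rfl fun i _ => toAlt_wedge_dx_single i _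

/-- The pairing `∫ a ∧ b` of covectors of complementary degrees. -/
def topWedge : Form n k →L[ℝ] Form n l →L[ℝ] ℝ :=
  (LinearMap.mk₂ ℝ (fun (a : Form n k) (b : Form n l) => top (wedge n a b))
    (fun a a' b => by rw [wedge_add_left, top_add])
    (fun c a b => by rw [wedge_smul_left, top_smul, smul_eq_mul])
    (fun a b b' => by rw [wedge_add_right]; rfl)
    (fun c a b => by
      simp only [top, wedge, smul_eq_mul, Finset.mul_sum, PiLp.smul_apply]
      refine Finset.sum_congr rfl fun I _ => Finset.sum_congr rfl fun J _ => ?_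
      split_ifs <;> ring)).toContinuousBilinearMap

lemma topWedge_apply (a : Form n k) (b : Form n l) : topWedge a b = top (wedge n a b) := rfl

end Form

/-! ### Closedness of the weak differential, minimal primitives -/

section WeakClosed

open Filter Topology

variable {n k : ℕ} {D : TopologicalSpace.Opens (EuclideanSpace ℝ (Fin n))} {p : ℝ}
  [Fact (1 ≤ ENNReal.ofReal p)]

/-- A continuous form of compact support lies in the dual `L^q`, so this is Hölder duality. It makes
the weak equation stable under `L^p` limits. -/
lemma LpForm.continuous_integral_wedge {l : ℕ} {g : EuclideanSpace ℝ (Fin n) → Form n l}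
    (hg : Continuous g) (hc : HasCompactSupport g) :
    Continuous fun ω : LpForm D p k =>
      ∫ x in (D : Set (EuclideanSpace ℝ (Fin n))), top (wedge n (ω x) (g x)) := by
  set μ := volume.restrict (D : Set (EuclideanSpace ℝ (Fin n)))
  set q := ENNReal.conjExponent (ENNReal.ofReal p)
  have hq : ENNReal.HolderConjugate (ENNReal.ofReal p) q :=
    ENNReal.HolderConjugate.conjExponent Fact.out
  have : Fact (1 ≤ q) := ⟨ENNReal.HolderConjugate.one_le q (ENNReal.ofReal p)⟩
  have hgm : MemLp g q μ := hg.memLp_of_hasCompactSupport hc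
  have h := ((topWedge (n := n) (k := k) (l := l)).lpPairing μ (ENNReal.ofReal p) q).flip
    hgm.toLp |>.continuous
  refine h.congr fun ω => ?_
  rw [ContinuousLinearMap.flip_apply, ContinuousLinearMap.lpPairing_eq_integral]
  refine integral_congr_ae ?_
  filter_upwards [hgm.coeFn_toLp] with x hx
  rw [hx, topWedge_apply]

lemma IsWeakD.of_tendsto {θ : ℕ → LpForm D p k} {ω : ℕ → LpForm D p (k + 1)} {θ₀ : LpForm D p k}
    {ω₀ : LpForm D p (k + 1)} (h : ∀ i, IsWeakD D (θ i) (ω i)) (hθ : Tendsto θ atTop (𝓝 θ₀))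
    (hω : Tendsto ω atTop (𝓝 ω₀)) : IsWeakD D θ₀ ω₀ := by
  intro l hl φ hφ
  have h1 := ((LpForm.continuous_integral_wedge (continuous_extD (m := l + 1) hφ.smooth)
      (hasCompactSupport_extD hφ.compact)).tendsto θ₀).comp hθ
  have h2 := (((LpForm.continuous_integral_wedge hφ.smooth.continuous hφ.compact).tendsto
    ω₀).comp hω).const_mul ((-1) ^ (k + 1))
  exact tendsto_nhds_unique h1 (h2.congr fun i => (h i l hl φ hφ).symm)

/-- Among the forms in `L^p` with a given weak differential there is one of minimal norm. -/
lemma IsWeakD.exists_minimal (hp : 1 < p) {ω : LpForm D p (k + 1)} {θ : LpForm D p k}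
    (h : IsWeakD D θ ω) :
    ∃ η : LpForm D p k, IsWeakD D η ω ∧ ∀ θ : LpForm D p k, IsWeakD D θ ω → ‖η‖ ≤ ‖θ‖ := by
  have hconv : Convex ℝ {η : LpForm D p k | IsWeakD D η ω} := by
    intro a ha b hb s t _ _ hst
    have h1 := IsWeakD.add (IsWeakD.smul (ω := a) (η := ω) s ha)
      (IsWeakD.smul (ω := b) (η := ω) t hb)
    have h2 : s • ω + t • ω = ω := by rw [← add_smul, hst, one_smul]
    rw [h2] at h1
    exact h1
  have H := fun (ε : ℝ) (hε : 0 < ε) => Lp_exists_norm_sub_rpow_le (F := Form n k)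
    (μ := volume.restrict (D : Set (EuclideanSpace ℝ (Fin n)))) hp hε
  -- The sequence of sets is constant: the affine space of all primitives of `ω`.
  obtain ⟨w, η, hw, hlim, -, hmin⟩ := exists_tendsto_of_antitone_convex (by linarith : 0 < p) H
    (W := fun _ => {η : LpForm D p k | IsWeakD D η ω}) antitone_const (fun _ => hconv)
    (M := ‖θ‖) (fun _ => ⟨θ, h, le_rfl⟩)
  refine ⟨η, ?_, fun θ hθ => hmin θ fun _ => hθ⟩
  exact IsWeakD.of_tendsto (ω := fun _ => ω) hw hlim tendsto_const_nhds

/-- The forms whose weak differential is bounded in `L^p` are closed in `L^p`. -/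
lemma IsWeakD.exists_of_mem_closure (hp : 1 < p) {M : ℝ} {θ : LpForm D p k}
    (h : θ ∈ closure {θ : LpForm D p k | ∃ ω : LpForm D p (k + 1), ‖ω‖ ≤ M ∧ IsWeakD D θ ω}) :
    ∃ ω : LpForm D p (k + 1), ‖ω‖ ≤ M ∧ IsWeakD D θ ω := by
  -- The differentials of forms close to `θ`. Almost minimal elements of these convex sets converge
  -- in norm, which takes the place of weak compactness of balls in `L^p`.
  set W : ℕ → Set (LpForm D p (k + 1)) := fun i =>
    {ω | ∃ θ' : LpForm D p k, ‖θ' - θ‖ ≤ 1 / ((i : ℝ) + 1) ∧ IsWeakD D θ' ω}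
  have hanti : Antitone W := by
    rintro i j hij ω ⟨θ', h1, h2⟩
    refine ⟨θ', h1.trans (one_div_le_one_div_of_le (by positivity) ?_), h2⟩
    have : (i : ℝ) ≤ j := by exact_mod_cast hij
    linarith
  have hconv : ∀ i, Convex ℝ (W i) := by
    rintro i a ⟨θa, ha, ha'⟩ b ⟨θb, hb, hb'⟩ s t hs ht hst
    refine ⟨s • θa + t • θb, ?_, IsWeakD.add (IsWeakD.smul (ω := θa) (η := a) s ha')
      (IsWeakD.smul (ω := θb) (η := b) t hb')⟩
    have e : s • θa + t • θb - θ = s • (θa - θ) + t • (θb - θ) := by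
      have : θ = (s + t) • θ := by rw [hst, one_smul]
      conv_lhs => rw [this]
      module
    rw [e]
    refine (norm_add_le _ _).trans ?_
    rw [norm_smul, norm_smul, Real.norm_of_nonneg hs, Real.norm_of_nonneg ht]
    calc _ ≤ s * (1 / ((i : ℝ) + 1)) + t * (1 / ((i : ℝ) + 1)) :=
          add_le_add (mul_le_mul_of_nonneg_left ha hs) (mul_le_mul_of_nonneg_left hb ht)
      _ = _ := by rw [← add_mul, hst, one_mul]
  have hM : ∀ i, ∃ ω ∈ W i, ‖ω‖ ≤ M := by
    intro i
    obtain ⟨θ', ⟨ω, hω, hd⟩, hθ'⟩ := Metric.mem_closure_iff.1 h (1 / ((i : ℝ) + 1)) (by positivity)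
    rw [dist_comm, dist_eq_norm] at hθ'
    exact ⟨ω, ⟨θ', hθ'.le, hd⟩, hω⟩
  have H := fun (ε : ℝ) (hε : 0 < ε) => Lp_exists_norm_sub_rpow_le (F := Form n (k + 1))
    (μ := volume.restrict (D : Set (EuclideanSpace ℝ (Fin n)))) hp hε
  obtain ⟨w, ω, hw, hlim, hωM, -⟩ := exists_tendsto_of_antitone_convex (by linarith : 0 < p) H
    hanti hconv hM
  choose θ' hθ' hd using hw
  have hlim' : Tendsto θ' atTop (𝓝 θ) := by
    rw [tendsto_iff_norm_sub_tendsto_zero]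
    exact squeeze_zero (fun _ => norm_nonneg _) hθ' tendsto_one_div_add_atTop_nhds_zero_nat
  exact ⟨ω, hωM, IsWeakD.of_tendsto hd hlim' hlim⟩

end WeakClosed

/-! ### The first variation at a minimizer -/

section PHarmonic

open Filter Topology

lemma hasDerivAt_norm_line_rpow {F : Type*} [NormedAddCommGroup F] [InnerProductSpace ℝ F] {p : ℝ}
    (hp : 1 < p) (a b : F) (t : ℝ) :
    HasDerivAt (fun t : ℝ => ‖a + t • b‖ ^ p)
      (p * ‖a + t • b‖ ^ (p - 2) * inner ℝ (a + t • b) b) t := by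
  have h1 : HasDerivAt (fun t : ℝ => a + t • b) b t := by
    simpa using ((hasDerivAt_id t).smul_const b).const_add a
  have h2 := (hasFDerivAt_norm_rpow (a + t • b) hp).comp_hasDerivAt t h1
  refine h2.congr_deriv ?_
  simp only [_root_.smul_apply, innerSL_apply_apply, smul_eq_mul]

/-- The domination needed to differentiate under the integral. For `p < 2` the power `p - 2` is
singular at zero, but the inner product supplies one more factor of the norm, leaving the exponent
`p - 1 > 0`. -/
lemma abs_deriv_norm_line_le {F : Type*} [NormedAddCommGroup F] [InnerProductSpace ℝ F] {p : ℝ}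
    (hp : 1 < p) (a b : F) {t : ℝ} (ht : |t| ≤ 1) :
    ‖p * ‖a + t • b‖ ^ (p - 2) * inner ℝ (a + t • b) b‖ ≤ p * 2 ^ p * (‖a‖ ^ p + ‖b‖ ^ p) := by
  have hp0 : 0 < p := by linarith
  set s := max ‖a‖ ‖b‖
  have hs0 : 0 ≤ s := (norm_nonneg a).trans (le_max_left _ _)
  have hc : ‖a + t • b‖ ≤ 2 * s := by
    refine (norm_add_le _ _).trans ?_
    rw [norm_smul, Real.norm_eq_abs]
    have h1 : |t| * ‖b‖ ≤ ‖b‖ := mul_le_of_le_one_left (norm_nonneg _) ht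
    linarith [le_max_left ‖a‖ ‖b‖, le_max_right ‖a‖ ‖b‖]
  have hb : ‖b‖ ≤ 2 * s := by linarith [le_max_right ‖a‖ ‖b‖]
  have hkey : ‖a + t • b‖ ^ (p - 2) * (‖a + t • b‖ * ‖b‖) ≤ (2 * s) ^ p := by
    rcases eq_or_lt_of_le (norm_nonneg (a + t • b)) with h | h
    · rw [← h]; simp; positivity
    · have e1 : ‖a + t • b‖ ^ (p - 2) * (‖a + t • b‖ * ‖b‖) = ‖a + t • b‖ ^ (p - 1) * ‖b‖ := by
        rw [← mul_assoc, ← Real.rpow_add_one h.ne']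
        congr 2; ring
      have h2s : 0 < 2 * s := h.trans_le hc
      have e2 : (2 * s) ^ p = (2 * s) ^ (p - 1) * (2 * s) := by
        rw [← Real.rpow_add_one h2s.ne']; congr 1; ring
      rw [e1, e2]
      exact mul_le_mul (Real.rpow_le_rpow h.le hc (by linarith)) hb (norm_nonneg _) (by positivity)
  have hsp : s ^ p ≤ ‖a‖ ^ p + ‖b‖ ^ p := by
    have ha : 0 ≤ ‖a‖ ^ p := by positivity
    have hb : 0 ≤ ‖b‖ ^ p := by positivity
    rcases max_cases ‖a‖ ‖b‖ with ⟨h, -⟩ | ⟨h, -⟩ <;> simp only [s, h] <;> linarith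
  rw [norm_mul, norm_mul, Real.norm_of_nonneg hp0.le, Real.norm_of_nonneg (by positivity), mul_assoc,
    mul_assoc]
  refine mul_le_mul_of_nonneg_left ?_ hp0.le
  calc _ ≤ ‖a + t • b‖ ^ (p - 2) * (‖a + t • b‖ * ‖b‖) :=
        mul_le_mul_of_nonneg_left (norm_inner_le_norm _ _) (by positivity)
    _ ≤ (2 * s) ^ p := hkey
    _ = 2 ^ p * s ^ p := Real.mul_rpow (by norm_num) hs0
    _ ≤ _ := mul_le_mul_of_nonneg_left hsp (by positivity)

/-- The first variation of the `L^p` norm vanishes at a minimizer. -/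
lemma integral_rpow_mul_inner_eq_zero {X F : Type*} [MeasurableSpace X] {μ : Measure X}
    [NormedAddCommGroup F] [InnerProductSpace ℝ F] {p : ℝ} (hp : 1 < p)
    (f g : Lp F (ENNReal.ofReal p) μ) (hmin : ∀ t : ℝ, ‖f‖ ≤ ‖f + t • g‖) :
    ∫ x, ‖f x‖ ^ (p - 2) * inner ℝ (f x) (g x) ∂μ = 0 := by
  have hp0 : 0 < p := by linarith
  have hae : ∀ t : ℝ, (fun x => ‖(f + t • g : Lp F (ENNReal.ofReal p) μ) x‖ ^ p) =ᵐ[μ]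
      fun x => ‖f x + t • g x‖ ^ p := by
    intro t
    filter_upwards [Lp.coeFn_add f (t • g), Lp.coeFn_smul t g] with x hx hx'
    rw [hx, Pi.add_apply, hx', Pi.smul_apply]
  have hI : ∀ t : ℝ, ‖f + t • g‖ ^ p = ∫ x, ‖f x + t • g x‖ ^ p ∂μ := fun t => by
    rw [Lp_norm_rpow_eq hp0, integral_congr_ae (hae t)]
  have hint : ∀ t : ℝ, Integrable (fun x => ‖f x + t • g x‖ ^ p) μ := fun t =>
    (Lp_integrable_norm_rpow hp0 (f + t • g)).congr (hae t)
  have hfm := (Lp.aestronglyMeasurable f)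
  have hgm := (Lp.aestronglyMeasurable g)
  have hd := (hasDerivAt_integral_of_dominated_loc_of_deriv_le (x₀ := (0 : ℝ))
    (s := Metric.ball (0 : ℝ) 1) (μ := μ)
    (F := fun t x => ‖f x + t • g x‖ ^ p)
    (F' := fun t x => p * ‖f x + t • g x‖ ^ (p - 2) * inner ℝ (f x + t • g x) (g x))
    (bound := fun x => p * 2 ^ p * (‖f x‖ ^ p + ‖g x‖ ^ p)) (Metric.ball_mem_nhds 0 one_pos)
    (Eventually.of_forall fun t => (hint t).aestronglyMeasurable) (hint 0) ?_
    (Eventually.of_forall fun x t ht => abs_deriv_norm_line_le hp _ _ ?_)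
    (((Lp_integrable_norm_rpow hp0 f).add (Lp_integrable_norm_rpow hp0 g)).const_mul _)
    (Eventually.of_forall fun x t _ => hasDerivAt_norm_line_rpow hp _ _ t)).2
  · have hmin' : IsLocalMin (fun t : ℝ => ∫ x, ‖f x + t • g x‖ ^ p ∂μ) 0 := by
      refine Eventually.of_forall fun t => ?_
      change ∫ x, ‖f x + (0 : ℝ) • g x‖ ^ p ∂μ ≤ ∫ x, ‖f x + t • g x‖ ^ p ∂μ
      rw [← hI, ← hI]
      refine Real.rpow_le_rpow (by rw [Lp.norm_def]; exact ENNReal.toReal_nonneg) ?_ hp0.le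
      rw [zero_smul, add_zero]
      exact hmin t
    have h0 := hmin'.hasDerivAt_eq_zero hd
    simp only [zero_smul, add_zero, mul_assoc, integral_const_mul] at h0
    exact (mul_eq_zero.1 h0).resolve_left hp0.ne'
  · have hs : AEStronglyMeasurable (fun x => f x + (0 : ℝ) • g x) μ := hfm.add (hgm.const_smul 0)
    exact (((hs.norm.aemeasurable.pow_const (p - 2)).const_mul p).aestronglyMeasurable).mul
      (hs.inner hgm)
  · rw [Metric.mem_ball, dist_zero_right] at ht
    exact ht.le

variable {n k : ℕ} {D : TopologicalSpace.Opens (EuclideanSpace ℝ (Fin n))} {p : ℝ}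
  [Fact (1 ≤ ENNReal.ofReal p)]

/-- The classical identity `d(dφ) = 0` together with `altWeakD_extDeriv`. -/
lemma isWeakD_extD {l : ℕ} {φ : EuclideanSpace ℝ (Fin n) → Form n l} (hφ : IsTestForm D φ)
    {ψ : LpForm D p (l + 1)}
    (hψ : ∀ᵐ x ∂(volume.restrict (D : Set (EuclideanSpace ℝ (Fin n)))), ψ x = extD (l + 1) φ x) :
    IsWeakD D ψ (0 : LpForm D p (l + 2)) := by
  have hw : ContDiff ℝ ((⊤ : ℕ∞) : WithTop ℕ∞) fun x => toAlt (φ x) :=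
    toAlt.contDiff.comp hφ.smooth
  have hw1 : ContDiff ℝ 1 (fderiv ℝ fun x => toAlt (φ x)) :=
    hw.fderiv_right (m := 1) (by rw [one_add_one_eq_two]; exact ENat.LEInfty.out)
  have hw' : ContDiff ℝ 1 (extDeriv fun x => toAlt (φ x)) :=
    ContDiff.comp (g := ContinuousAlternatingMap.alternatizeUncurryFinCLM ℝ
      (EuclideanSpace ℝ (Fin n)) ℝ (n := l)) (ContinuousLinearMap.contDiff _) hw1
  rw [isWeakD_iff]
  intro g hg hc hs
  rw [← setIntegral_weak_integrand _ _ hs]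
  have h := altWeakD_extDeriv hw' g hg hc (subset_univ _)
  rw [← setIntegral_weak_integrand _ _ hs] at h
  rw [← h]
  refine integral_congr_ae ?_
  filter_upwards [hψ, Lp.coeFn_zero (Form n (l + 2)) (ENNReal.ofReal p)
      (volume.restrict (D : Set (EuclideanSpace ℝ (Fin n))))] with x hx h0
  have h2 : extDeriv (extDeriv fun x => toAlt (φ x)) x = 0 :=
    extDeriv_extDeriv_apply hw.contDiffAt
      (by rw [minSmoothness_of_isRCLikeNormedField]; exact ENat.LEInfty.out)
  rw [hx, h0, toAlt_extD (hφ.smooth.differentiable (by simp) x), h2]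
  simp only [Pi.zero_apply, map_zero]

/-- Since `d(dφ) = 0`, the whole line `η + t dφ` consists of primitives of `ω`, so the minimum at `t
= 0` makes the first variation vanish. -/
lemma isPHarmonic_of_minimal (hp : 1 < p) {ω : LpForm D p (k + 1)} {η : LpForm D p k}
    (h : IsWeakD D η ω) (hmin : ∀ θ : LpForm D p k, IsWeakD D θ ω → ‖η‖ ≤ ‖θ‖) :
    IsPHarmonic D p η := by
  rintro l rfl φ hφ
  have hm : MemLp (extD (l + 1) φ) (ENNReal.ofReal p)
      (volume.restrict (D : Set (EuclideanSpace ℝ (Fin n)))) :=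
    (continuous_extD hφ.smooth).memLp_of_hasCompactSupport (hasCompactSupport_extD hφ.compact)
  have hd : IsWeakD D hm.toLp (0 : LpForm D p (l + 2)) := isWeakD_extD hφ hm.coeFn_toLp
  have h0 := integral_rpow_mul_inner_eq_zero hp η hm.toLp fun t => hmin _ (by
    have := IsWeakD.add (ω := η) (η := ω) h (IsWeakD.smul (ω := hm.toLp) t hd)
    rwa [smul_zero, add_zero] at this)
  rw [← h0]
  refine integral_congr_ae ?_
  filter_upwards [hm.coeFn_toLp] with x hx
  rw [hx]

end PHarmonic

/-! ### Norms of pullbacks -/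

section Transfer

open Filter Topology

variable {n k : ℕ}

lemma AltWeakD.congr_ae {U : Set (EuclideanSpace ℝ (Fin n))}
    {θ θ' : EuclideanSpace ℝ (Fin n) → Alt n k} {η η' : EuclideanSpace ℝ (Fin n) → Alt n (k + 1)}
    (h : AltWeakD U θ η) (hθ : θ =ᵐ[volume.restrict U] θ') (hη : η =ᵐ[volume.restrict U] η') :
    AltWeakD U θ' η' := by
  intro g hg hc hs
  have h0 := h g hg hc hs
  rw [← setIntegral_weak_integrand _ _ hs] at h0 ⊢
  rw [← h0]
  refine integral_congr_ae ?_
  filter_upwards [hθ, hη] with x hx hx'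
  rw [hx, hx']

lemma eLpNorm_comp_le {X Y F : Type*} [MeasurableSpace X] [MeasurableSpace Y]
    [NormedAddCommGroup F] {μ : Measure X} {ν : Measure Y} {f : X → Y} {M : ℝ≥0∞} {p : ℝ}
    (hp : 0 < p) (hf : AEMeasurable f μ) (hmap : μ.map f ≤ M • ν) {u : Y → F}
    (hu : AEStronglyMeasurable u ν) :
    eLpNorm (fun x => u (f x)) (ENNReal.ofReal p) μ ≤
      M ^ (1 / p) * eLpNorm u (ENNReal.ofReal p) ν := by
  rw [eLpNorm_ofReal_eq hp, eLpNorm_ofReal_eq hp, ← ENNReal.mul_rpow_of_nonneg _ _ (by positivity)]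
  exact ENNReal.rpow_le_rpow (lintegral_comp_le hf hmap (hu.enorm.pow_const p)) (by positivity)

lemma eLpNorm_le_mul_of_ae {X F G : Type*} [MeasurableSpace X] [NormedAddCommGroup F]
    [NormedAddCommGroup G] {μ : Measure X} {q : ℝ≥0∞} {f : X → F} {g : X → G} {c : ℝ≥0}
    (h : ∀ᵐ x ∂μ, ‖f x‖ ≤ c * ‖g x‖) : eLpNorm f q μ ≤ c * eLpNorm g q μ := by
  have h1 := eLpNorm_le_nnreal_smul_eLpNorm_of_ae_le_mul (p := q) (f := f) (g := g) (c := c)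
    (h.mono fun x hx => by exact_mod_cast hx)
  rwa [ENNReal.smul_def, smul_eq_mul] at h1

lemma exists_stronglyMeasurable_extension {X F : Type*} [MeasurableSpace X]
    [NormedAddCommGroup F] {μ : Measure X} {s : Set X} (hs : MeasurableSet s) {f : X → F}
    (hf : AEStronglyMeasurable f (μ.restrict s)) (q : ℝ≥0∞) :
    ∃ v : X → F, StronglyMeasurable v ∧ (∀ z, z ∉ s → v z = 0) ∧ v =ᵐ[μ.restrict s] f ∧
      eLpNorm v q μ = eLpNorm f q (μ.restrict s) := by
  refine ⟨s.indicator (hf.mk f), hf.stronglyMeasurable_mk.indicator hs,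
    fun z hz => indicator_of_notMem hz _, ?_, ?_⟩
  · filter_upwards [hf.ae_eq_mk, ae_restrict_mem hs] with x hx hxs
    rw [hx, indicator_of_mem hxs]
  · rw [eLpNorm_indicator_eq_eLpNorm_restrict hs, ← eLpNorm_congr_ae hf.ae_eq_mk]

variable {D V : Set (EuclideanSpace ℝ (Fin n))} {C L : ℝ≥0}
  {β α : EuclideanSpace ℝ (Fin n) → EuclideanSpace ℝ (Fin n)}

lemma IsBiLipschitz.aestronglyMeasurable_pull (h : IsBiLipschitz C L D V β α) (hD : IsOpen D)
    (hV : IsOpen V) {θ : EuclideanSpace ℝ (Fin n) → Alt n k}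
    (hθ : AEStronglyMeasurable θ (volume.restrict V)) :
    AEStronglyMeasurable (fun x => pull (θ (β x)) (fderiv ℝ β x)) (volume.restrict D) := by
  have hac := map_absolutelyContinuous_of_map_le (h.map_le hD.measurableSet hV.measurableSet)
  have h1 : AEStronglyMeasurable (fun x => θ (β x)) (volume.restrict D) :=
    (hθ.mono_ac hac).comp_aemeasurable (h.aemeasurable hD.measurableSet)
  have h2 : AEStronglyMeasurable (fun x => fderiv ℝ β x) (volume.restrict D) :=
    (measurable_fderiv ℝ β).aestronglyMeasurable
  exact continuous_pull.comp_aestronglyMeasurable (h1.prodMk h2)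

/-- The derivative of `β` enters `k` times with norm at most `C`; the change of variables costs
`L^n` before the `p`-th root. -/
lemma IsBiLipschitz.eLpNorm_pull_le (h : IsBiLipschitz C L D V β α) (hD : IsOpen D)
    (hV : IsOpen V) {p : ℝ} (hp : 0 < p) {θ : EuclideanSpace ℝ (Fin n) → Alt n k}
    (hθ : AEStronglyMeasurable θ (volume.restrict V)) :
    eLpNorm (fun x => pull (θ (β x)) (fderiv ℝ β x)) (ENNReal.ofReal p) (volume.restrict D) ≤
      ((C ^ k : ℝ≥0) : ℝ≥0∞) * (((L : ℝ≥0∞) ^ n) ^ (1 / p) *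
        eLpNorm θ (ENNReal.ofReal p) (volume.restrict V)) := by
  refine le_trans ?_ (mul_le_mul_right (eLpNorm_comp_le hp (h.aemeasurable hD.measurableSet)
    (h.map_le hD.measurableSet hV.measurableSet) hθ) _)
  refine eLpNorm_le_mul_of_ae ((ae_restrict_mem hD.measurableSet).mono fun x hx => ?_)
  refine (norm_pull_le _ _).trans ?_
  rw [mul_comm, NNReal.coe_pow]
  exact mul_le_mul_of_nonneg_right (pow_le_pow_left₀ (norm_nonneg _) (h.norm_fderiv_le hD hx) _)
    (norm_nonneg _)

end Transfer

/-! ### Transport of forms between the domain and the ball -/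

section TransferLp

open Filter Topology

variable {n k : ℕ} {D : TopologicalSpace.Opens (EuclideanSpace ℝ (Fin n))}
  {V : Set (EuclideanSpace ℝ (Fin n))} {C L : ℝ≥0} {p : ℝ}
  {β α : EuclideanSpace ℝ (Fin n) → EuclideanSpace ℝ (Fin n)}

lemma coe_pow_rpow_eq_ofReal (n : ℕ) (L : ℝ≥0) (hp : 0 < p) :
    ((L : ℝ≥0∞) ^ n) ^ (1 / p) = ENNReal.ofReal ((L : ℝ) ^ ((n : ℝ) / p)) := by
  rw [← ENNReal.rpow_natCast, ← ENNReal.rpow_mul, mul_one_div, ← ENNReal.ofReal_coe_nnreal,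
    ENNReal.ofReal_rpow_of_nonneg L.coe_nonneg (by positivity)]

/-- A bound for the norm of the pullback of `p`-integrable `k`-forms along a `C`-Lipschitz map
with `L`-Lipschitz inverse. -/
def pullConst (n k : ℕ) (C L : ℝ≥0) (p : ℝ) : ℝ :=
  √(n.choose k : ℝ) * ((C : ℝ) ^ k * (L : ℝ) ^ ((n : ℝ) / p))

lemma IsBiLipschitz.eLpNorm_ofAlt_pull_le (h : IsBiLipschitz C L D V β α) (hV : IsOpen V)
    (hp : 0 < p) {θ : EuclideanSpace ℝ (Fin n) → Alt n k}
    (hθ : AEStronglyMeasurable θ (volume.restrict V)) :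
    eLpNorm (fun x => ofAlt (pull (θ (β x)) (fderiv ℝ β x))) (ENNReal.ofReal p)
      (volume.restrict (D : Set (EuclideanSpace ℝ (Fin n)))) ≤
      ENNReal.ofReal (pullConst n k C L p) *
        eLpNorm θ (ENNReal.ofReal p) (volume.restrict V) := by
  have h1 : eLpNorm (fun x => ofAlt (pull (θ (β x)) (fderiv ℝ β x))) (ENNReal.ofReal p)
      (volume.restrict (D : Set (EuclideanSpace ℝ (Fin n)))) ≤ (Real.toNNReal √(n.choose k : ℝ)) *
      eLpNorm (fun x => pull (θ (β x)) (fderiv ℝ β x)) (ENNReal.ofReal p)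
        (volume.restrict (D : Set (EuclideanSpace ℝ (Fin n)))) := by
    refine eLpNorm_le_mul_of_ae (Eventually.of_forall fun x => ?_)
    rw [Real.coe_toNNReal _ (Real.sqrt_nonneg _)]
    exact norm_ofAlt_le _
  refine (h1.trans (mul_le_mul_right (h.eLpNorm_pull_le D.isOpen hV hp hθ) _)).trans_eq ?_
  rw [pullConst, coe_pow_rpow_eq_ofReal n L hp, ENNReal.ofReal_mul (Real.sqrt_nonneg _), ENNReal.ofReal_mul (by positivity),
    ← NNReal.coe_pow, ENNReal.ofReal_coe_nnreal]
  simp only [mul_assoc]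
  rfl

lemma IsBiLipschitz.memLp_ofAlt_pull (h : IsBiLipschitz C L D V β α) (hV : IsOpen V)
    (hp : 0 < p) {θ : EuclideanSpace ℝ (Fin n) → Alt n k}
    (hθ : MemLp θ (ENNReal.ofReal p) (volume.restrict V)) :
    MemLp (fun x => ofAlt (pull (θ (β x)) (fderiv ℝ β x))) (ENNReal.ofReal p)
      (volume.restrict (D : Set (EuclideanSpace ℝ (Fin n)))) :=
  ⟨ofAlt.continuous.comp_aestronglyMeasurable (h.aestronglyMeasurable_pull D.isOpen hV hθ.1),
    (h.eLpNorm_ofAlt_pull_le hV hp hθ.1).trans_lt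
      (ENNReal.mul_lt_top ENNReal.ofReal_lt_top hθ.2)⟩

lemma IsBiLipschitz.norm_toLp_pull_le [Fact (1 ≤ ENNReal.ofReal p)]
    (h : IsBiLipschitz C L D V β α) (hV : IsOpen V)
    (hp : 0 < p) {θ : EuclideanSpace ℝ (Fin n) → Alt n k}
    (hθ : MemLp θ (ENNReal.ofReal p) (volume.restrict V)) {M : ℝ} (hM : 0 ≤ M)
    (hθM : eLpNorm θ (ENNReal.ofReal p) (volume.restrict V) ≤ ENNReal.ofReal M) :
    ‖((h.memLp_ofAlt_pull hV hp hθ).toLp : LpForm D p k)‖ ≤ pullConst n k C L p * M := by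
  have hc : 0 ≤ pullConst n k C L p := by rw [pullConst]; positivity
  rw [Lp.norm_toLp]
  refine ENNReal.toReal_le_of_le_ofReal (by positivity) ?_
  rw [ENNReal.ofReal_mul hc]
  exact (h.eLpNorm_ofAlt_pull_le hV hp hθ.1).trans (mul_le_mul_right hθM _)

lemma IsBiLipschitz.norm_toLp_pull_sub_le [Fact (1 ≤ ENNReal.ofReal p)]
    (h : IsBiLipschitz C L D V β α) (hV : IsOpen V)
    (hp : 0 < p) {θ θ' : EuclideanSpace ℝ (Fin n) → Alt n k}
    (hθ : MemLp θ (ENNReal.ofReal p) (volume.restrict V))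
    (hθ' : MemLp θ' (ENNReal.ofReal p) (volume.restrict V)) {M : ℝ} (hM : 0 ≤ M)
    (hθM : eLpNorm (fun x => θ x - θ' x) (ENNReal.ofReal p) (volume.restrict V) ≤
      ENNReal.ofReal M) :
    ‖((h.memLp_ofAlt_pull hV hp hθ).toLp : LpForm D p k) -
      (h.memLp_ofAlt_pull hV hp hθ').toLp‖ ≤ pullConst n k C L p * M := by
  have hsub : MemLp (fun x => θ x - θ' x) (ENNReal.ofReal p) (volume.restrict V) := hθ.sub hθ'
  refine le_of_eq_of_le ?_ (h.norm_toLp_pull_le hV hp hsub hM hθM)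
  congr 1

/-- Here `v` represents `α^*u`. Pulling `dθ = v` back by `β` gives a primitive of `β^*α^*u`, which
is `u` almost everywhere by `IsBiLipschitz.ae_pull_pull`. -/
lemma IsBiLipschitz.isWeakD_toLp_pull [Fact (1 ≤ ENNReal.ofReal p)]
    (h : IsBiLipschitz C L D V β α) (hV : IsOpen V)
    (hp : 0 < p) {θ : EuclideanSpace ℝ (Fin n) → Alt n k}
    (hθ : MemLp θ (ENNReal.ofReal p) (volume.restrict V))
    {v : EuclideanSpace ℝ (Fin n) → Alt n (k + 1)}
    (hv : MemLp v (ENNReal.ofReal p) (volume.restrict V)) (hd : AltWeakD V θ v)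
    {u : LpForm D p (k + 1)}
    (hvu : v =ᵐ[volume.restrict V] fun y => pull (toAlt (u (α y))) (fderiv ℝ α y)) :
    IsWeakD D ((h.memLp_ofAlt_pull hV hp hθ).toLp : LpForm D p k) u := by
  rw [isWeakD_iff]
  refine (AltWeakD.pullback D.isOpen hV h.lipschitz h.mapsTo (M := (L : ℝ≥0∞) ^ n)
    (ENNReal.pow_ne_top ENNReal.coe_ne_top)
    (h.map_le D.isOpen.measurableSet hV.measurableSet) (hθ.locallyIntegrable Fact.out)
    (hv.locallyIntegrable Fact.out) hd).congr_ae ?_ ?_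
  · filter_upwards [MemLp.coeFn_toLp (h.memLp_ofAlt_pull hV hp hθ)] with x hx
    rw [hx, toAlt_ofAlt]
  · filter_upwards [h.ae_comp D.isOpen.measurableSet hV.measurableSet hvu,
      h.ae_pull_pull D.isOpen hV fun x => toAlt (u x)] with x hx hx'
    rw [hx, hx']

/-- The transport of a closed form to `V`, extended by zero. -/
lemma IsBiLipschitz.exists_transport [Fact (1 ≤ ENNReal.ofReal p)]
    (h : IsBiLipschitz C L D V β α) (hV : IsOpen V) (hp : 0 < p)
    {u : LpForm D p k} (hu : IsWeakD D u (0 : LpForm D p (k + 1))) :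
    ∃ v : EuclideanSpace ℝ (Fin n) → Alt n k, StronglyMeasurable v ∧ (∀ z, z ∉ V → v z = 0) ∧
      (v =ᵐ[volume.restrict V] fun y => pull (toAlt (u (α y))) (fderiv ℝ α y)) ∧
      AltWeakD V v 0 ∧ eLpNorm v (ENNReal.ofReal p) volume ≤
        ENNReal.ofReal (pullConst n k L C p * k.factorial * ‖u‖) := by
  have hum : AEStronglyMeasurable (fun x => toAlt (u x))
      (volume.restrict (D : Set (EuclideanSpace ℝ (Fin n)))) :=
    toAlt.continuous.comp_aestronglyMeasurable (Lp.aestronglyMeasurable u)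
  have hm := h.symm.aestronglyMeasurable_pull hV D.isOpen hum
  -- The homotopy operator evaluates its argument along segments, so an everywhere defined strongly
  -- measurable representative is fixed.
  obtain ⟨v, hvm, hv0, hae, hvn⟩ := exists_stronglyMeasurable_extension (μ := volume)
    hV.measurableSet hm (ENNReal.ofReal p)
  refine ⟨v, hvm, hv0, hae, ?_, ?_⟩
  · have h0 := AltWeakD.pullback hV D.isOpen h.lipschitz_inv h.mapsTo_inv (M := (C : ℝ≥0∞) ^ n)
      (ENNReal.pow_ne_top ENNReal.coe_ne_top)
      (h.symm.map_le hV.measurableSet D.isOpen.measurableSet) u.locallyIntegrable_toAlt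
      (LpForm.locallyIntegrable_toAlt (0 : LpForm D p (k + 1))) ((isWeakD_iff _ _).1 hu)
    refine h0.congr_ae hae.symm ?_
    filter_upwards [h.symm.ae_comp hV.measurableSet D.isOpen.measurableSet
      (Lp.coeFn_zero (Form n (k + 1)) (ENNReal.ofReal p)
        (volume.restrict (D : Set (EuclideanSpace ℝ (Fin n)))))] with y hy
    rw [hy, Pi.zero_apply, map_zero]
    rfl
  · refine hvn.trans_le ?_
    have h1 : eLpNorm (fun x => toAlt (u x)) (ENNReal.ofReal p)
        (volume.restrict (D : Set (EuclideanSpace ℝ (Fin n)))) ≤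
        (Real.toNNReal (√(n.choose k : ℝ) * k.factorial)) * eLpNorm u (ENNReal.ofReal p)
          (volume.restrict (D : Set (EuclideanSpace ℝ (Fin n)))) := by
      refine eLpNorm_le_mul_of_ae (Eventually.of_forall fun x => ?_)
      rw [Real.coe_toNNReal _ (by positivity)]
      exact norm_toAlt_le _
    refine (h.symm.eLpNorm_pull_le hV D.isOpen hp hum).trans ((mul_le_mul_right
      (mul_le_mul_right h1 _) _).trans_eq ?_)
    have e : pullConst n k L C p * k.factorial * ‖u‖ = (L : ℝ) ^ k * ((C : ℝ) ^ ((n : ℝ) / p) *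
        (√(n.choose k : ℝ) * k.factorial * ‖u‖)) := by
      rw [pullConst]; ring
    rw [e, ENNReal.ofReal_mul (by positivity), ENNReal.ofReal_mul (by positivity),
      ENNReal.ofReal_mul (by positivity), coe_pow_rpow_eq_ofReal n C hp, ← NNReal.coe_pow,
      ENNReal.ofReal_coe_nnreal, Lp.norm_def, ENNReal.ofReal_toReal (Lp.eLpNorm_ne_top u)]
    rfl

end TransferLp

/-! ### Primitives on the domain: bounded ones and precompact ones -/

section Primitive

open Filter Topology

variable {n m : ℕ} {D : TopologicalSpace.Opens (EuclideanSpace ℝ (Fin n))}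
  {c : EuclideanSpace ℝ (Fin n)} {r p : ℝ} {C L : ℝ≥0}
  {β α : EuclideanSpace ℝ (Fin n) → EuclideanSpace ℝ (Fin n)}

lemma eLpNorm_cone_le_ofReal (hp : 1 ≤ p) (hpn : -1 < p * m - n)
    {B : Set (EuclideanSpace ℝ (Fin n))} (hB : MeasurableSet B)
    {μ : Measure (EuclideanSpace ℝ (Fin n))} [IsProbabilityMeasure μ] {R : ℝ} (hR0 : 0 ≤ R)
    (hR : ∀ᵐ y ∂μ, ∀ x ∈ B, ‖x - y‖ ≤ R) {v : EuclideanSpace ℝ (Fin n) → Alt n (m + 1)}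
    (hv : StronglyMeasurable v) {M : ℝ}
    (hM : eLpNorm v (ENNReal.ofReal p) volume ≤ ENNReal.ofReal M) :
    eLpNorm (cone ((volume.restrict (Ioo 0 1)).prod μ) v) (ENNReal.ofReal p) (volume.restrict B) ≤
      ENNReal.ofReal (R * (1 / (p * m - n + 1)) ^ (1 / p) * M) := by
  have hd : 0 < p * m - n + 1 := by linarith
  refine (eLpNorm_cone_le hp hB hR0 hR measurableSet_Ioo subset_rfl hv).trans ?_
  rw [lintegral_rpow_Ioo hpn le_rfl zero_le_one, Real.zero_rpow hd.ne', sub_zero,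
    ENNReal.ofReal_rpow_of_nonneg (by positivity) (by positivity), ← ENNReal.ofReal_mul hR0,
    ENNReal.ofReal_mul (p := R * _) (by positivity)]
  exact mul_le_mul_right hM _

lemma MeasureTheory.MemLp.integrable_of_forall_notMem {X F : Type*} [MeasurableSpace X]
    [NormedAddCommGroup F] {μ : Measure X} {q : ℝ≥0∞} (hq : 1 ≤ q) {s : Set X} (hs : μ s ≠ ∞)
    {v : X → F} (hv : MemLp v q μ) (h0 : ∀ x, x ∉ s → v x = 0) : Integrable v μ := by
  have : Fact (μ s < ∞) := ⟨hs.lt_top⟩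
  exact integrable_of_restrict ((hv.restrict s).integrable hq) h0

lemma norm_sub_le_of_mem_ball (c : EuclideanSpace ℝ (Fin n)) (r : ℝ)
    {x y : EuclideanSpace ℝ (Fin n)} (hx : x ∈ Metric.ball c r) (hy : y ∈ Metric.ball c r) :
    ‖x - y‖ ≤ 2 * r := by
  rw [← dist_eq_norm]
  have := dist_triangle_right x y c
  have h1 := Metric.mem_ball.1 hx
  have h2 := Metric.mem_ball.1 hy
  linarith

/-- The constant in the norm estimate for the primitive of a closed form. -/
def primitiveConst (n m : ℕ) (r p : ℝ) (C L : ℝ≥0) : ℝ :=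
  pullConst n m C L p * (r * (1 / (p * m - n + 1)) ^ (1 / p) *
    (pullConst n (m + 1) L C p * (m + 1).factorial))

variable [Fact (1 ≤ ENNReal.ofReal p)]

/-- The centre of the ball, as a point mass, is the only centre used: then `‖x - c‖ ≤ r` on the
ball, whereas averaging over centres would cost a factor `2`. -/
lemma IsBiLipschitz.exists_primitive (h : IsBiLipschitz C L D (Metric.ball c r) β α) (hr : 0 < r)
    (hp : 1 ≤ p) (hpn : -1 < p * m - n) {u : LpForm D p (m + 1)}
    (hu : IsWeakD D u (0 : LpForm D p (m + 1 + 1))) :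
    ∃ η : LpForm D p m, IsWeakD D η u ∧ ‖η‖ ≤ primitiveConst n m r p C L * ‖u‖ := by
  have hp0 : 0 < p := by linarith
  have hd : 0 < p * m - n + 1 := by linarith
  have hBm : MeasurableSet (Metric.ball c r) := measurableSet_ball
  have hBfin : volume (Metric.ball c r) ≠ ∞ := measure_ball_lt_top.ne
  obtain ⟨v, hvm, hv0, hvu, hvd, hvM⟩ := h.exists_transport Metric.isOpen_ball hp0 hu
  have hvp : MemLp v (ENNReal.ofReal p) :=
    ⟨hvm.aestronglyMeasurable, hvM.trans_lt ENNReal.ofReal_lt_top⟩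
  have hvi : Integrable v := hvp.integrable_of_forall_notMem Fact.out hBfin hv0
  have hR : ∀ᵐ y ∂(Measure.dirac c), ∀ x ∈ Metric.ball c r, ‖x - y‖ ≤ r := by
    rw [ae_dirac_eq]
    intro x hx
    exact (mem_ball_iff_norm.1 hx).le
  have hμ : ∀ᵐ y ∂(Measure.dirac c), y ∈ Metric.ball c r := by
    rw [ae_dirac_eq]
    exact Metric.mem_ball_self hr
  have hle := eLpNorm_cone_le_ofReal hp hpn hBm hr.le hR hvm hvM
  have hθ : MemLp (cone ((volume.restrict (Ioo 0 1)).prod (Measure.dirac c)) v) (ENNReal.ofReal p)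
      (volume.restrict (Metric.ball c r)) :=
    ⟨(stronglyMeasurable_cone _ hvm).aestronglyMeasurable, hle.trans_lt ENNReal.ofReal_lt_top⟩
  have hw := AltWeakD.cone hp hpn hBm (convex_ball c r) hBfin hr.le hR hμ hvm hvi hvp hvd
  refine ⟨(h.memLp_ofAlt_pull Metric.isOpen_ball hp0 hθ).toLp,
    h.isWeakD_toLp_pull Metric.isOpen_ball hp0 hθ (hvp.restrict _) hw hvu, ?_⟩
  refine (h.norm_toLp_pull_le Metric.isOpen_ball hp0 hθ ?_ hle).trans_eq ?_
  · rw [pullConst]; positivity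
  · rw [primitiveConst]; ring

/-- The closed forms in the unit ball have primitives in a totally bounded set. -/
lemma IsBiLipschitz.exists_totallyBounded_primitives
    (h : IsBiLipschitz C L D (Metric.ball c r) β α) (hr : 0 < r)
    (hp : 1 ≤ p) (hpn : -1 < p * m - n) :
    ∃ Q : Set (LpForm D p m), TotallyBounded Q ∧
      (∀ u : LpForm D p (m + 1), IsWeakD D u (0 : LpForm D p (m + 1 + 1)) → ‖u‖ ≤ 1 →
        ∃ η ∈ Q, IsWeakD D η u) ∧
      ∀ η ∈ Q, ∃ u : LpForm D p (m + 1), ‖u‖ ≤ 1 ∧ IsWeakD D η u := by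
  have hp0 : 0 < p := by linarith
  have hBm : MeasurableSet (Metric.ball c r) := measurableSet_ball
  have hBfin : volume (Metric.ball c r) ≠ ∞ := measure_ball_lt_top.ne
  -- Here the averaged operator is used; its worse constant is irrelevant for compactness.
  obtain ⟨φ, hφ0, hφP, hφK, hprob, hφB⟩ := exists_bump_density c hr
  set μ : Measure (EuclideanSpace ℝ (Fin n)) := volume.withDensity fun y => ENNReal.ofReal (φ y)
  have hR : ∀ᵐ y ∂μ, ∀ x ∈ Metric.ball c r, ‖x - y‖ ≤ 2 * r :=
    hφB.mono fun y hy x hx => norm_sub_le_of_mem_ball c r hx hy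
  set ι : Type := {u : LpForm D p (m + 1) // IsWeakD D u (0 : LpForm D p (m + 1 + 1)) ∧ ‖u‖ ≤ 1}
  have hex := fun u : ι => h.exists_transport Metric.isOpen_ball hp0 u.2.1
  choose v hvm hv0 hvu hvd hvM using hex
  set M : ℝ := pullConst n (m + 1) L C p * (m + 1).factorial
  have hM0 : 0 ≤ M := by simp only [M, pullConst]; positivity
  have hvM1 : ∀ u, eLpNorm (v u) (ENNReal.ofReal p) volume ≤ ENNReal.ofReal M := fun u =>
    (hvM u).trans (ENNReal.ofReal_le_ofReal (mul_le_of_le_one_right hM0 u.2.2))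
  have hvp : ∀ u, MemLp (v u) (ENNReal.ofReal p) := fun u =>
    ⟨(hvm u).aestronglyMeasurable, (hvM u).trans_lt ENNReal.ofReal_lt_top⟩
  have hvi : ∀ u, Integrable (v u) := fun u =>
    (hvp u).integrable_of_forall_notMem Fact.out hBfin (hv0 u)
  have hθ : ∀ u, MemLp (cone ((volume.restrict (Ioo 0 1)).prod μ) (v u)) (ENNReal.ofReal p)
      (volume.restrict (Metric.ball c r)) := fun u =>
    ⟨(stronglyMeasurable_cone _ (hvm u)).aestronglyMeasurable,
      (eLpNorm_cone_le_ofReal hp hpn hBm (by positivity) hR (hvm u) (hvM u)).trans_lt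
        ENNReal.ofReal_lt_top⟩
  have hw : ∀ u : ι, IsWeakD D
      ((h.memLp_ofAlt_pull Metric.isOpen_ball hp0 (hθ u)).toLp : LpForm D p m) u.1 := fun u =>
    h.isWeakD_toLp_pull Metric.isOpen_ball hp0 (hθ u) ((hvp u).restrict _)
      (AltWeakD.cone hp hpn hBm (convex_ball c r) hBfin (by positivity) hR hφB (hvm u) (hvi u)
        (hvp u) (hvd u)) (hvu u)
  refine ⟨range fun u : ι =>
    ((h.memLp_ofAlt_pull Metric.isOpen_ball hp0 (hθ u)).toLp : LpForm D p m), ?_, ?_, ?_⟩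
  · refine Metric.totallyBounded_iff.2 fun ε hε => ?_
    set A : ℝ := pullConst n m C L p
    have hA : 0 ≤ A := by simp only [A, pullConst]; positivity
    -- Pulling back to `D` multiplies distances by at most `A`, so nets of this size on the ball
    -- become `ε`-nets.
    have hδ : 0 < ε / (A + 1) := by positivity
    obtain ⟨S, hS, hSi⟩ := exists_finite_net_cone hp hpn hr hφ0 hφP hφK hφB hvm hvi hv0
      ENNReal.ofReal_ne_top hvM1 (ENNReal.ofReal_pos.2 hδ).ne'
    refine ⟨(fun u : ι =>
      ((h.memLp_ofAlt_pull Metric.isOpen_ball hp0 (hθ u)).toLp : LpForm D p m)) '' S,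
      hS.image _, ?_⟩
    rintro _ ⟨i, rfl⟩
    obtain ⟨j, hj, hij⟩ := hSi i
    refine mem_iUnion₂.2 ⟨_, mem_image_of_mem _ hj, ?_⟩
    rw [Metric.mem_ball, dist_eq_norm]
    refine (h.norm_toLp_pull_sub_le Metric.isOpen_ball hp0 (hθ i) (hθ j) hδ.le hij).trans_lt ?_
    calc A * (ε / (A + 1)) < (A + 1) * (ε / (A + 1)) :=
          mul_lt_mul_of_pos_right (by linarith) hδ
      _ = ε := by field_simp
  · exact fun u hu hu1 => ⟨_, ⟨⟨u, hu, hu1⟩, rfl⟩, hw ⟨u, hu, hu1⟩⟩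
  · rintro _ ⟨u, rfl⟩
    exact ⟨u.1, u.2.2, hw u⟩

end Primitive

/-! ### Comparison with the stated constant -/

/-- Since `j + 1 ≤ (n choose j)`, the left side is at most `((n choose j) j!)^2 = (n!/(n-j)!)^2`.
The factor `n - j ≥ 1` and the exponent `(p+1)/p ≥ 1` only enlarge the right side. -/
lemma sqrt_choose_mul_factorial_le {n j : ℕ} (hkn : j + 1 ≤ n) {p : ℝ} (hp : 0 < p) :
    √(n.choose j : ℝ) * (j + 1).factorial ≤
      ((n : ℝ) - j) * ((n.factorial : ℝ) ^ ((p + 1) / p) / ((n - j).factorial : ℝ)) ^ 2 := by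
  have hc : (j : ℝ) + 1 ≤ n.choose j := by
    have := Nat.choose_le_choose j hkn
    rw [Nat.choose_succ_self_right] at this
    exact_mod_cast this
  have hj0 : (0 : ℝ) ≤ j := by positivity
  have hnj : (1 : ℝ) ≤ (n : ℝ) - j := by
    have : (j : ℝ) + 1 ≤ n := by exact_mod_cast hkn
    linarith
  have hf1 : (1 : ℝ) ≤ n.factorial := by exact_mod_cast n.factorial_pos
  have hfj : (1 : ℝ) ≤ j.factorial := by exact_mod_cast j.factorial_pos
  have hfac : (n.choose j : ℝ) * j.factorial ≤
      (n.factorial : ℝ) ^ ((p + 1) / p) / ((n - j).factorial : ℝ) := by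
    rw [le_div_iff₀ (by positivity)]
    have e : (n.choose j : ℝ) * j.factorial * (n - j).factorial = n.factorial := by
      exact_mod_cast Nat.choose_mul_factorial_mul_factorial (by omega : j ≤ n)
    rw [e]
    refine Real.self_le_rpow_of_one_le hf1 ?_
    rw [le_div_iff₀ hp]; linarith
  have hsq : √(n.choose j : ℝ) ≤ n.choose j := by
    rw [Real.sqrt_le_left (by positivity)]
    nlinarith
  have h2 : ((n.choose j : ℝ) * j.factorial) ^ 2 ≤
      ((n : ℝ) - j) * ((n.factorial : ℝ) ^ ((p + 1) / p) / ((n - j).factorial : ℝ)) ^ 2 :=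
    (pow_le_pow_left₀ (by positivity) hfac 2).trans (le_mul_of_one_le_left (by positivity) hnj)
  refine le_trans ?_ h2
  rw [Nat.factorial_succ]
  push_cast
  calc √(n.choose j : ℝ) * (((j : ℝ) + 1) * j.factorial)
      ≤ n.choose j * (n.choose j * (j.factorial * j.factorial)) := by
        refine mul_le_mul hsq (mul_le_mul hc ?_ (by positivity) (by positivity)) (by positivity)
          (by positivity)
        exact le_mul_of_one_le_left (by positivity) hfj
    _ = _ := by ring

/-- The powers of `C` and `L`, the root of `(n choose j+1)` and the denominator match exactly; only
the remaining numerical factor is estimated. -/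
lemma primitiveConst_le {n j : ℕ} (hkn : j + 1 ≤ n) {r p : ℝ} (hr : 0 < r) (hp : 0 < p)
    (hpn : -1 < p * j - n) (C L : ℝ≥0) :
    primitiveConst n j r p C L ≤ r * solutionConst n (j + 1) p *
      (C : ℝ) ^ (j + n / p) * (L : ℝ) ^ (j + 1 + n / p) := by
  have hd : 0 < p * j - n + 1 := by linarith
  have hnj : n - (j + 1) + 1 = n - j := by omega
  have e1 : (C : ℝ) ^ ((j : ℝ) + n / p) = (C : ℝ) ^ j * (C : ℝ) ^ ((n : ℝ) / p) := by
    rw [Real.rpow_add_of_nonneg C.coe_nonneg (by positivity) (by positivity), Real.rpow_natCast]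
  have e2 : (L : ℝ) ^ ((j : ℝ) + 1 + n / p) = (L : ℝ) ^ (j + 1) * (L : ℝ) ^ ((n : ℝ) / p) := by
    rw [Real.rpow_add_of_nonneg L.coe_nonneg (by positivity) (by positivity),
      ← Nat.cast_add_one, Real.rpow_natCast]
  have e3 : (p * (((j + 1 : ℕ) : ℝ) - 1) - n + 1) = p * j - n + 1 := by push_cast; ring
  have e4 : ((n : ℝ) - ((j + 1 : ℕ) : ℝ) + 1) = n - j := by push_cast; ring
  rw [e1, e2, solutionConst, e3, e4, hnj, primitiveConst, pullConst, pullConst,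
    Real.div_rpow zero_le_one hd.le, Real.one_rpow]
  have h := sqrt_choose_mul_factorial_le hkn hp
  set a := √(n.choose j : ℝ)
  set b := √(n.choose (j + 1) : ℝ)
  set q := (p * (j : ℝ) - n + 1) ^ (1 / p)
  have hq : 0 < q := Real.rpow_pos_of_pos hd _
  calc _ = (r * (b / q) * ((C : ℝ) ^ j * (C : ℝ) ^ ((n : ℝ) / p)) *
        ((L : ℝ) ^ (j + 1) * (L : ℝ) ^ ((n : ℝ) / p))) * (a * (j + 1).factorial) := by ring
    _ ≤ _ := mul_le_mul_of_nonneg_left h (by positivity)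
    _ = _ := by ring

/-! ### The solution operator and its compactness -/

section Solution

open Filter Topology

variable {n k : ℕ} {D : TopologicalSpace.Opens (EuclideanSpace ℝ (Fin n))} {p : ℝ}
  [Fact (1 ≤ ENNReal.ofReal p)]

lemma HarmonicSpace.d_injective : Function.Injective (HarmonicSpace.d D p k) :=
  LinearMap.ker_eq_bot.1 (Submodule.ker_liftQ_eq_bot _ _ _ le_rfl)

lemma HarmonicSpace.d_mk (η : SobolevForm D p k) :
    HarmonicSpace.d D p k (Submodule.Quotient.mk η) = SobolevForm.d D p k η := rfl

/-- Injectivity of `d` on the quotient lets the class be represented by whichever primitive suits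
the purpose at hand. -/
lemma HarmonicSpace.eq_mk {q : HarmonicSpace D p k} {u : LpForm D p (k + 1)}
    (hq : HarmonicSpace.d D p k q = u) {η : LpForm D p k} (hη : IsWeakD D η u) :
    q = Submodule.Quotient.mk ⟨η, u, hη⟩ := by
  refine HarmonicSpace.d_injective ?_
  rw [hq, HarmonicSpace.d_mk]
  exact ((SobolevForm.d_eq_iff ⟨η, u, hη⟩ u).2 hη).symm

/-- A bounded right inverse of `d` on the closed forms. -/
lemma exists_solution_operator {A : ℝ}
    (h : ∀ u : LpForm D p (k + 1), IsWeakD D u (0 : LpForm D p (k + 1 + 1)) →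
      ∃ η : LpForm D p k, IsWeakD D η u ∧ ‖η‖ ≤ A * ‖u‖) :
    ∃ 𝒮 : ClosedForm D p (k + 1) →L[ℝ] HarmonicSpace D p k,
      (∀ u : ClosedForm D p (k + 1), HarmonicSpace.d D p k (𝒮 u) = u) ∧ (0 ≤ A → ‖𝒮‖ ≤ A) := by
  have hle : ClosedForm D p (k + 1) ≤ LinearMap.range (HarmonicSpace.d D p k) := by
    intro u hu
    obtain ⟨η, hη, -⟩ := h u hu
    exact ⟨Submodule.Quotient.mk ⟨η, u, hη⟩, (SobolevForm.d_eq_iff ⟨η, u, hη⟩ u).2 hη⟩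
  -- Defined as the inverse of `d`, the operator is linear without a linear choice of primitives.
  set S : ClosedForm D p (k + 1) →ₗ[ℝ] HarmonicSpace D p k :=
    (LinearEquiv.ofInjective (HarmonicSpace.d D p k) HarmonicSpace.d_injective).symm.toLinearMap ∘ₗ
      Submodule.inclusion hle
  have hS : ∀ u : ClosedForm D p (k + 1), HarmonicSpace.d D p k (S u) = u := fun u =>
    LinearEquiv.ofInjective_symm_apply (f := HarmonicSpace.d D p k) (h := HarmonicSpace.d_injective)
      (Submodule.inclusion hle u)
  have hn : ∀ u : ClosedForm D p (k + 1), ‖S u‖ ≤ A * ‖u‖ := by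
    intro u
    obtain ⟨η, hη, hle⟩ := h u u.2
    rw [HarmonicSpace.eq_mk (hS u) hη]
    exact (Submodule.Quotient.norm_mk_le _ _).trans hle
  exact ⟨S.mkContinuous A hn, hS, fun hA => csInf_le ⟨0, fun _ h => h.1⟩ ⟨hA, hn⟩⟩

/-- The closure of `Q` is compact in `L^p`, but `SobolevForm` with the `L^p` norm need not be
complete. The bound on the differentials of elements of `Q` keeps the closure inside it, and the
image in the quotient is then a compact set containing the image of the unit ball. -/
lemma isCompactOperator_of_totallyBounded (hp : 1 < p) {Q : Set (LpForm D p k)}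
    (hQ : TotallyBounded Q)
    (hsurj : ∀ u : LpForm D p (k + 1), IsWeakD D u (0 : LpForm D p (k + 1 + 1)) → ‖u‖ ≤ 1 →
      ∃ η ∈ Q, IsWeakD D η u)
    (hQd : ∀ η ∈ Q, ∃ u : LpForm D p (k + 1), ‖u‖ ≤ 1 ∧ IsWeakD D η u)
    {𝒮 : ClosedForm D p (k + 1) →L[ℝ] HarmonicSpace D p k}
    (h𝒮 : ∀ u : ClosedForm D p (k + 1), HarmonicSpace.d D p k (𝒮 u) = u) :
    IsCompactOperator 𝒮 := by
  have hK : IsCompact (closure Q) := hQ.closure.isCompact_of_isClosed isClosed_closure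
  have hsub : closure Q ⊆ Set.range (Subtype.val : SobolevForm D p k → LpForm D p k) := by
    intro θ hθ
    obtain ⟨u, -, hu⟩ := IsWeakD.exists_of_mem_closure hp (M := 1) (closure_mono hQd hθ)
    exact ⟨⟨θ, u, hu⟩, rfl⟩
  have hK' : IsCompact (Subtype.val ⁻¹' closure Q : Set (SobolevForm D p k)) := by
    rw [Subtype.isCompact_iff]
    exact (image_preimage_eq_of_subset hsub).symm ▸ hK
  refine ⟨_, hK'.image (f := fun η => (Submodule.Quotient.mk η : HarmonicSpace D p k))
    continuous_quot_mk, ?_⟩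
  refine Filter.mem_of_superset (Metric.ball_mem_nhds 0 one_pos) fun u hu => ?_
  rw [mem_ball_zero_iff] at hu
  obtain ⟨η, hηQ, hη⟩ := hsurj u u.2 hu.le
  exact ⟨⟨η, u, hη⟩, subset_closure hηQ, (HarmonicSpace.eq_mk (h𝒮 u) hη).symm⟩

end Solution

/-- For the case `L = C⁻¹` with exponents `a` and `a + 1`. It includes `x = 0`, where positivity of
`a` makes both sides zero. -/
lemma rpow_mul_inv_rpow (x : ℝ) (hx : 0 ≤ x) {a : ℝ} (ha : 0 < a) :
    x ^ a * (x⁻¹) ^ (a + 1) = x⁻¹ := by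
  rcases eq_or_lt_of_le hx with rfl | hx
  · rw [Real.zero_rpow ha.ne', zero_mul, inv_zero]
  · rw [Real.rpow_add_one (inv_pos.2 hx).ne', ← mul_assoc, ← Real.mul_rpow hx.le (by positivity),
      mul_inv_cancel₀ hx.ne', Real.one_rpow, one_mul]

end

/-- Let `2 ≤ j + 1 ≤ n` and write `k = j + 1` for the degree. The instance argument
`1 ≤ p` is implied by `p > (n-1)/(k-1)`. -/
theorem mainTheorem5 (n j : ℕ) (p : ℝ) [Fact (1 ≤ ENNReal.ofReal p)]
    (hk : 2 ≤ j + 1) (hkn : j + 1 ≤ n)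
    (hp : ((n : ℝ) - 1) / (((j + 1 : ℕ) : ℝ) - 1) < p)
    (D : TopologicalSpace.Opens (EuclideanSpace ℝ (Fin n)))
    (c : EuclideanSpace ℝ (Fin n)) (r : ℝ) (hr : 0 < r) (C L : ℝ≥0)
    (β α : EuclideanSpace ℝ (Fin n) → EuclideanSpace ℝ (Fin n))
    (hD : IsBiLipschitz C L (D : Set (EuclideanSpace ℝ (Fin n))) (Metric.ball c r) β α) :
    ∃ 𝒮 : ClosedForm D p (j + 1) →L[ℝ] HarmonicSpace D p j,
      IsCompactOperator 𝒮 ∧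
      (∀ ω : ClosedForm D p (j + 1), HarmonicSpace.d D p j (𝒮 ω) = ω) ∧
      (∀ ω : ClosedForm D p (j + 1), ∃ η : SobolevForm D p j,
        𝒮 ω = Submodule.Quotient.mk η ∧
        SobolevForm.d D p j η = ω ∧
        IsPHarmonic D p (η : LpForm D p j) ∧
        (∀ θ : SobolevForm D p j, SobolevForm.d D p j θ = ω → ‖η‖ ≤ ‖θ‖)) ∧
      ‖𝒮‖ ≤ r * solutionConst n (j + 1) p *
        (C : ℝ) ^ (j + n / p) * (L : ℝ) ^ (j + 1 + n / p) ∧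
      (L = C⁻¹ → ‖𝒮‖ ≤ r * (solutionConst n (j + 1) p / C)) := by
  have hj : (1 : ℝ) ≤ j := by exact_mod_cast (by omega : 1 ≤ j)
  have hjn : (j : ℝ) + 1 ≤ n := by exact_mod_cast hkn
  have hp' : ((n : ℝ) - 1) / j < p := by simpa using hp
  -- `j + 1 ≤ n` makes the lower bound `(n - 1)/j` for `p` at least `1`.
  have hp1 : 1 < p := lt_of_le_of_lt (by rw [le_div_iff₀ (by linarith)]; linarith) hp'
  -- The hypothesis on `p`, cleared of its denominator, is the integrability of `t^{pj-n}` at zero.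
  have hpn : -1 < p * j - n := by
    rw [div_lt_iff₀ (by linarith)] at hp'
    linarith
  obtain ⟨𝒮, h𝒮, hn⟩ := exists_solution_operator fun u hu => hD.exists_primitive hr hp1.le hpn hu
  obtain ⟨Q, hQ, hQs, hQd⟩ := hD.exists_totallyBounded_primitives hr hp1.le hpn
  have hA : 0 ≤ primitiveConst n j r p C L := by
    have : 0 < p * j - n + 1 := by linarith
    simp only [primitiveConst, pullConst]
    positivity
  have hle := (hn hA).trans (primitiveConst_le hkn hr (by linarith) hpn C L)
  refine ⟨𝒮, isCompactOperator_of_totallyBounded hp1 hQ hQs hQd h𝒮, h𝒮, fun ω => ?_, hle, ?_⟩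
  · obtain ⟨θ, hθ, -⟩ := hD.exists_primitive hr hp1.le hpn ω.2
    -- The minimal primitive differs from `θ` by a closed form and so represents the same class `𝒮
    -- ω`.
    obtain ⟨η, hη, hmin⟩ := IsWeakD.exists_minimal hp1 hθ
    refine ⟨⟨η, ω, hη⟩, HarmonicSpace.eq_mk (h𝒮 ω) hη, (SobolevForm.d_eq_iff _ _).2 hη,
      isPHarmonic_of_minimal hp1 hη hmin, fun θ hθ => hmin _ ((SobolevForm.d_eq_iff _ _).1 hθ)⟩
  · rintro rfl
    refine hle.trans_eq ?_
    have hnp : 0 < (j : ℝ) + n / p := by positivity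
    rw [mul_assoc, NNReal.coe_inv, add_right_comm, rpow_mul_inv_rpow _ C.coe_nonneg hnp,
      div_eq_mul_inv, mul_assoc]
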